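/- Let $n\ge 1$, $\lambda,\Lambda>0$, and write $x=(x_1,x')\in\mathbb R\times\mathbb R^{n-1}$, $B_R=\{x\in\mathbb R^n:|x|\le R\}$. There is $\varepsilon_0=\varepsilon_0(n,\lambda,\Lambda)>0$ with the following property. Let $$A(x)=A(x')=\begin{pmatrix}\overline{a_{11}}&0\\0&\widetilde A(x')\end{pmatrix},$$ where $\overline{a_{11}}>0$ is a constant and $\widetilde A=(\widetilde a_{jk})\in C^3(\mathbb R^{n-1})$ is a real symmetric $(n-1)\times(n-1)$ matrix field with $$\|\widetilde A\|_{C^3}:=\sum_{i=1}^3\ \sup_{x',\,|\alpha|=i}\Big(\sum_{j,k}|\partial^\alpha\widetilde a_{jk}(x')|^2\Big)^{1/2}<\infty.$$ Suppose that $\lambda|\xi|^2\le\sum_{j,k}a_{jk}(x)\xi_j\xi_k\le\Lambda|\xi|^2$ for all $x,\xi\in\mathbb R^n$ and that $$\sup_{x'\in\mathbb R^{n-1}}|x'||\nabla_{x'}\widetilde A(x')|\le\varepsilon_0 ,\qquad |\nabla_{x'}\widetilde A|:=\Big(\sum_{l,j,k}|\partial_l\widetilde a_{jk}|^2\Big)^{1/2}.$$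 Let $V\in L^\infty([0,1]\times\mathbb R^n,\mathbb R)$ with $\|V\|_{L^\infty}\le M_1$, and let the complex-valued function $u\in L^\infty([0,1],L^2(\mathbb R^n))\cap L^2([0,1],H^1(\mathbb R^n))$ be a solution, in the sense of distributions on $(0,1)\times\mathbb R^n$, of $$\partial_t u=i\Big(\sum_{j,k=1}^n\partial_k(a_{kj}\partial_j u)+Vu\Big).$$ Let $E_1,E_2,R_0$ be real numbers such that $$\int_{1/8}^{7/8}\int_{\mathbb R^n}(|u|^2+|\nabla u|^2)\,dx\,dt\le E_1^2,\qquad \int_{1/4}^{3/4}\int_{B_{R_0}}|u|^2\,dx\,dt\ge E_2^2>0 .$$ Then there are positive constants $C_0=C_0(n,\lambda,\Lambda,\|\widetilde A\|_{C^3})$, $R_1=R_1(n,\lambda,\Lambda,\|\widetilde A\|_{C^3},M_1,E_1,E_2,R_0)$ and $C_1=C_1(n,\lambda,\Lambda,\|\widetilde A\|_{C^3},M_1,E_1,E_2,R_0)$ such that, for every $R>R_1$, $$\int_{1/8}^{7/8}\int_{B_R\setminus B_{R-1}}(|u|^2+|\nabla u|^2)\,dx\,dt\ \ge\ C_1e^{-C_0R^2}.$$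 The constants $C_0$, $R_1$, $C_1$ can be chosen uniformly over all $\widetilde A$ with $\|\widetilde A\|_{C^3}$ below a given bound. -/

import Mathlib

open MeasureTheory Set
open scoped ENNReal NNReal

noncomputable section

/-- The `k`-th standard unit vector of `ℝⁿ`. -/
def basisVec {n : ℕ} (k : Fin n) : EuclideanSpace ℝ (Fin n) := EuclideanSpace.single k 1

/-- The component `x'` of `x = (x₁, x') ∈ ℝ × ℝᵈ = ℝᵈ⁺¹`. -/
def tailVec {d : ℕ} (x : EuclideanSpace ℝ (Fin (d + 1))) : EuclideanSpace ℝ (Fin d) :=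
  WithLp.toLp 2 (fun i => x i.succ)

/-- The coefficient matrix `A(x) = diag(a, B(x'))` on `ℝᵈ⁺¹`, with a constant `a` in the first
diagonal entry and a `d × d` matrix field `B` depending on `x'` only. -/
def blockCoeff {d : ℕ} (a : ℝ) (B : EuclideanSpace ℝ (Fin d) → Matrix (Fin d) (Fin d) ℝ)
    (x : EuclideanSpace ℝ (Fin (d + 1))) : Matrix (Fin (d + 1)) (Fin (d + 1)) ℝ :=
  Matrix.of (Fin.cons (Fin.cons a (fun _ => 0))
    (fun j => Fin.cons 0 (fun k => B (tailVec x) j k)))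

/-- Boundedness and ellipticity:
`lam |ξ|² ≤ ∑ a_{jk}(x) ξ_j ξ_k ≤ Lam |ξ|²` for all `x` and `ξ`. -/
def IsEllipticField {n : ℕ} (lam Lam : ℝ)
    (A : EuclideanSpace ℝ (Fin n) → Matrix (Fin n) (Fin n) ℝ) : Prop :=
  ∀ x ξ : EuclideanSpace ℝ (Fin n),
    lam * ‖ξ‖ ^ 2 ≤ ∑ j, ∑ k, A x j k * ξ j * ξ k ∧
      ∑ j, ∑ k, A x j k * ξ j * ξ k ≤ Lam * ‖ξ‖ ^ 2

/-- `|∇B|(y) = (∑_{l,j,k} |∂_l b_{jk}(y)|²)^{1/2}`. -/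
def gradNorm {d : ℕ} (B : EuclideanSpace ℝ (Fin d) → Matrix (Fin d) (Fin d) ℝ)
    (y : EuclideanSpace ℝ (Fin d)) : ℝ :=
  Real.sqrt (∑ l, ∑ j, ∑ k, (fderiv ℝ (fun z => B z j k) y (basisVec l)) ^ 2)

/-- `|∂_{s_1} ⋯ ∂_{s_i} B|(y) = (∑_{j,k} |∂_{s_1} ⋯ ∂_{s_i} b_{jk}(y)|²)^{1/2}`. A finite sequence
`s` of directions of length `i` encodes a multi-index of order `i`. -/
def partialNorm {d : ℕ} (B : EuclideanSpace ℝ (Fin d) → Matrix (Fin d) (Fin d) ℝ) {i : ℕ}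
    (s : Fin i → Fin d) (y : EuclideanSpace ℝ (Fin d)) : ℝ :=
  Real.sqrt (∑ j, ∑ k,
    (iteratedFDeriv ℝ i (fun z => B z j k) y (fun l => basisVec (s l))) ^ 2)

/-- `‖B‖_{C³} = ∑_{i=1}^{3} sup_{y, |α| = i} |∂^α B(y)|`, as an extended nonnegative number. -/
def c3Norm {d : ℕ} (B : EuclideanSpace ℝ (Fin d) → Matrix (Fin d) (Fin d) ℝ) : ℝ≥0∞ :=
  ∑ i ∈ Finset.Icc 1 3, ⨆ (y : EuclideanSpace ℝ (Fin d)) (s : Fin i → Fin d),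
    ENNReal.ofReal (partialNorm B s y)

/-- `v ∈ H¹(ℝⁿ; ℂ)` with weak gradient `g`. -/
structure IsH1 {n : ℕ} (v : EuclideanSpace ℝ (Fin n) → ℂ)
    (g : EuclideanSpace ℝ (Fin n) → EuclideanSpace ℂ (Fin n)) : Prop where
  memLp_fun : MemLp v 2 volume
  memLp_grad : MemLp g 2 volume
  weak_deriv : ∀ ψ : EuclideanSpace ℝ (Fin n) → ℂ,
    ContDiff ℝ (⊤ : ℕ∞) ψ → HasCompactSupport ψ → ∀ j : Fin n,
      ∫ x, v x * fderiv ℝ ψ x (basisVec j) = -∫ x, g x j * ψ x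

/-- `u ∈ L^∞([0,1]; L²(ℝⁿ))`. -/
structure MemLinfL2 {n : ℕ} (u : ℝ × EuclideanSpace ℝ (Fin n) → ℂ) : Prop where
  meas : AEStronglyMeasurable u (volume.restrict (Icc (0 : ℝ) 1 ×ˢ univ))
  bound : essSup (fun t => eLpNorm (fun x => u (t, x)) 2 volume)
    (volume.restrict (Icc (0 : ℝ) 1)) < ∞

/-- `u ∈ L²([0,1]; H¹(ℝⁿ))` with spatial weak gradient `Du`. -/
structure MemL2H1 {n : ℕ} (u : ℝ × EuclideanSpace ℝ (Fin n) → ℂ)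
    (Du : ℝ × EuclideanSpace ℝ (Fin n) → EuclideanSpace ℂ (Fin n)) : Prop where
  memLp_fun : MemLp u 2 (volume.restrict (Icc (0 : ℝ) 1 ×ˢ univ))
  memLp_grad : MemLp Du 2 (volume.restrict (Icc (0 : ℝ) 1 ×ˢ univ))
  slice : ∀ᵐ t ∂(volume.restrict (Icc (0 : ℝ) 1)),
    IsH1 (fun x => u (t, x)) (fun x => Du (t, x))

/-- `u`, with spatial weak gradient `Du`, solves `∂_t u = i (∑_{j,k} ∂_k (a_{kj} ∂_j u) + V u)` in
the sense of distributions on `(0,1) × ℝⁿ`. -/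
def IsWeakSolution {n : ℕ} (A : EuclideanSpace ℝ (Fin n) → Matrix (Fin n) (Fin n) ℝ)
    (V : ℝ × EuclideanSpace ℝ (Fin n) → ℝ) (u : ℝ × EuclideanSpace ℝ (Fin n) → ℂ)
    (Du : ℝ × EuclideanSpace ℝ (Fin n) → EuclideanSpace ℂ (Fin n)) : Prop :=
  ∀ φ : ℝ × EuclideanSpace ℝ (Fin n) → ℂ, ContDiff ℝ (⊤ : ℕ∞) φ → HasCompactSupport φ →
    tsupport φ ⊆ Ioo (0 : ℝ) 1 ×ˢ univ →
    -∫ z in Ioo (0 : ℝ) 1 ×ˢ univ, u z * fderiv ℝ φ z (1, 0) =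
      Complex.I * ∫ z in Ioo (0 : ℝ) 1 ×ˢ univ,
        (-(∑ k, ∑ j, (A z.2 k j : ℂ) * Du z j * fderiv ℝ φ z (0, basisVec k))
          + (V z : ℂ) * u z * φ z)

/-- `∬_{I × S} (|u|² + |∇u|²) dx dt`. -/
def energyOn {n : ℕ} (u : ℝ × EuclideanSpace ℝ (Fin n) → ℂ)
    (Du : ℝ × EuclideanSpace ℝ (Fin n) → EuclideanSpace ℂ (Fin n))
    (I : Set ℝ) (S : Set (EuclideanSpace ℝ (Fin n))) : ℝ≥0∞ :=
  ∫⁻ z in I ×ˢ S, (‖u z‖ₑ ^ 2 + ‖Du z‖ₑ ^ 2)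

end

/-!
The lower bound follows from a Carleman inequality with the weight `ψ = κ |x + R φ(t) e₁|²`, where
`φ` rises from `0` to `4` and back inside `[1/8, 7/8]`, `κ` is a fixed large number and `R` is the
radius of the shell. The coefficients do not depend on `x₁` and `A e₁` is a constant multiple of
`e₁`, so the centre `-R φ(t) e₁` of the weight may travel along the `x₁`-axis at no cost: the
derivatives of `A` meet the position vector only through its component `x'`, and the products are
bounded by `|x'| |∇A| ≤ ε₀`. Writing the conjugated operator `e^ψ (i ∂ₜ + L) e^{-ψ}` as a symmetric
plus an antisymmetric part, one finds that its squared norm is at least the commutator form of the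
two parts (`integral_carlemanForm_le`), and that this form is at least `κ³ λ² R² |g|²` where
`|x| ≤ R ≤ |x + R φ(t) e₁|` (`carlemanForm_weight_lower`). The smallness of `ε₀` is needed against
the ellipticity constants only; the bound `K` on two derivatives of `A` and the bounds of `φ'`, `φ''`
enter lower order terms, which a large `κ` absorbs. This gives `carleman_inequality`.

The inequality is applied to `χ u`, with a cutoff `χ` supported where `|x| ≤ R ≤ |x + R φ(t) e₁|` and
`1/8 ≤ t ≤ 7/8` (`exists_localized_carleman`). Three regions matter. On `[1/4, 3/4] × B_{R₀}` the
centre is at `-4 R e₁`, so `|x + R φ e₁| ≥ 3 R` and `e^{2ψ} ≥ e^{18 κ R²}`. Derivatives of `χ` live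
either where `|x + R φ e₁| ≤ 2 R`, with `e^{2ψ} ≤ e^{8 κ R²}`, or in the shell `R - 1 < |x| ≤ R`,
where `|x + R φ e₁| ≤ 5 R` and `e^{2ψ} ≤ e^{50 κ R²}`. The bounded potential is absorbed by the factor
`R²` on the left, the first part of the error by the gap between `e^{18 κ R²}` and `e^{8 κ R²}`, and
what remains is a lower bound of order `e^{-32 κ R²}` for the energy in the shell
(`shell_lower_bound`).

A weak solution has too little regularity for this computation. Its real and imaginary parts,
extended by zero in time, are mollified in space-time; by Friedrichs' lemma (`tendsto_friedrichs`)
the mollified functions solve the equation on `[1/8, 7/8]` up to an error tending to zero in `L²`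
(`tendsto_residual`), so the estimate passes to the limit (`IsRealForm.carleman`).
-/

namespace Carleman

/-! ### Directional derivatives and the differential operators -/

section Calculus

variable {F : Type*} [NormedAddCommGroup F] [NormedSpace ℝ F]

/-- The derivative of `f` at `z` in the direction `v`. -/
noncomputable def dirD (v : F) (f : F → ℝ) (z : F) : ℝ := fderiv ℝ f z v

lemma dirD_add (v : F) {f g : F → ℝ} (hf : Differentiable ℝ f) (hg : Differentiable ℝ g) (z : F) :
    dirD v (fun y => f y + g y) z = dirD v f z + dirD v g z := by
  unfold dirD
  rw [fderiv_fun_add (hf z) (hg z)]; rfl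

lemma dirD_sub (v : F) {f g : F → ℝ} (hf : Differentiable ℝ f) (hg : Differentiable ℝ g) (z : F) :
    dirD v (fun y => f y - g y) z = dirD v f z - dirD v g z := by
  unfold dirD
  rw [fderiv_fun_sub (hf z) (hg z)]; rfl

lemma dirD_neg (v : F) (f : F → ℝ) (z : F) : dirD v (fun y => - f y) z = - dirD v f z := by
  unfold dirD
  rw [fderiv_fun_neg]; rfl

lemma dirD_mul (v : F) {f g : F → ℝ} (hf : Differentiable ℝ f) (hg : Differentiable ℝ g) (z : F) :
    dirD v (fun y => f y * g y) z = dirD v f z * g z + f z * dirD v g z := by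
  unfold dirD
  rw [fderiv_fun_mul (hf z) (hg z)]
  simp
  ring

lemma dirD_const_mul (v : F) (c : ℝ) {f : F → ℝ} (hf : Differentiable ℝ f) (z : F) :
    dirD v (fun y => c * f y) z = c * dirD v f z := by
  unfold dirD
  rw [fderiv_const_mul (hf z)]
  simp

lemma dirD_const (v : F) (c : ℝ) (z : F) : dirD v (fun _ => c) z = 0 := by
  unfold dirD
  simp

lemma dirD_sum {ι : Type*} (s : Finset ι) (v : F) {f : ι → F → ℝ}
    (hf : ∀ i, Differentiable ℝ (f i)) (z : F) :
    dirD v (fun y => ∑ i ∈ s, f i y) z = ∑ i ∈ s, dirD v (f i) z := by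
  unfold dirD
  rw [fderiv_fun_sum (fun i _ => hf i z)]
  simp

lemma dirD_comp (v : F) {f : F → ℝ} {s : ℝ → ℝ} (hs : Differentiable ℝ s)
    (hf : Differentiable ℝ f) (z : F) :
    dirD v (fun y => s (f y)) z = deriv s (f z) * dirD v f z := by
  unfold dirD
  have h := ((hs (f z)).hasDerivAt.comp_hasFDerivAt z (hf z).hasFDerivAt).fderiv
  have h2 : fderiv ℝ (fun y => s (f y)) z = deriv s (f z) • fderiv ℝ f z := h
  rw [h2]; simp

lemma dirD_eq_zero_of_eventuallyEq (v : F) {f : F → ℝ} {c : ℝ} {z : F}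
    (h : f =ᶠ[nhds z] fun _ => c) : dirD v f z = 0 := by
  unfold dirD
  rw [h.fderiv_eq]
  simp

lemma contDiff_dirD {m n : WithTop ℕ∞} (v : F) {f : F → ℝ} (hf : ContDiff ℝ n f)
    (h : m + 1 ≤ n) : ContDiff ℝ m (dirD v f) :=
  (hf.fderiv_right h).clm_apply contDiff_const

lemma dirD_comm (v w : F) {f : F → ℝ} (hf : ContDiff ℝ 2 f) (z : F) :
    dirD v (dirD w f) z = dirD w (dirD v f) z := by
  have hd : DifferentiableAt ℝ (fderiv ℝ f) z :=
    ((hf.fderiv_right (m := 1) (by norm_num)).differentiable (by norm_num)) z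
  have key : ∀ a b : F, dirD a (dirD b f) z = fderiv ℝ (fderiv ℝ f) z a b := by
    intro a b
    unfold dirD
    rw [fderiv_clm_apply hd (by fun_prop)]
    simp
  rw [key, key]
  exact (hf.contDiffAt.isSymmSndFDerivAt (by simp)) v w

lemma hasCompactSupport_dirD (v : F) {f : F → ℝ} (hf : HasCompactSupport f) :
    HasCompactSupport (dirD v f) := hf.fderiv_apply ℝ v

lemma integral_dirD_eq_zero [FiniteDimensional ℝ F] [MeasurableSpace F] [BorelSpace F]
    (μ : Measure F) [μ.IsAddHaarMeasure] (v : F) {f : F → ℝ} (hf : ContDiff ℝ 1 f)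
    (hc : HasCompactSupport f) : ∫ z, dirD v f z ∂μ = 0 := by
  have h1 : Integrable (dirD v f) μ :=
    (contDiff_dirD (m := 0) v hf (by norm_num)).continuous.integrable_of_hasCompactSupport
      (hasCompactSupport_dirD v hc)
  have h2 : Integrable f μ := hf.continuous.integrable_of_hasCompactSupport hc
  have := integral_mul_fderiv_eq_neg_fderiv_mul_of_integrable (μ := μ) (f := fun _ : F => (1 : ℝ))
    (g := f) (v := v) (by simp)
    (by simp only [one_mul]; exact h1) (by simpa using h2)
    (by intros; fun_prop) (fun x _ => hf.differentiable (by norm_num) x)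
  simpa [dirD] using this

end Calculus

section Identity

variable {F : Type*} [NormedAddCommGroup F] [NormedSpace ℝ F] {ι : Type*} [Fintype ι]

/-- The `k`-th component `∑ⱼ a_{kj} ∂ⱼ p` of the flux `A ∇p`, the partial derivatives being taken
along the directions `v`. -/
noncomputable def flux (a : ι → ι → F → ℝ) (v : ι → F) (p : F → ℝ) (k : ι) (z : F) : ℝ :=
  ∑ j, a k j z * dirD (v j) p z

/-- The divergence form operator `L p = ∑ₖ ∂ₖ (∑ⱼ a_{kj} ∂ⱼ p)`. -/
noncomputable def divOp (a : ι → ι → F → ℝ) (v : ι → F) (p : F → ℝ) (z : F) : ℝ :=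
  ∑ k, dirD (v k) (flux a v p k) z

/-- The divergence `∑ₗ ∂ₗ Xₗ`. -/
noncomputable def diverg (v : ι → F) (X : ι → F → ℝ) (z : F) : ℝ := ∑ l, dirD (v l) (X l) z

/-- The multiplier `2 X·∇p + (div X) p`. -/
noncomputable def multOp (v : ι → F) (X : ι → F → ℝ) (p : F → ℝ) (z : F) : ℝ :=
  2 * ∑ l, X l z * dirD (v l) p z + diverg v X z * p z

/-- The density of the commutator of `L` with the multiplier along `X`, tested against `p`. -/
noncomputable def commForm (a : ι → ι → F → ℝ) (v : ι → F) (X : ι → F → ℝ) (p : F → ℝ)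
    (z : F) : ℝ :=
  2 * ∑ k, ∑ l, flux a v p k z * dirD (v k) (X l) z * dirD (v l) p z
    - ∑ l, X l z * ∑ k, ∑ j, dirD (v l) (a k j) z * dirD (v j) p z * dirD (v k) p z
    + (∑ k, flux a v p k z * dirD (v k) (diverg v X) z) * p z

variable {a : ι → ι → F → ℝ} {v : ι → F} {X : ι → F → ℝ} {p q : F → ℝ}

lemma contDiff_flux {m : WithTop ℕ∞} (ha : ∀ i j, ContDiff ℝ m (a i j)) (hp : ContDiff ℝ (m + 1) p)
    (k : ι) : ContDiff ℝ m (flux a v p k) :=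
  ContDiff.sum fun j _ => (ha k j).mul (contDiff_dirD _ hp le_rfl)

lemma contDiff_diverg {m : WithTop ℕ∞} (hX : ∀ i, ContDiff ℝ (m + 1) (X i)) :
    ContDiff ℝ m (diverg v X) :=
  ContDiff.sum fun j _ => (contDiff_dirD _ (hX j) le_rfl)

lemma contDiff_multOp {m : WithTop ℕ∞} (hX : ∀ i, ContDiff ℝ (m + 1) (X i))
    (hp : ContDiff ℝ (m + 1) p) : ContDiff ℝ m (multOp v X p) := by
  have h := contDiff_diverg (v := v) hX
  have h1 : ∀ i, ContDiff ℝ m (X i) := fun i => (hX i).of_le le_self_add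
  have h2 : ContDiff ℝ m p := hp.of_le le_self_add
  have h3 : ∀ i, ContDiff ℝ m (dirD (v i) p) := fun i => contDiff_dirD _ hp le_rfl
  unfold multOp
  exact (contDiff_const.mul (ContDiff.sum fun j _ => (h1 j).mul (h3 j))).add (h.mul h2)

/-- Rellich-type identity: `-(L p)(2 X·∇p + (div X) p)` is the commutator density up to a
divergence. -/
lemma neg_divOp_mul_multOp (hs : ∀ i j, a i j = a j i) (ha : ∀ i j, ContDiff ℝ 2 (a i j))
    (hX : ∀ i, ContDiff ℝ 2 (X i)) (hp : ContDiff ℝ 2 p) (z : F) :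
    -(divOp a v p z * multOp v X p z) = commForm a v X p z
      + ∑ k, dirD (v k) (fun y => X k y * (∑ i, ∑ j, a i j y * dirD (v i) p y * dirD (v j) p y)
          - flux a v p k y * multOp v X p y) z := by
  have da : ∀ i j, Differentiable ℝ (a i j) := fun i j => (ha i j).differentiable (by norm_num)
  have dX : ∀ i, Differentiable ℝ (X i) := fun i => (hX i).differentiable (by norm_num)
  have dp : Differentiable ℝ p := hp.differentiable (by norm_num)
  have dpj : ∀ j, Differentiable ℝ (dirD (v j) p) := fun j =>
    (contDiff_dirD (m := 1) _ hp (by norm_num)).differentiable (by norm_num)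
  have dP : ∀ k, Differentiable ℝ (flux a v p k) := fun k =>
    (contDiff_flux (m := 1) (fun i j => (ha i j).of_le (by norm_num))
      (hp.of_le (by norm_num)) k).differentiable (by norm_num)
  have dD : Differentiable ℝ (diverg v X) :=
    (contDiff_diverg (m := 1) (fun i => (hX i).of_le (by norm_num))).differentiable (by norm_num)
  have dM : Differentiable ℝ (multOp v X p) :=
    (contDiff_multOp (m := 1) (fun i => (hX i).of_le (by norm_num))
      (hp.of_le (by norm_num))).differentiable (by norm_num)
  have eM : ∀ k, dirD (v k) (multOp v X p) z =
      2 * ∑ l, (dirD (v k) (X l) z * dirD (v l) p z + X l z * dirD (v k) (dirD (v l) p) z)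
      + (dirD (v k) (diverg v X) z * p z + diverg v X z * dirD (v k) p z) := by
    intro k
    unfold multOp
    rw [dirD_add _ (by fun_prop) (by fun_prop), dirD_const_mul _ _ (by fun_prop),
      dirD_sum _ _ (by fun_prop), dirD_mul _ dD dp]
    simp_rw [dirD_mul _ (dX _) (dpj _)]
  have ee : ∀ k, dirD (v k) (fun y => ∑ i, ∑ j, a i j y * dirD (v i) p y * dirD (v j) p y) z =
      (∑ i, ∑ j, dirD (v k) (a i j) z * dirD (v i) p z * dirD (v j) p z)
      + 2 * ∑ i, flux a v p i z * dirD (v i) (dirD (v k) p) z := by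
    intro k
    rw [dirD_sum _ _ (by fun_prop)]
    have : ∀ i, dirD (v k) (fun y => ∑ j, a i j y * dirD (v i) p y * dirD (v j) p y) z =
        ∑ j, (dirD (v k) (a i j) z * dirD (v i) p z * dirD (v j) p z
          + a i j z * dirD (v k) (dirD (v i) p) z * dirD (v j) p z
          + a i j z * dirD (v i) p z * dirD (v k) (dirD (v j) p) z) := by
      intro i
      rw [dirD_sum _ _ (by fun_prop)]
      refine Finset.sum_congr rfl fun j _ => ?_
      rw [dirD_mul _ (by fun_prop) (by fun_prop), dirD_mul _ (by fun_prop) (by fun_prop)]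
      ring
    simp_rw [this, Finset.sum_add_distrib]
    have h1 : ∑ i, ∑ j, a i j z * dirD (v k) (dirD (v i) p) z * dirD (v j) p z =
        ∑ i, flux a v p i z * dirD (v i) (dirD (v k) p) z := by
      refine Finset.sum_congr rfl fun i _ => ?_
      unfold flux
      rw [Finset.sum_mul]
      refine Finset.sum_congr rfl fun j _ => ?_
      rw [dirD_comm _ _ hp]; ring
    have h2 : ∑ i, ∑ j, a i j z * dirD (v i) p z * dirD (v k) (dirD (v j) p) z =
        ∑ i, flux a v p i z * dirD (v i) (dirD (v k) p) z := by
      rw [Finset.sum_comm, ← h1]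
      refine Finset.sum_congr rfl fun i _ => Finset.sum_congr rfl fun j _ => ?_
      rw [hs j i]; ring
    rw [h1, h2]; ring
  have eY : ∀ k, dirD (v k) (fun y => X k y *
      (∑ i, ∑ j, a i j y * dirD (v i) p y * dirD (v j) p y)
          - flux a v p k y * multOp v X p y) z =
      dirD (v k) (X k) z * (∑ i, ∑ j, a i j z * dirD (v i) p z * dirD (v j) p z)
      + X k z * (∑ i, ∑ j, dirD (v k) (a i j) z * dirD (v i) p z * dirD (v j) p z)
      + 2 * (X k z * ∑ i, flux a v p i z * dirD (v i) (dirD (v k) p) z)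
      - dirD (v k) (flux a v p k) z * multOp v X p z
      - 2 * ∑ l, flux a v p k z * dirD (v k) (X l) z * dirD (v l) p z
      - 2 * (flux a v p k z * ∑ l, X l z * dirD (v k) (dirD (v l) p) z)
      - flux a v p k z * dirD (v k) (diverg v X) z * p z
      - diverg v X z * (flux a v p k z * dirD (v k) p z) := by
    intro k
    rw [dirD_sub _ (by fun_prop) (by fun_prop), dirD_mul _ (by fun_prop) (by fun_prop),
      dirD_mul _ (by fun_prop) (by fun_prop), ee, eM]
    simp_rw [Finset.sum_add_distrib, mul_assoc, ← Finset.mul_sum]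
    ring
  simp only [eY, Finset.sum_add_distrib, Finset.sum_sub_distrib, ← Finset.mul_sum,
    ← Finset.sum_mul]
  have k1 : ∑ i, X i z * ∑ j, flux a v p j z * dirD (v j) (dirD (v i) p) z =
      ∑ i, flux a v p i z * ∑ j, X j z * dirD (v i) (dirD (v j) p) z := by
    simp_rw [Finset.mul_sum]
    rw [Finset.sum_comm]
    refine Finset.sum_congr rfl fun i _ => Finset.sum_congr rfl fun j _ => ?_
    ring
  have k2 : ∑ i, flux a v p i z * dirD (v i) p z =
      ∑ i, ∑ j, a i j z * dirD (v i) p z * dirD (v j) p z := by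
    refine Finset.sum_congr rfl fun i _ => ?_
    unfold flux
    rw [Finset.sum_mul]
    exact Finset.sum_congr rfl fun j _ => by ring
  have k3 : ∑ l, X l z * ∑ k, ∑ j, dirD (v l) (a k j) z * dirD (v j) p z * dirD (v k) p z =
      ∑ l, X l z * ∑ k, ∑ j, dirD (v l) (a k j) z * dirD (v k) p z * dirD (v j) p z := by
    refine Finset.sum_congr rfl fun i _ => ?_
    congr 1
    exact Finset.sum_congr rfl fun i _ => Finset.sum_congr rfl fun j _ => by ring
  unfold commForm
  rw [k1, k2, k3]
  unfold divOp
  have k4 : diverg v X z = ∑ l, dirD (v l) (X l) z := rfl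
  rw [k4]
  ring

/-- The zeroth order part `-Q p (2 X·∇p + (div X) p)` of the identity. -/
lemma neg_mul_multOp {Q : F → ℝ} (hX : ∀ i, ContDiff ℝ 2 (X i)) (hp : ContDiff ℝ 2 p)
    (hQ : Differentiable ℝ Q) (z : F) :
    -(Q z * p z * multOp v X p z) = (∑ l, X l z * dirD (v l) Q z) * p z ^ 2
      + ∑ k, dirD (v k) (fun y => -(X k y * (Q y * (p y * p y)))) z := by
  have dX : ∀ i, Differentiable ℝ (X i) := fun i => (hX i).differentiable (by norm_num)
  have dp : Differentiable ℝ p := hp.differentiable (by norm_num)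
  have e : ∀ k, dirD (v k) (fun y => -(X k y * (Q y * (p y * p y)))) z =
      -(dirD (v k) (X k) z * (Q z * (p z * p z))) - X k z * dirD (v k) Q z * (p z ^ 2)
        - (X k z * dirD (v k) p z) * (2 * Q z * p z) := by
    intro k
    rw [dirD_neg, dirD_mul _ (by fun_prop) (by fun_prop), dirD_mul _ (by fun_prop) (by fun_prop),
      dirD_mul _ (by fun_prop) (by fun_prop)]
    ring
  simp only [e, Finset.sum_sub_distrib, Finset.sum_neg_distrib, ← Finset.sum_mul]
  unfold multOp diverg
  ring

/-- The contribution of the time derivative to the identity. -/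
lemma time_mul_multOp (τ : F) (hX : ∀ i, ContDiff ℝ 2 (X i)) (hp : ContDiff ℝ 2 p)
    (hq : ContDiff ℝ 2 q) (z : F) :
    dirD τ q z * multOp v X p z - dirD τ p z * multOp v X q z =
      ∑ l, dirD τ (X l) z * (p z * dirD (v l) q z - q z * dirD (v l) p z)
      + ∑ l, dirD (v l) (fun y => X l y * (p y * dirD τ q y - q y * dirD τ p y)) z
      + dirD τ (fun y => ∑ l, X l y * (q y * dirD (v l) p y - p y * dirD (v l) q y)) z := by
  have dX : ∀ i, Differentiable ℝ (X i) := fun i => (hX i).differentiable (by norm_num)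
  have dp : Differentiable ℝ p := hp.differentiable (by norm_num)
  have dq : Differentiable ℝ q := hq.differentiable (by norm_num)
  have dpw : ∀ w, Differentiable ℝ (dirD w p) := fun j =>
    (contDiff_dirD (m := 1) _ hp (by norm_num)).differentiable (by norm_num)
  have dqw : ∀ w, Differentiable ℝ (dirD w q) := fun j =>
    (contDiff_dirD (m := 1) _ hq (by norm_num)).differentiable (by norm_num)
  have e1 : ∀ l, dirD (v l) (fun y => X l y * (p y * dirD τ q y - q y * dirD τ p y)) z =
      dirD (v l) (X l) z * (p z * dirD τ q z - q z * dirD τ p z)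
      + X l z * (dirD (v l) p z * dirD τ q z + p z * dirD (v l) (dirD τ q) z
        - dirD (v l) q z * dirD τ p z - q z * dirD (v l) (dirD τ p) z) := by
    intro l
    rw [dirD_mul _ (by fun_prop) (by fun_prop), dirD_sub _ (by fun_prop) (by fun_prop),
      dirD_mul _ (by fun_prop) (by fun_prop), dirD_mul _ (by fun_prop) (by fun_prop)]
    ring
  have e2 : dirD τ (fun y => ∑ l, X l y * (q y * dirD (v l) p y - p y * dirD (v l) q y)) z =
      ∑ l, (dirD τ (X l) z * (q z * dirD (v l) p z - p z * dirD (v l) q z)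
      + X l z * (dirD τ q z * dirD (v l) p z + q z * dirD τ (dirD (v l) p) z
        - dirD τ p z * dirD (v l) q z - p z * dirD τ (dirD (v l) q) z)) := by
    rw [dirD_sum _ _ (by fun_prop)]
    refine Finset.sum_congr rfl fun l _ => ?_
    rw [dirD_mul _ (by fun_prop) (by fun_prop), dirD_sub _ (by fun_prop) (by fun_prop),
      dirD_mul _ (by fun_prop) (by fun_prop), dirD_mul _ (by fun_prop) (by fun_prop)]
    ring
  rw [e2]
  simp only [e1]
  unfold multOp diverg
  simp only [Finset.mul_sum, Finset.sum_mul, mul_add, ← Finset.sum_add_distrib,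
    ← Finset.sum_sub_distrib]
  refine Finset.sum_congr rfl fun l _ => ?_
  rw [dirD_comm τ (v l) hp, dirD_comm τ (v l) hq]
  ring

/-- The contribution of the pairing of `L` with multiplication by `2 i g`. -/
lemma mul_divOp_sub (hs : ∀ i j, a i j = a j i) (ha : ∀ i j, ContDiff ℝ 2 (a i j))
    (hp : ContDiff ℝ 2 p) (hq : ContDiff ℝ 2 q) {g : F → ℝ} (hg : Differentiable ℝ g) (z : F) :
    2 * g z * (q z * divOp a v p z - p z * divOp a v q z) =
      ∑ l, 2 * (∑ k, a l k z * dirD (v k) g z) * (p z * dirD (v l) q z - q z * dirD (v l) p z)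
      + ∑ k, dirD (v k) (fun y => 2 * (g y * (q y * flux a v p k y - p y * flux a v q k y))) z := by
  have dp : Differentiable ℝ p := hp.differentiable (by norm_num)
  have dq : Differentiable ℝ q := hq.differentiable (by norm_num)
  have dP : ∀ k, Differentiable ℝ (flux a v p k) := fun k =>
    (contDiff_flux (m := 1) (fun i j => (ha i j).of_le (by norm_num))
      (hp.of_le (by norm_num)) k).differentiable (by norm_num)
  have dQ : ∀ k, Differentiable ℝ (flux a v q k) := fun k =>
    (contDiff_flux (m := 1) (fun i j => (ha i j).of_le (by norm_num))
      (hq.of_le (by norm_num)) k).differentiable (by norm_num)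
  have e : ∀ k, dirD (v k) (fun y => 2 * (g y * (q y * flux a v p k y - p y * flux a v q k y))) z =
      2 * (dirD (v k) g z * (q z * flux a v p k z - p z * flux a v q k z))
      + 2 * g z * (dirD (v k) q z * flux a v p k z) - 2 * g z * (dirD (v k) p z * flux a v q k z)
      + 2 * g z * q z * dirD (v k) (flux a v p k) z
      - 2 * g z * p z * dirD (v k) (flux a v q k) z := by
    intro k
    rw [dirD_const_mul _ _ (by fun_prop), dirD_mul _ (by fun_prop) (by fun_prop),
      dirD_sub _ (by fun_prop) (by fun_prop),
      dirD_mul _ (by fun_prop) (by fun_prop), dirD_mul _ (by fun_prop) (by fun_prop)]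
    ring
  have sym : ∑ k, dirD (v k) q z * flux a v p k z = ∑ k, dirD (v k) p z * flux a v q k z := by
    unfold flux
    simp_rw [Finset.mul_sum]
    rw [Finset.sum_comm]
    refine Finset.sum_congr rfl fun i _ => Finset.sum_congr rfl fun j _ => ?_
    rw [hs i j]; ring
  have h1 : ∀ f : F → ℝ, ∑ l, (∑ k, a l k z * dirD (v k) g z) * dirD (v l) f z =
      ∑ k, dirD (v k) g z * flux a v f k z := by
    intro f
    unfold flux
    simp_rw [Finset.mul_sum, Finset.sum_mul]
    rw [Finset.sum_comm]
    refine Finset.sum_congr rfl fun i _ => Finset.sum_congr rfl fun j _ => ?_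
    rw [hs i j]; ring
  have h2 : ∑ l, 2 * (∑ k, a l k z * dirD (v k) g z)
        * (p z * dirD (v l) q z - q z * dirD (v l) p z) =
      2 * p z * ∑ k, dirD (v k) g z * flux a v q k z
        - 2 * q z * ∑ k, dirD (v k) g z * flux a v p k z := by
    rw [← h1, ← h1, Finset.mul_sum, Finset.mul_sum, ← Finset.sum_sub_distrib]
    exact Finset.sum_congr rfl fun l _ => by ring
  have h3 : ∑ k, dirD (v k) g z * (q z * flux a v p k z - p z * flux a v q k z) =
      q z * ∑ k, dirD (v k) g z * flux a v p k z - p z * ∑ k, dirD (v k) g z * flux a v q k z := by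
    rw [Finset.mul_sum, Finset.mul_sum, ← Finset.sum_sub_distrib]
    exact Finset.sum_congr rfl fun l _ => by ring
  rw [h2]
  simp only [e, Finset.sum_sub_distrib, Finset.sum_add_distrib, ← Finset.mul_sum]
  rw [sym, h3]
  unfold divOp
  ring

/-- The `l`-th component `2 ∑ₘ a_{lm} ∂ₘ ψ` of the multiplier field attached to a weight `ψ`. -/
noncomputable def weightField (a : ι → ι → F → ℝ) (v : ι → F) (ψ : F → ℝ) (l : ι) (z : F) : ℝ :=
  2 * flux a v ψ l z

/-- The potential `A∇ψ·∇ψ` produced by conjugation with `e^ψ`. -/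
noncomputable def weightPot (a : ι → ι → F → ℝ) (v : ι → F) (ψ : F → ℝ) (z : F) : ℝ :=
  ∑ j, ∑ k, a j k z * dirD (v j) ψ z * dirD (v k) ψ z

/-- The real part of the conjugated operator `e^ψ (i ∂_τ + L) e^{-ψ}` applied to `p + i q`. The
imaginary part is obtained by applying it to `q` and `-p`. -/
noncomputable def conjOp (a : ι → ι → F → ℝ) (v : ι → F) (τ : F) (ψ p q : F → ℝ) (z : F) : ℝ :=
  -dirD τ q z + divOp a v p z + weightPot a v ψ z * p z
    - multOp v (weightField a v ψ) p z / 2 + dirD τ ψ z * q z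

/-- The density of the quadratic form of the commutator of the symmetric and antisymmetric parts of
the conjugated operator. -/
noncomputable def carlemanForm (a : ι → ι → F → ℝ) (v : ι → F) (τ : F) (ψ p q : F → ℝ)
    (z : F) : ℝ :=
  commForm a v (weightField a v ψ) p z + commForm a v (weightField a v ψ) q z
    + 2 * ∑ l, dirD τ (weightField a v ψ l) z * (p z * dirD (v l) q z - q z * dirD (v l) p z)
    + (dirD τ (dirD τ ψ) z + ∑ l, weightField a v ψ l z * dirD (v l) (weightPot a v ψ) z)
      * (p z ^ 2 + q z ^ 2)

end Identity

/-! ### The integrated Carleman form -/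

section IntegratedIdentity

variable {F : Type*} [NormedAddCommGroup F] [NormedSpace ℝ F] {ι : Type*} [Fintype ι]
variable {a : ι → ι → F → ℝ} {v : ι → F} {τ : F} {ψ p q : F → ℝ}

lemma eventually_eq_zero_of_notMem_tsupport {F : Type*} [TopologicalSpace F] {f : F → ℝ} {z : F}
    (hz : z ∉ tsupport f) : f =ᶠ[nhds z] fun _ => 0 := by
  filter_upwards [(isClosed_tsupport f).isOpen_compl.mem_nhds hz] with y hy
  exact image_eq_zero_of_notMem_tsupport hy

lemma dirD_eq_zero_of_notMem_tsupport (w : F) {f : F → ℝ} {z : F} (hz : z ∉ tsupport f) :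
    dirD w f z = 0 :=
  dirD_eq_zero_of_eventuallyEq w (eventually_eq_zero_of_notMem_tsupport hz)

lemma flux_eq_zero_of_notMem_tsupport {z : F} (hz : z ∉ tsupport p) (k : ι) :
    flux a v p k z = 0 := by
  simp [flux, dirD_eq_zero_of_notMem_tsupport _ hz]

lemma divOp_eq_zero_of_notMem_tsupport {z : F} (hz : z ∉ tsupport p) :
    divOp a v p z = 0 := by
  refine Finset.sum_eq_zero fun k _ => dirD_eq_zero_of_eventuallyEq (c := 0) _ ?_
  filter_upwards [(isClosed_tsupport p).isOpen_compl.mem_nhds hz] with y hy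
  exact flux_eq_zero_of_notMem_tsupport hy k

lemma multOp_eq_zero_of_notMem_tsupport {X : ι → F → ℝ} {z : F} (hz : z ∉ tsupport p) :
    multOp v X p z = 0 := by
  simp [multOp, dirD_eq_zero_of_notMem_tsupport _ hz, image_eq_zero_of_notMem_tsupport hz]

lemma conjOp_eq_zero {z : F} (hz : z ∉ tsupport p) (hz' : z ∉ tsupport q) :
    conjOp a v τ ψ p q z = 0 := by
  simp [conjOp, dirD_eq_zero_of_notMem_tsupport _ hz', image_eq_zero_of_notMem_tsupport hz,
    image_eq_zero_of_notMem_tsupport hz', divOp_eq_zero_of_notMem_tsupport hz,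
    multOp_eq_zero_of_notMem_tsupport hz]

lemma carlemanForm_eq_zero {z : F} (hz : z ∉ tsupport p) (hz' : z ∉ tsupport q) :
    carlemanForm a v τ ψ p q z = 0 := by
  simp [carlemanForm, commForm, dirD_eq_zero_of_notMem_tsupport _ hz,
    dirD_eq_zero_of_notMem_tsupport _ hz',
    image_eq_zero_of_notMem_tsupport hz, image_eq_zero_of_notMem_tsupport hz']

lemma contDiff_weightField {m : WithTop ℕ∞} (ha : ∀ i j, ContDiff ℝ m (a i j))
    (hψ : ContDiff ℝ (m + 1) ψ) (k : ι) : ContDiff ℝ m (weightField a v ψ k) :=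
  contDiff_const.mul (contDiff_flux ha hψ k)

lemma contDiff_weightPot {m : WithTop ℕ∞} (ha : ∀ i j, ContDiff ℝ m (a i j))
    (hψ : ContDiff ℝ (m + 1) ψ) : ContDiff ℝ m (weightPot a v ψ) :=
  ContDiff.sum fun j _ => ContDiff.sum fun k _ =>
    ((ha j k).mul (contDiff_dirD _ hψ le_rfl)).mul (contDiff_dirD _ hψ le_rfl)

lemma dirD_weightField (hτ : ∀ i j z, dirD τ (a i j) z = 0) (ha : ∀ i j, ContDiff ℝ 2 (a i j))
    (hψ : ContDiff ℝ 3 ψ) (l : ι) (z : F) :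
    dirD τ (weightField a v ψ l) z = 2 * ∑ k, a l k z * dirD (v k) (dirD τ ψ) z := by
  have da : ∀ i j, Differentiable ℝ (a i j) := fun i j => (ha i j).differentiable (by norm_num)
  have dψ : ∀ k, Differentiable ℝ (dirD (v k) ψ) := fun j =>
    (contDiff_dirD (m := 2) _ hψ (by norm_num)).differentiable (by norm_num)
  have hf : Differentiable ℝ (flux a v ψ l) :=
    (contDiff_flux (m := 2) ha (hψ.of_le (by norm_num)) l).differentiable (by norm_num)
  unfold weightField
  rw [dirD_const_mul _ _ hf]
  unfold flux
  rw [dirD_sum _ _ (by fun_prop)]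
  congr 1
  refine Finset.sum_congr rfl fun k _ => ?_
  rw [dirD_mul _ (by fun_prop) (by fun_prop), hτ, dirD_comm _ _ (hψ.of_le (by norm_num))]
  ring

/-- The squared modulus of the conjugated operator dominates the commutator density up to terms of
vanishing integral: with `S` and `T` its symmetric and antisymmetric parts,
`|S g + T g|² ≥ 2 Re (S g, T g)`. -/
lemma integral_carlemanForm_le [FiniteDimensional ℝ F] [MeasurableSpace F] [BorelSpace F]
    (μ : Measure F) [μ.IsAddHaarMeasure]
    (hs : ∀ i j, a i j = a j i) (hτ : ∀ i j z, dirD τ (a i j) z = 0)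
    (ha : ∀ i j, ContDiff ℝ 2 (a i j)) (hψ : ContDiff ℝ 3 ψ)
    (hp : ContDiff ℝ 2 p) (hq : ContDiff ℝ 2 q) (hpc : HasCompactSupport p)
    (hqc : HasCompactSupport q) :
    Integrable (carlemanForm a v τ ψ p q) μ ∧
    Integrable (fun z => conjOp a v τ ψ p q z ^ 2 + conjOp a v τ ψ q (fun y => -p y) z ^ 2) μ ∧
    ∫ z, carlemanForm a v τ ψ p q z ∂μ ≤
      ∫ z, conjOp a v τ ψ p q z ^ 2 + conjOp a v τ ψ q (fun y => -p y) z ^ 2 ∂μ := by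
  set X := weightField a v ψ with hXdef
  set Q := weightPot a v ψ with hQdef
  have hX : ∀ i, ContDiff ℝ 2 (X i) := contDiff_weightField ha (hψ.of_le (by norm_num))
  have hQ : ContDiff ℝ 2 Q := contDiff_weightPot ha (hψ.of_le (by norm_num))
  have hg : ContDiff ℝ 2 (dirD τ ψ) := contDiff_dirD _ hψ (by norm_num)
  have hgt : ContDiff ℝ 1 (dirD τ (dirD τ ψ)) := contDiff_dirD _ hg (by norm_num)
  have hQd : ∀ w, ContDiff ℝ 1 (dirD w Q) := fun w => contDiff_dirD _ hQ (by norm_num)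
  have hXd : ∀ w i, ContDiff ℝ 1 (dirD w (X i)) := fun w i => contDiff_dirD _ (hX i) (by norm_num)
  have hpd : ∀ w, ContDiff ℝ 1 (dirD w p) := fun w => contDiff_dirD _ hp (by norm_num)
  have hqd : ∀ w, ContDiff ℝ 1 (dirD w q) := fun w => contDiff_dirD _ hq (by norm_num)
  have hnp : ContDiff ℝ 2 (fun y => -p y) := hp.neg
  have hnpd : ∀ w, ContDiff ℝ 1 (dirD w (fun y => -p y)) :=
    fun w => contDiff_dirD _ hnp (by norm_num)
  have had : ∀ w i j, ContDiff ℝ 1 (dirD w (a i j)) :=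
    fun w i j => contDiff_dirD _ (ha i j) (by norm_num)
  have hP : ∀ k, ContDiff ℝ 1 (flux a v p k) :=
    contDiff_flux (fun i j => (ha i j).of_le (by norm_num)) (hp.of_le (by norm_num))
  have hR : ∀ k, ContDiff ℝ 1 (flux a v q k) :=
    contDiff_flux (fun i j => (ha i j).of_le (by norm_num)) (hq.of_le (by norm_num))
  have hD : ContDiff ℝ 1 (diverg v X) :=
    contDiff_diverg (fun i => (hX i).of_le (by norm_num))
  have hMp : ContDiff ℝ 1 (multOp v X p) :=
    contDiff_multOp (fun i => (hX i).of_le (by norm_num)) (hp.of_le (by norm_num))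
  have hMq : ContDiff ℝ 1 (multOp v X q) :=
    contDiff_multOp (fun i => (hX i).of_le (by norm_num)) (hq.of_le (by norm_num))
  have hDd : ∀ w, Continuous (dirD w (diverg v X)) :=
    fun w => (contDiff_dirD (m := 0) w hD (by norm_num)).continuous
  have hPd : ∀ w k, Continuous (dirD w (flux a v p k)) :=
    fun w k => (contDiff_dirD (m := 0) w (hP k) (by norm_num)).continuous
  have hRd : ∀ w k, Continuous (dirD w (flux a v q k)) :=
    fun w k => (contDiff_dirD (m := 0) w (hR k) (by norm_num)).continuous
  have ha1 : ∀ i j, ContDiff ℝ 1 (a i j) := fun i j => (ha i j).of_le (by norm_num)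
  have hX1 : ∀ i, ContDiff ℝ 1 (X i) := fun i => (hX i).of_le (by norm_num)
  have hp1 : ContDiff ℝ 1 p := hp.of_le (by norm_num)
  have hq1 : ContDiff ℝ 1 q := hq.of_le (by norm_num)
  have hQ1 : ContDiff ℝ 1 Q := hQ.of_le (by norm_num)
  have hg1 : ContDiff ℝ 1 (dirD τ ψ) := hg.of_le (by norm_num)
  set K := tsupport p ∪ tsupport q with hK
  have hKc : IsCompact K := hpc.isCompact.union hqc.isCompact
  have cont1 : Continuous (carlemanForm a v τ ψ p q) := by
    unfold carlemanForm commForm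
    rw [← hXdef, ← hQdef]
    have := fun w i => (hXd w i).continuous
    have := fun w i j => (had w i j).continuous
    have := fun w => (hQd w).continuous
    have := fun w => (hpd w).continuous
    have := fun w => (hqd w).continuous
    have := fun w => (hP w).continuous
    have := fun w => (hR w).continuous
    have := fun w => (hX w).continuous
    have := hgt.continuous
    have := hp.continuous
    have := hq.continuous
    fun_prop
  have contC : ∀ {f g : F → ℝ}, ContDiff ℝ 2 f → ContDiff ℝ 2 g →
      Continuous (conjOp a v τ ψ f g) := by
    intro f g hf hg'
    unfold conjOp divOp
    rw [← hXdef, ← hQdef]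
    have h1 : ∀ k, Continuous (dirD (v k) (flux a v f k)) := fun k =>
      (contDiff_dirD (m := 0) _ (contDiff_flux (m := 1) ha1 (hf.of_le (by norm_num)) k)
        (by norm_num)).continuous
    have h2 : Continuous (multOp v X f) :=
      (contDiff_multOp (m := 1) (fun i => (hX i).of_le (by norm_num))
        (hf.of_le (by norm_num))).continuous
    have h3 : Continuous (dirD τ g) := (contDiff_dirD (m := 1) _ hg' (by norm_num)).continuous
    have := hQ.continuous
    have := hf.continuous
    have := hg'.continuous
    have := hg.continuous
    fun_prop
  have int1 : Integrable (carlemanForm a v τ ψ p q) μ := by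
    refine cont1.integrable_of_hasCompactSupport (HasCompactSupport.intro hKc fun z hz => ?_)
    rw [hK, mem_union, not_or] at hz
    exact carlemanForm_eq_zero hz.1 hz.2
  have neg_supp : ∀ z, z ∉ tsupport p → z ∉ tsupport (fun y => -p y) := by
    intro z hz
    have : tsupport (fun y => -p y) = tsupport p := by
      unfold tsupport
      congr 1
      ext y
      simp
    rwa [this]
  have int2 : Integrable
      (fun z => conjOp a v τ ψ p q z ^ 2 + conjOp a v τ ψ q (fun y => -p y) z ^ 2) μ := by
    refine Continuous.integrable_of_hasCompactSupport (((contC hp hq).pow 2).add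
      ((contC hq hnp).pow 2)) (HasCompactSupport.intro hKc fun z hz => ?_)
    rw [hK, mem_union, not_or] at hz
    rw [conjOp_eq_zero hz.1 hz.2, conjOp_eq_zero hz.2 (neg_supp z hz.1)]
    norm_num
  refine ⟨int1, int2, ?_⟩
  -- The divergence terms are those of the five partial identities.
  let Y : ι → F → ℝ := fun k y =>
    (X k y * (∑ i, ∑ j, a i j y * dirD (v i) p y * dirD (v j) p y) - flux a v p k y * multOp v X p y)
    + (X k y * (∑ i, ∑ j, a i j y * dirD (v i) q y * dirD (v j) q y)
      - flux a v q k y * multOp v X q y)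
    + (-(X k y * (Q y * (p y * p y)))) + (-(X k y * (Q y * (q y * q y))))
    + X k y * (p y * dirD τ q y - q y * dirD τ p y)
    + 2 * (dirD τ ψ y * (q y * flux a v p k y - p y * flux a v q k y))
  let Z : F → ℝ := fun y => (∑ l, X l y * (q y * dirD (v l) p y - p y * dirD (v l) q y))
    + (-(dirD τ ψ y * (p y * p y + q y * q y)))
  have hY : ∀ k, ContDiff ℝ 1 (Y k) := by
    intro k
    fun_prop
  have hZ : ContDiff ℝ 1 Z := by
    fun_prop
  have zY : ∀ k, HasCompactSupport (Y k) := fun k => by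
    refine HasCompactSupport.intro hKc fun z hz => ?_
    rw [hK, mem_union, not_or] at hz
    simp [Y, dirD_eq_zero_of_notMem_tsupport _ hz.1, dirD_eq_zero_of_notMem_tsupport _ hz.2,
      image_eq_zero_of_notMem_tsupport hz.1, image_eq_zero_of_notMem_tsupport hz.2,
      flux_eq_zero_of_notMem_tsupport hz.1, flux_eq_zero_of_notMem_tsupport hz.2]
  have zZ : HasCompactSupport Z := by
    refine HasCompactSupport.intro hKc fun z hz => ?_
    rw [hK, mem_union, not_or] at hz
    simp [Z, image_eq_zero_of_notMem_tsupport hz.1, image_eq_zero_of_notMem_tsupport hz.2]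
  have intdiv : ∀ (w : F) {f : F → ℝ}, ContDiff ℝ 1 f → HasCompactSupport f →
      Integrable (dirD w f) μ := fun w f hf hc =>
    (contDiff_dirD (m := 0) w hf (by norm_num)).continuous.integrable_of_hasCompactSupport
      (hasCompactSupport_dirD w hc)
  have point : ∀ z, carlemanForm a v τ ψ p q z + ((∑ k, dirD (v k) (Y k) z) + dirD τ Z z) ≤
      conjOp a v τ ψ p q z ^ 2 + conjOp a v τ ψ q (fun y => -p y) z ^ 2 := by
    intro z
    have d1 : ∀ i j, Differentiable ℝ (a i j) := fun i j => (ha i j).differentiable (by norm_num)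
    have d2 : ∀ i, Differentiable ℝ (X i) := fun i => (hX i).differentiable (by norm_num)
    have d3 : Differentiable ℝ p := hp.differentiable (by norm_num)
    have d4 : Differentiable ℝ q := hq.differentiable (by norm_num)
    have d5 : Differentiable ℝ Q := hQ.differentiable (by norm_num)
    have d6 : ∀ w, Differentiable ℝ (dirD w p) := fun w => (hpd w).differentiable (by norm_num)
    have d7 : ∀ w, Differentiable ℝ (dirD w q) := fun w => (hqd w).differentiable (by norm_num)
    have d8 : ∀ w, Differentiable ℝ (flux a v p w) := fun w => (hP w).differentiable (by norm_num)
    have d9 : ∀ w, Differentiable ℝ (flux a v q w) := fun w => (hR w).differentiable (by norm_num)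
    have d10 : Differentiable ℝ (multOp v X p) := hMp.differentiable (by norm_num)
    have d11 : Differentiable ℝ (multOp v X q) := hMq.differentiable (by norm_num)
    have d12 : Differentiable ℝ (dirD τ ψ) := hg.differentiable (by norm_num)
    have eY : ∑ k, dirD (v k) (Y k) z =
        ∑ k, dirD (v k) (fun y => X k y * (∑ i, ∑ j, a i j y * dirD (v i) p y * dirD (v j) p y)
          - flux a v p k y * multOp v X p y) z
        + ∑ k, dirD (v k) (fun y => X k y * (∑ i, ∑ j, a i j y * dirD (v i) q y * dirD (v j) q y)
          - flux a v q k y * multOp v X q y) z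
        + ∑ k, dirD (v k) (fun y => -(X k y * (Q y * (p y * p y)))) z
        + ∑ k, dirD (v k) (fun y => -(X k y * (Q y * (q y * q y)))) z
        + ∑ l, dirD (v l) (fun y => X l y * (p y * dirD τ q y - q y * dirD τ p y)) z
        + ∑ k, dirD (v k)
            (fun y => 2 * (dirD τ ψ y * (q y * flux a v p k y - p y * flux a v q k y))) z := by
      simp only [← Finset.sum_add_distrib]
      refine Finset.sum_congr rfl fun k _ => ?_
      simp only [Y]
      rw [dirD_add _ (by fun_prop) (by fun_prop), dirD_add _ (by fun_prop) (by fun_prop),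
        dirD_add _ (by fun_prop) (by fun_prop), dirD_add _ (by fun_prop) (by fun_prop),
        dirD_add _ (by fun_prop) (by fun_prop)]
    have eZ : dirD τ Z z =
        dirD τ (fun y => ∑ l, X l y * (q y * dirD (v l) p y - p y * dirD (v l) q y)) z
        - dirD τ (dirD τ ψ) z * (p z ^ 2 + q z ^ 2)
        - dirD τ ψ z * (2 * p z * dirD τ p z + 2 * q z * dirD τ q z) := by
      simp only [Z]
      rw [dirD_add _ (by fun_prop) (by fun_prop), dirD_neg,
        dirD_mul _ (by fun_prop) (by fun_prop), dirD_add _ (by fun_prop) (by fun_prop),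
        dirD_mul _ (by fun_prop) (by fun_prop), dirD_mul _ (by fun_prop) (by fun_prop)]
      ring
    have i1 := neg_divOp_mul_multOp (v := v) hs ha hX hp z
    have i2 := neg_divOp_mul_multOp (v := v) hs ha hX hq z
    have i3 := neg_mul_multOp (v := v) hX hp d5 z
    have i4 := neg_mul_multOp (v := v) hX hq d5 z
    have i5 := time_mul_multOp (v := v) τ hX hp hq z
    have i6 := mul_divOp_sub (v := v) hs ha hp hq d12 z
    have i7 : ∑ l, 2 * (∑ k, a l k z * dirD (v k) (dirD τ ψ) z)
          * (p z * dirD (v l) q z - q z * dirD (v l) p z) =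
        ∑ l, dirD τ (X l) z * (p z * dirD (v l) q z - q z * dirD (v l) p z) :=
      Finset.sum_congr rfl fun l _ => by rw [hXdef, dirD_weightField hτ ha hψ]
    rw [i7] at i6
    have i8 : dirD τ (fun y => -p y) z = - dirD τ p z := dirD_neg _ _ _
    have key : carlemanForm a v τ ψ p q z + ((∑ k, dirD (v k) (Y k) z) + dirD τ Z z) =
        -2 * (-dirD τ q z + divOp a v p z + Q z * p z) * (multOp v X p z / 2 - dirD τ ψ z * q z)
        -2 * (dirD τ p z + divOp a v q z + Q z * q z) * (multOp v X q z / 2 + dirD τ ψ z * p z) := by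
      unfold carlemanForm
      rw [eY, eZ, ← hXdef, ← hQdef]
      linear_combination (-1 : ℝ) * (i1 + i2 + i3 + i4 + i5 + i6)
    rw [key]
    unfold conjOp
    rw [i8, ← hXdef, ← hQdef]
    have b1 := sq_nonneg (-dirD τ q z + divOp a v p z + Q z * p z)
    have b2 := sq_nonneg (dirD τ p z + divOp a v q z + Q z * q z)
    have b3 := sq_nonneg (multOp v X p z / 2 - dirD τ ψ z * q z)
    have b4 := sq_nonneg (multOp v X q z / 2 + dirD τ ψ z * p z)
    linear_combination b1 + b2 + b3 + b4
  have hint : ∫ z, (carlemanForm a v τ ψ p q z + ((∑ k, dirD (v k) (Y k) z) + dirD τ Z z)) ∂μ =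
      ∫ z, carlemanForm a v τ ψ p q z ∂μ := by
    rw [integral_add int1, integral_add, integral_finsetSum]
    · simp [integral_dirD_eq_zero μ _ (hY _) (zY _), integral_dirD_eq_zero μ _ hZ zZ]
    · exact fun k _ => intdiv _ (hY k) (zY k)
    · exact integrable_finsetSum _ fun k _ => intdiv _ (hY k) (zY k)
    · exact intdiv _ hZ zZ
    · exact (integrable_finsetSum _ fun k _ => intdiv _ (hY k) (zY k)).add (intdiv _ hZ zZ)
  rw [← hint]
  exact integral_mono (int1.add ((integrable_finsetSum _ fun k _ =>
    intdiv _ (hY k) (zY k)).add (intdiv _ hZ zZ))) int2 point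

end IntegratedIdentity

/-! ### Pointwise lower bounds -/

section PointwiseBounds

variable {ι : Type*} [Fintype ι]

lemma abs_sum_mul_le {b ξ : ι → ℝ} {c : ℝ} (hb : ∀ i, |b i| ≤ c) :
    |∑ i, b i * ξ i| ≤ c * ∑ i, |ξ i| := by
  rw [Finset.mul_sum]
  refine (Finset.abs_sum_le_sum_abs _ _).trans (Finset.sum_le_sum fun i _ => ?_)
  rw [abs_mul]
  exact mul_le_mul_of_nonneg_right (hb i) (abs_nonneg _)

lemma abs_sum_le_card_mul {b : ι → ℝ} {c : ℝ} (hb : ∀ i, |b i| ≤ c) :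
    |∑ i, b i| ≤ Fintype.card ι * c := by
  refine (Finset.abs_sum_le_sum_abs _ _).trans ((Finset.sum_le_sum fun i _ => hb i).trans ?_)
  simp

lemma sq_sum_abs_le (ξ : ι → ℝ) : (∑ i, |ξ i|) ^ 2 ≤ Fintype.card ι * ∑ i, ξ i ^ 2 := by
  have h := sq_sum_le_card_mul_sum_sq (s := (Finset.univ : Finset ι)) (f := fun i => |ξ i|)
  simpa using h

/-- Positivity of the gradient part of the commutator form. The matrix `A` and its derivatives
`dA l = ∂ₗ A` are taken at one point, `z` is the gradient of the weight up to the factor `2 κ`, `ξ` is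
the gradient of the function and `D` stands for `∇ div X`. -/
lemma commForm_lower [Nonempty ι] {A : ι → ι → ℝ} {dA : ι → ι → ι → ℝ} {z ξ D : ι → ℝ}
    {lam Lam ε κ b p : ℝ} (hlam : 0 < lam) (hLam : 0 < Lam) (hε : 0 ≤ ε) (hκ : 0 < κ)
    (hA : ∀ i j, |A i j| ≤ Lam) (hs : ∀ i j, A i j = A j i)
    (hell : lam ^ 2 * ∑ k, ξ k ^ 2 ≤ ∑ k, (∑ j, A k j * ξ j) ^ 2)
    (h1 : ∀ k l m, |dA k l m * z m| ≤ ε) (h2 : ∀ l m k j, |A l m * z m * dA l k j| ≤ Lam * ε)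
    (hD : ∀ k, |D k| ≤ κ * b)
    (hsmall : 3 * (Fintype.card ι : ℝ) ^ 3 * Lam * ε ≤ lam ^ 2) :
    3 * κ * lam ^ 2 * ∑ k, ξ k ^ 2
      - κ * ((Fintype.card ι : ℝ) ^ 3 * Lam ^ 2 * b ^ 2 / (4 * lam ^ 2)) * p ^ 2 ≤
    2 * ∑ k, ∑ l, (∑ j, A k j * ξ j) * (4 * κ * (A l k + ∑ m, dA k l m * z m)) * ξ l
    - ∑ l, (4 * κ * ∑ m, A l m * z m) * ∑ k, ∑ j, dA l k j * ξ j * ξ k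
    + (∑ k, (∑ j, A k j * ξ j) * D k) * p := by
  set N : ℝ := (Fintype.card ι : ℝ) with hN
  have hN1 : 1 ≤ N := by rw [hN]; exact_mod_cast Fintype.card_pos
  set s := ∑ i, |ξ i| with hs'
  have hs0 : 0 ≤ s := Finset.sum_nonneg fun _ _ => abs_nonneg _
  have hs2 : s ^ 2 ≤ N * ∑ i, ξ i ^ 2 := sq_sum_abs_le ξ
  set S := ∑ i, ξ i ^ 2 with hS
  have hP : ∀ k, |∑ j, A k j * ξ j| ≤ Lam * s := fun k => abs_sum_mul_le fun j => hA k j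
  set P : ι → ℝ := fun k => ∑ j, A k j * ξ j with hPdef
  -- The terms without `dA` add up to a multiple of `|A ξ|²`; those with `dA` are errors of size `ε`.
  have e1 : ∑ k, ∑ l, P k * (4 * κ * (A l k + ∑ m, dA k l m * z m)) * ξ l =
      4 * κ * ∑ k, P k ^ 2 + 4 * κ * ∑ k, ∑ l, (P k * ∑ m, dA k l m * z m) * ξ l := by
    rw [Finset.mul_sum, Finset.mul_sum, ← Finset.sum_add_distrib]
    refine Finset.sum_congr rfl fun k _ => ?_
    have : P k ^ 2 = ∑ l, P k * A l k * ξ l := by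
      rw [sq, hPdef]
      simp only
      rw [Finset.mul_sum]
      exact Finset.sum_congr rfl fun l _ => by rw [hs k l]; ring
    rw [this, Finset.mul_sum, Finset.mul_sum, ← Finset.sum_add_distrib]
    exact Finset.sum_congr rfl fun l _ => by ring
  have b1 : |∑ k, ∑ l, (P k * ∑ m, dA k l m * z m) * ξ l| ≤ N * ((Lam * s * (N * ε)) * s) := by
    refine abs_sum_le_card_mul fun k => abs_sum_mul_le fun l => ?_
    rw [abs_mul]
    exact mul_le_mul (hP k) (abs_sum_le_card_mul fun m => h1 k l m) (abs_nonneg _) (by positivity)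
  have e2 : ∑ l, (4 * κ * ∑ m, A l m * z m) * ∑ k, ∑ j, dA l k j * ξ j * ξ k =
      4 * κ * ∑ l, ∑ k, (∑ j, (∑ m, A l m * z m * dA l k j) * ξ j) * ξ k := by
    rw [Finset.mul_sum]
    refine Finset.sum_congr rfl fun l _ => ?_
    rw [mul_assoc]
    congr 1
    rw [Finset.mul_sum]
    refine Finset.sum_congr rfl fun k _ => ?_
    rw [Finset.mul_sum, Finset.sum_mul]
    refine Finset.sum_congr rfl fun j _ => ?_
    rw [← Finset.sum_mul]; ring
  have b2 : |∑ l, ∑ k, (∑ j, (∑ m, A l m * z m * dA l k j) * ξ j) * ξ k| ≤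
      N * ((N * (Lam * ε) * s) * s) := by
    refine abs_sum_le_card_mul fun l => abs_sum_mul_le fun k => abs_sum_mul_le fun j => ?_
    exact abs_sum_le_card_mul fun m => h2 l m k j
  have b3 : |∑ k, P k * D k| ≤ N * (Lam * s * (κ * b)) := by
    refine abs_sum_le_card_mul fun k => ?_
    rw [abs_mul]
    exact mul_le_mul (hP k) (hD k) (abs_nonneg _) (by positivity)
  have b3' : -(N * (Lam * s * (κ * b))) * |p| ≤ (∑ k, P k * D k) * p := by
    have : |(∑ k, P k * D k) * p| ≤ N * (Lam * s * (κ * b)) * |p| := by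
      rw [abs_mul]; exact mul_le_mul_of_nonneg_right b3 (abs_nonneg _)
    have := neg_abs_le ((∑ k, P k * D k) * p)
    linarith
  have young : N * (Lam * s * b) * |p| ≤
      lam ^ 2 * S + N ^ 3 * Lam ^ 2 * b ^ 2 / (4 * lam ^ 2) * p ^ 2 := by
    have h := sq_nonneg (lam * s - N * (N * Lam * b * |p|) / (2 * lam))
    have : (lam * s - N * (N * Lam * b * |p|) / (2 * lam)) ^ 2 =
        lam ^ 2 * s ^ 2 - N * (N * (Lam * s * b) * |p|)
          + N * (N ^ 3 * Lam ^ 2 * b ^ 2 / (4 * lam ^ 2) * p ^ 2) := by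
      rw [← sq_abs p]
      field_simp
      ring
    rw [this] at h
    have h3 : lam ^ 2 * s ^ 2 ≤ N * (lam ^ 2 * S) := by nlinarith [sq_nonneg lam]
    have h4 : N * (N * (Lam * s * b) * |p|) ≤
      N * (lam ^ 2 * S + N ^ 3 * Lam ^ 2 * b ^ 2 / (4 * lam ^ 2) * p ^ 2) := by linarith
    exact le_of_mul_le_mul_left h4 (by linarith)
  rw [e1, e2]
  have a1 := neg_abs_le (∑ k, ∑ l, (P k * ∑ m, dA k l m * z m) * ξ l)
  have a2 := le_abs_self (∑ l, ∑ k, (∑ j, (∑ m, A l m * z m * dA l k j) * ξ j) * ξ k)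
  have err : N ^ 2 * Lam * ε * s ^ 2 ≤ lam ^ 2 * S / 3 := by
    have hS0 : 0 ≤ S := Finset.sum_nonneg fun _ _ => sq_nonneg _
    calc N ^ 2 * Lam * ε * s ^ 2 ≤ N ^ 2 * Lam * ε * (N * S) := by gcongr
      _ = (3 * N ^ 3 * Lam * ε) * S / 3 := by ring
      _ ≤ lam ^ 2 * S / 3 := by gcongr
  have m1 : κ * (8 * (lam ^ 2 * S)) ≤ κ * (8 * ∑ k, P k ^ 2) := by gcongr
  have m2 : κ * -(N ^ 2 * Lam * ε * s ^ 2) ≤ κ * ∑ k, ∑ l, (P k * ∑ m, dA k l m * z m) * ξ l := by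
    refine mul_le_mul_of_nonneg_left ?_ hκ.le
    linarith
  have m3 : κ * (∑ l, ∑ k, (∑ j, (∑ m, A l m * z m * dA l k j) * ξ j) * ξ k) ≤
      κ * (N ^ 2 * Lam * ε * s ^ 2) := by
    refine mul_le_mul_of_nonneg_left ?_ hκ.le
    linarith
  have m4 := mul_le_mul_of_nonneg_left err hκ.le
  have m5 := mul_le_mul_of_nonneg_left young hκ.le
  linarith

/-- Positivity of the zeroth order part, the derivative of the potential `A∇ψ·∇ψ` along the
multiplier field. -/
lemma potential_lower [Nonempty ι] {A : ι → ι → ℝ} {dA : ι → ι → ι → ℝ} {z : ι → ℝ}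
    {lam Lam ε κ : ℝ} (hLam : 0 < Lam) (hε : 0 ≤ ε) (hκ : 0 < κ)
    (hA : ∀ i j, |A i j| ≤ Lam)
    (hell : lam ^ 2 * ∑ k, z k ^ 2 ≤ ∑ k, (∑ j, A k j * z j) ^ 2)
    (h1 : ∀ k l m, |dA k l m * z m| ≤ ε)
    (hsmall : 3 * (Fintype.card ι : ℝ) ^ 3 * Lam * ε ≤ lam ^ 2) :
    16 * κ ^ 3 * lam ^ 2 * ∑ k, z k ^ 2 ≤
    ∑ l, (4 * κ * ∑ m, A l m * z m) *
      (4 * κ ^ 2 * (∑ j, ∑ k, dA l j k * z j * z k + 2 * ∑ k, A l k * z k)) := by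
  set N : ℝ := (Fintype.card ι : ℝ) with hN
  set s := ∑ i, |z i| with hs'
  have hs0 : 0 ≤ s := Finset.sum_nonneg fun _ _ => abs_nonneg _
  have hs2 : s ^ 2 ≤ N * ∑ i, z i ^ 2 := sq_sum_abs_le z
  set S := ∑ i, z i ^ 2 with hS
  have hP : ∀ k, |∑ j, A k j * z j| ≤ Lam * s := fun k => abs_sum_mul_le fun j => hA k j
  set P : ι → ℝ := fun k => ∑ j, A k j * z j with hPdef
  have e1 : ∑ l, (4 * κ * P l) *
      (4 * κ ^ 2 * (∑ j, ∑ k, dA l j k * z j * z k + 2 * P l)) =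
      κ ^ 3 * (32 * ∑ k, P k ^ 2) + κ ^ 3 * (16 * ∑ l, P l * ∑ j, (∑ k, dA l j k * z k) * z j) := by
    rw [Finset.mul_sum, Finset.mul_sum, Finset.mul_sum, Finset.mul_sum, ← Finset.sum_add_distrib]
    refine Finset.sum_congr rfl fun l _ => ?_
    have : ∑ j, ∑ k, dA l j k * z j * z k = ∑ j, (∑ k, dA l j k * z k) * z j := by
      refine Finset.sum_congr rfl fun j _ => ?_
      rw [Finset.sum_mul]
      exact Finset.sum_congr rfl fun k _ => by ring
    rw [this]; ring
  have b1 : |∑ l, P l * ∑ j, (∑ k, dA l j k * z k) * z j| ≤ N * (Lam * s * (N * ε * s)) := by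
    refine abs_sum_le_card_mul fun l => ?_
    rw [abs_mul]
    refine mul_le_mul (hP l) (abs_sum_mul_le fun j => ?_) (abs_nonneg _) (by positivity)
    exact abs_sum_le_card_mul fun k => h1 l j k
  have a1 := neg_abs_le (∑ l, P l * ∑ j, (∑ k, dA l j k * z k) * z j)
  have err : N ^ 2 * Lam * ε * s ^ 2 ≤ lam ^ 2 * S / 3 := by
    have hS0 : 0 ≤ S := Finset.sum_nonneg fun _ _ => sq_nonneg _
    calc N ^ 2 * Lam * ε * s ^ 2 ≤ N ^ 2 * Lam * ε * (N * S) := by gcongr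
      _ = (3 * N ^ 3 * Lam * ε) * S / 3 := by ring
      _ ≤ lam ^ 2 * S / 3 := by gcongr
  have hS0 : 0 ≤ lam ^ 2 * S := mul_nonneg (sq_nonneg _) (Finset.sum_nonneg fun _ _ => sq_nonneg _)
  rw [e1, ← mul_add]
  calc 16 * κ ^ 3 * lam ^ 2 * S = κ ^ 3 * (16 * (lam ^ 2 * S)) := by ring
    _ ≤ _ := by
      refine mul_le_mul_of_nonneg_left ?_ (by positivity)
      linarith

/-- The first order terms coming from `∂ₜ X` are absorbed by the gradient and zeroth order
parts. -/
lemma cross_lower [Nonempty ι] {Y ξ η : ι → ℝ} {lam κ c p q : ℝ} (hlam : 0 < lam) (hκ : 0 < κ)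
    (hY : ∀ l, |Y l| ≤ κ * c) :
    -(κ * lam ^ 2 * (∑ k, ξ k ^ 2 + ∑ k, η k ^ 2)
      + κ * ((Fintype.card ι : ℝ) * c ^ 2 / lam ^ 2) * (p ^ 2 + q ^ 2)) ≤
    2 * ∑ l, Y l * (p * η l - q * ξ l) := by
  set N : ℝ := (Fintype.card ι : ℝ) with hN
  have hN1 : 1 ≤ N := by rw [hN]; exact_mod_cast Fintype.card_pos
  have e : ∑ l, Y l * (p * η l - q * ξ l) = (∑ l, Y l * η l) * p - (∑ l, Y l * ξ l) * q := by
    rw [Finset.sum_mul, Finset.sum_mul, ← Finset.sum_sub_distrib]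
    exact Finset.sum_congr rfl fun l _ => by ring
  have key : ∀ (ζ : ι → ℝ) (r : ℝ), |2 * ((∑ l, Y l * ζ l) * r)| ≤
      κ * (lam ^ 2 * ∑ k, ζ k ^ 2 + (N * c ^ 2 / lam ^ 2) * r ^ 2) := by
    intro ζ r
    have h1 : |∑ l, Y l * ζ l| ≤ κ * c * ∑ l, |ζ l| := abs_sum_mul_le hY
    have hs2 := sq_sum_abs_le ζ
    set s := ∑ l, |ζ l|
    rw [abs_mul, abs_mul, abs_two]
    have h2 : 2 * (|∑ l, Y l * ζ l| * |r|) ≤ κ * (2 * c * s * |r|) := by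
      have := mul_le_mul_of_nonneg_right h1 (abs_nonneg r)
      linarith
    refine h2.trans (mul_le_mul_of_nonneg_left ?_ hκ.le)
    have h := sq_nonneg (lam * s - N * c * |r| / lam)
    have e2 : (lam * s - N * c * |r| / lam) ^ 2 = lam ^ 2 * s ^ 2 - N * (2 * c * s * |r|)
        + N * (N * c ^ 2 / lam ^ 2 * r ^ 2) := by
      rw [← sq_abs r]
      field_simp
      ring
    rw [e2] at h
    have h3 : lam ^ 2 * s ^ 2 ≤ N * (lam ^ 2 * ∑ k, ζ k ^ 2) := by nlinarith [sq_nonneg lam]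
    have h4 : N * (2 * c * s * |r|) ≤
      N * (lam ^ 2 * ∑ k, ζ k ^ 2 + N * c ^ 2 / lam ^ 2 * r ^ 2) := by linarith
    exact le_of_mul_le_mul_left h4 (by linarith)
  rw [e]
  have k1 := neg_abs_le (2 * ((∑ l, Y l * η l) * p))
  have k2 := le_abs_self (2 * ((∑ l, Y l * ξ l) * q))
  have k3 := key η p
  have k4 := key ξ q
  linarith

end PointwiseBounds

/-! ### The coefficients on space-time -/

section Coefficients

variable {d : ℕ}

/-- Space-time `ℝ × ℝᵈ⁺¹`. -/
abbrev SpaceTime (d : ℕ) : Type := ℝ × EuclideanSpace ℝ (Fin (d + 1))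

/-- The `k`-th spatial unit direction in space-time. -/
noncomputable def ex (k : Fin (d + 1)) : SpaceTime d := (0, basisVec k)

/-- The time direction in space-time. -/
def et : SpaceTime d := (1, 0)

/-- What the argument uses of the coefficients `a_{ij}`, as functions on space-time: symmetry,
ellipticity, independence of `t` and `x₁`, block structure, the bound `ε` on the scale-invariant
quantity `|x'| |∂ a_{ij}|` and the bound `K` on first and second derivatives. -/
structure Admissible (A : Fin (d + 1) → Fin (d + 1) → SpaceTime d → ℝ) (lam Lam ε K : ℝ) :
    Prop where
  symm : ∀ i j, A i j = A j i
  contDiff : ∀ i j, ContDiff ℝ 2 (A i j)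
  dirD_et : ∀ i j z, dirD et (A i j) z = 0
  abs_le : ∀ z i j, |A i j z| ≤ Lam
  elliptic : ∀ z (ξ : Fin (d + 1) → ℝ),
    lam ^ 2 * ∑ k, ξ k ^ 2 ≤ ∑ k, (∑ j, A k j z * ξ j) ^ 2
  block : ∀ z, ∀ i ≠ 0, A i 0 z = 0
  dirD_block : ∀ l i j z, l = 0 ∨ i = 0 ∨ j = 0 → dirD (ex l) (A i j) z = 0
  small : ∀ l i j z, ∀ m ≠ 0, |dirD (ex l) (A i j) z * z.2 m| ≤ ε
  dirD_le : ∀ l i j z, |dirD (ex l) (A i j) z| ≤ K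
  dirD_dirD_le : ∀ k l i j z, |dirD (ex k) (dirD (ex l) (A i j)) z| ≤ K

/-- `x ↦ x'` as a continuous linear map. -/
noncomputable def tailCLM (d : ℕ) : EuclideanSpace ℝ (Fin (d + 1)) →L[ℝ] EuclideanSpace ℝ (Fin d) :=
  LinearMap.toContinuousLinearMap
    { toFun := tailVec
      map_add' := fun x y => by ext i; simp [tailVec]
      map_smul' := fun c x => by ext i; simp [tailVec] }

lemma tailCLM_apply (x : EuclideanSpace ℝ (Fin (d + 1))) : tailCLM d x = tailVec x := rfl

lemma tailVec_basisVec_zero : tailVec (basisVec (0 : Fin (d + 1))) = 0 := by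
  ext i; simp [tailVec, basisVec]

lemma tailVec_basisVec_succ (l : Fin d) : tailVec (basisVec l.succ) = basisVec l := by
  ext i; simp [tailVec, basisVec]

/-- The coefficients `a_{ij}`, as functions on space-time. -/
noncomputable def coef (a : ℝ) (B : EuclideanSpace ℝ (Fin d) → Matrix (Fin d) (Fin d) ℝ)
    (i j : Fin (d + 1)) (z : SpaceTime d) : ℝ := blockCoeff a B z.2 i j

variable {a : ℝ} {B : EuclideanSpace ℝ (Fin d) → Matrix (Fin d) (Fin d) ℝ}

lemma coef_zero_zero : coef a B 0 0 = fun _ => a := by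
  ext z; simp [coef, blockCoeff]

lemma coef_zero_succ (j : Fin d) : coef a B 0 j.succ = fun _ => 0 := by
  ext z; simp [coef, blockCoeff]

lemma coef_succ_zero (j : Fin d) : coef a B j.succ 0 = fun _ => 0 := by
  ext z; simp [coef, blockCoeff]

lemma coef_succ_succ (i j : Fin d) :
    coef a B i.succ j.succ = fun z => (fun y => B y i j) (tailCLM d z.2) := by
  ext z; simp [coef, blockCoeff, tailCLM_apply]

lemma dirD_comp_tail {f : EuclideanSpace ℝ (Fin d) → ℝ} (hf : Differentiable ℝ f)
    (w : SpaceTime d) :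
    dirD w (fun z : SpaceTime d => f (tailCLM d z.2)) =
      fun z => fderiv ℝ f (tailVec z.2) (tailVec w.2) := by
  ext z
  have h : HasFDerivAt (fun z : SpaceTime d => tailCLM d z.2)
      ((tailCLM d).comp (ContinuousLinearMap.snd ℝ ℝ _)) z :=
    ((tailCLM d).comp (ContinuousLinearMap.snd ℝ ℝ _)).hasFDerivAt
  have h2 := ((hf (tailCLM d z.2)).hasFDerivAt.comp z h).fderiv
  unfold dirD
  have h3 : fderiv ℝ (fun z : SpaceTime d => f (tailCLM d z.2)) z = _ := h2
  rw [h3]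
  rfl

/-- Entries of a symmetric matrix with quadratic form in `[0, Λ|ξ|²]` are at most `Λ`. -/
lemma abs_entry_le {n : ℕ} {M : Fin n → Fin n → ℝ} {lam Lam : ℝ} (hlam : 0 < lam)
    (hs : ∀ i j, M i j = M j i)
    (h : ∀ ξ : EuclideanSpace ℝ (Fin n), lam * ‖ξ‖ ^ 2 ≤ ∑ j, ∑ k, M j k * ξ j * ξ k ∧
      ∑ j, ∑ k, M j k * ξ j * ξ k ≤ Lam * ‖ξ‖ ^ 2) (i j : Fin n) : |M i j| ≤ Lam := by
  have q : ∀ (s : ℝ), ∑ b, ∑ c, M b c * (basisVec i + s • basisVec j : EuclideanSpace ℝ (Fin n)) b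
      * (basisVec i + s • basisVec j : EuclideanSpace ℝ (Fin n)) c
      = M i i + 2 * s * M i j + s ^ 2 * M j j := by
    intro s
    have : ∀ b, (basisVec i + s • basisVec j : EuclideanSpace ℝ (Fin n)) b =
        (if b = i then 1 else 0) + s * (if b = j then 1 else 0) := by
      intro b; simp [basisVec]
    have inner : ∀ b, ∑ c, M b c * (basisVec i + s • basisVec j : EuclideanSpace ℝ (Fin n)) b
        * (basisVec i + s • basisVec j : EuclideanSpace ℝ (Fin n)) c =
        ((if b = i then 1 else 0) + s * (if b = j then 1 else 0)) * (M b i + s * M b j) := by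
      intro b
      simp only [this, mul_add, Finset.sum_add_distrib]
      simp
      split_ifs <;> ring
    simp only [inner, add_mul, Finset.sum_add_distrib]
    simp
    rw [hs j i]; ring
  have nn : ∀ s : ℝ, ‖(basisVec i + s • basisVec j : EuclideanSpace ℝ (Fin n))‖ ^ 2 =
      1 + s ^ 2 + 2 * s * (if i = j then 1 else 0) := by
    intro s
    rw [norm_add_sq_real, norm_smul, inner_smul_right]
    simp only [basisVec, PiLp.norm_single, EuclideanSpace.inner_single_left]
    simp
    ring
  have d1 : ∀ k, 0 ≤ M k k ∧ M k k ≤ Lam := by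
    intro k
    have := h (basisVec k)
    have e : ∑ b, ∑ c, M b c * (basisVec k : EuclideanSpace ℝ (Fin n)) b
      * (basisVec k : EuclideanSpace ℝ (Fin n)) c = M k k := by
      simp [basisVec]
    rw [e] at this
    simp only [basisVec, PiLp.norm_single] at this
    norm_num at this
    constructor <;> linarith
  have p1 := h (basisVec i + (1 : ℝ) • basisVec j)
  have p2 := h (basisVec i + (-1 : ℝ) • basisVec j)
  rw [q, nn] at p1 p2
  by_cases hij : i = j
  · subst hij
    rw [abs_of_nonneg (d1 i).1]; exact (d1 i).2
  · simp only [hij, if_false] at p1 p2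
    have := d1 i
    have := d1 j
    rw [abs_le]
    constructor <;> linarith [p1.2, p2.2]

/-- The ellipticity bound `λ|ξ|² ≤ Aξ·ξ` gives `λ|ξ| ≤ |Aξ|`. -/
lemma sq_mul_le_of_elliptic {n : ℕ} {M : Fin n → Fin n → ℝ} {lam : ℝ} (hlam : 0 < lam)
    (h : ∀ ξ : EuclideanSpace ℝ (Fin n), lam * ‖ξ‖ ^ 2 ≤ ∑ j, ∑ k, M j k * ξ j * ξ k)
    (ξ : Fin n → ℝ) : lam ^ 2 * ∑ k, ξ k ^ 2 ≤ ∑ k, (∑ j, M k j * ξ j) ^ 2 := by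
  have h1 := h (WithLp.toLp 2 ξ)
  rw [EuclideanSpace.norm_sq_eq] at h1
  simp only [Real.norm_eq_abs, sq_abs] at h1
  have h2 : ∑ j, ∑ k, M j k * ξ j * ξ k = ∑ j, ξ j * ∑ k, M j k * ξ k := by
    refine Finset.sum_congr rfl fun j _ => ?_
    rw [Finset.mul_sum]
    exact Finset.sum_congr rfl fun k _ => by ring
  rw [h2] at h1
  have h3 := Finset.sum_nonneg (s := Finset.univ)
    (fun k _ => sq_nonneg ((∑ j, M k j * ξ j) - lam * ξ k))
  have h4 : ∑ k, ((∑ j, M k j * ξ j) - lam * ξ k) ^ 2 =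
      ∑ k, (∑ j, M k j * ξ j) ^ 2 - 2 * lam * ∑ k, ξ k * (∑ j, M k j * ξ j)
        + lam ^ 2 * ∑ k, ξ k ^ 2 := by
    rw [Finset.mul_sum, Finset.mul_sum, ← Finset.sum_sub_distrib, ← Finset.sum_add_distrib]
    exact Finset.sum_congr rfl fun k _ => by ring
  rw [h4] at h3
  nlinarith [mul_le_mul_of_nonneg_left h1 hlam.le]

lemma fderiv_clm_apply_const {f : EuclideanSpace ℝ (Fin d) → ℝ} (hf : Differentiable ℝ (fderiv ℝ f))
    (x v w : EuclideanSpace ℝ (Fin d)) :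
    fderiv ℝ (fun y => fderiv ℝ f y w) x v = fderiv ℝ (fderiv ℝ f) x v w := by
  rw [fderiv_clm_apply (hf x) (by fun_prop)]
  simp

lemma abs_fderiv_le_gradNorm (y : EuclideanSpace ℝ (Fin d)) (l j k : Fin d) :
    |fderiv ℝ (fun z => B z j k) y (basisVec l)| ≤ gradNorm B y := by
  refine Real.abs_le_sqrt ?_
  refine le_trans ?_ (Finset.single_le_sum (f := fun l => ∑ j, ∑ k,
    (fderiv ℝ (fun z => B z j k) y (basisVec l)) ^ 2) (fun _ _ => by positivity)
    (Finset.mem_univ l))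
  refine le_trans ?_ (Finset.single_le_sum (f := fun j => ∑ k,
    (fderiv ℝ (fun z => B z j k) y (basisVec l)) ^ 2) (fun _ _ => by positivity)
    (Finset.mem_univ j))
  exact Finset.single_le_sum (f := fun k =>
    (fderiv ℝ (fun z => B z j k) y (basisVec l)) ^ 2) (fun _ _ => by positivity)
    (Finset.mem_univ k)

lemma abs_iteratedFDeriv_le_of_c3Norm_le {K : ℝ≥0} (h : c3Norm B ≤ K) {i : ℕ}
    (hi : i ∈ Finset.Icc 1 3) (s : Fin i → Fin d) (y : EuclideanSpace ℝ (Fin d)) (j k : Fin d) :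
    |iteratedFDeriv ℝ i (fun z => B z j k) y (fun l => basisVec (s l))| ≤ K := by
  have h1 : ENNReal.ofReal (partialNorm B s y) ≤ K := by
    refine le_trans ?_ h
    refine le_trans ?_ (Finset.single_le_sum (f := fun i => ⨆ (y : EuclideanSpace ℝ (Fin d))
      (s : Fin i → Fin d), ENNReal.ofReal (partialNorm B s y)) (fun _ _ => zero_le) hi)
    exact le_iSup_of_le y (le_iSup_of_le s le_rfl)
  have h2 : partialNorm B s y ≤ K := by
    rw [ENNReal.ofReal_le_iff_le_toReal (by simp)] at h1
    simpa using h1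
  refine le_trans (Real.abs_le_sqrt ?_) h2
  refine le_trans ?_ (Finset.single_le_sum (f := fun j => ∑ k,
    (iteratedFDeriv ℝ i (fun z => B z j k) y (fun l => basisVec (s l))) ^ 2)
    (fun _ _ => by positivity) (Finset.mem_univ j))
  exact Finset.single_le_sum (f := fun k =>
    (iteratedFDeriv ℝ i (fun z => B z j k) y (fun l => basisVec (s l))) ^ 2)
    (fun _ _ => by positivity) (Finset.mem_univ k)

/-- Since the block matrix is constant in `t` and `x₁`, the hypotheses on `B` are all that
`Admissible` asks for. -/
lemma admissible_coef {lam Lam ε : ℝ} {K : ℝ≥0} (hlam : 0 < lam) (hε : 0 ≤ ε)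
    (hB : ∀ y, (B y).IsSymm) (hd : ∀ j k, ContDiff ℝ 3 (fun y => B y j k))
    (hK : c3Norm B ≤ K) (hell : IsEllipticField lam Lam (blockCoeff a B))
    (hsm : ∀ y, ‖y‖ * gradNorm B y ≤ ε) : Admissible (coef a B) lam Lam ε K := by
  have hsymm : ∀ i j, coef a B i j = coef a B j i := by
    intro i j
    refine Fin.cases ?_ (fun i => ?_) i <;> refine Fin.cases ?_ (fun j => ?_) j
    · rfl
    · rw [coef_zero_succ, coef_succ_zero]
    · rw [coef_zero_succ, coef_succ_zero]
    · rw [coef_succ_succ, coef_succ_succ]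
      ext z
      exact (hB _).apply _ _
  have hdiff : ∀ i j, Differentiable ℝ (fun y => B y i j) := fun i j =>
    (hd i j).differentiable (by norm_num)
  have hDss : ∀ w i j, dirD w (coef a B i.succ j.succ) =
      fun z => fderiv ℝ (fun y => B y i j) (tailVec z.2) (tailVec w.2) := by
    intro w i j
    rw [coef_succ_succ]
    exact dirD_comp_tail (hdiff i j) w
  have hform : ∀ l i j, (dirD (ex l) (coef a B i j) = fun _ => 0) ∨
      ∃ l' i' j', l = Fin.succ l' ∧ i = Fin.succ i' ∧ j = Fin.succ j' := by
    intro l i j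
    induction i using Fin.cases with
    | zero =>
      left
      induction j using Fin.cases with
      | zero => rw [coef_zero_zero]; ext z; exact dirD_const _ _ _
      | succ j => rw [coef_zero_succ]; ext z; exact dirD_const _ _ _
    | succ i =>
      induction j using Fin.cases with
      | zero => left; rw [coef_succ_zero]; ext z; exact dirD_const _ _ _
      | succ j =>
        induction l using Fin.cases with
        | zero => left; rw [hDss]; ext z; simp [ex, tailVec_basisVec_zero]
        | succ l => exact Or.inr ⟨l, i, j, rfl, rfl, rfl⟩
  have hDsss : ∀ l i j, dirD (ex l.succ) (coef a B i.succ j.succ) =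
      fun z => (fun y => fderiv ℝ (fun y => B y i j) y (basisVec l)) (tailCLM d z.2) := by
    intro l i j
    rw [hDss]
    ext z
    simp [ex, tailVec_basisVec_succ, tailCLM_apply]
  have hcont : ∀ i j, ContDiff ℝ 2 (coef a B i j) := by
    intro i j
    induction i using Fin.cases with
    | zero =>
      induction j using Fin.cases with
      | zero => rw [coef_zero_zero]; exact contDiff_const
      | succ j => rw [coef_zero_succ]; exact contDiff_const
    | succ i =>
      induction j using Fin.cases with
      | zero => rw [coef_succ_zero]; exact contDiff_const
      | succ j =>
        rw [coef_succ_succ]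
        exact ((hd i j).of_le (by norm_num)).comp ((tailCLM d).contDiff.comp contDiff_snd)
  constructor
  · exact hsymm
  · exact hcont
  · intro i j z
    unfold dirD
    have h1 : HasFDerivAt (coef a B i j) (fderiv ℝ (coef a B i j) z) z :=
      ((hcont i j).differentiable (by norm_num) z).hasFDerivAt
    have h2 : HasDerivAt (fun s : ℝ => coef a B i j (z + s • et))
        (fderiv ℝ (coef a B i j) z et) 0 := by
      have h3 : HasDerivAt (fun s : ℝ => z + s • (et : SpaceTime d)) et 0 := by
        simpa using ((hasDerivAt_id (0 : ℝ)).smul_const (et : SpaceTime d)).const_add z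
      have h1' : HasFDerivAt (coef a B i j) (fderiv ℝ (coef a B i j) z)
          (z + (0 : ℝ) • (et : SpaceTime d)) := by simpa using h1
      exact h1'.comp_hasDerivAt 0 h3
    have h4 : (fun s : ℝ => coef a B i j (z + s • et)) = fun _ => coef a B i j z := by
      ext s
      simp [coef, et]
    rw [h4] at h2
    exact h2.unique (hasDerivAt_const _ _)
  · intro z i j
    exact abs_entry_le (M := fun i j => blockCoeff a B z.2 i j) hlam
      (fun i j => congrFun (hsymm i j) z) (fun ξ => hell z.2 ξ) i j
  · intro z ξ
    exact sq_mul_le_of_elliptic (M := fun i j => blockCoeff a B z.2 i j) hlam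
      (fun ξ => (hell z.2 ξ).1) ξ
  · intro z i hi
    obtain ⟨i, rfl⟩ := Fin.exists_succ_eq.2 hi
    rw [coef_succ_zero]
  · intro l i j z h
    rcases hform l i j with h0 | ⟨l', i', j', rfl, rfl, rfl⟩
    · rw [h0]
    · simp [Fin.succ_ne_zero] at h
  · intro l i j z m hm
    rcases hform l i j with h0 | ⟨l', i', j', rfl, rfl, rfl⟩
    · rw [h0]; simpa using hε
    · obtain ⟨m, rfl⟩ := Fin.exists_succ_eq.2 hm
      rw [hDsss, abs_mul]
      have h1 : |z.2 m.succ| ≤ ‖tailVec z.2‖ := PiLp.norm_apply_le (tailVec z.2) m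
      have h2 := abs_fderiv_le_gradNorm (B := B) (tailVec z.2) l' i' j'
      calc _ ≤ gradNorm B (tailVec z.2) * ‖tailVec z.2‖ :=
            mul_le_mul h2 h1 (abs_nonneg _) ((abs_nonneg _).trans h2)
        _ = ‖tailVec z.2‖ * gradNorm B (tailVec z.2) := mul_comm _ _
        _ ≤ ε := hsm _
  · intro l i j z
    rcases hform l i j with h0 | ⟨l', i', j', rfl, rfl, rfl⟩
    · rw [h0]; simp
    · rw [hDsss]
      have := abs_iteratedFDeriv_le_of_c3Norm_le hK (i := 1) (by simp) (fun _ => l')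
        (tailVec z.2) i' j'
      rwa [iteratedFDeriv_one_apply] at this
  · intro k l i j z
    rcases hform l i j with h0 | ⟨l', i', j', rfl, rfl, rfl⟩
    · rw [h0, dirD_const]; simp
    · have hf2 : Differentiable ℝ (fderiv ℝ fun y => B y i' j') :=
        ((hd i' j').fderiv_right (m := 1) (by norm_num)).differentiable (by norm_num)
      rw [hDsss, dirD_comp_tail (f := fun y => fderiv ℝ (fun y => B y i' j') y (basisVec l'))
        (hf2.clm_apply (by fun_prop))]
      induction k using Fin.cases with
      | zero => simp [ex, tailVec_basisVec_zero]
      | succ k =>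
        have := abs_iteratedFDeriv_le_of_c3Norm_le hK (i := 2) (by simp) ![k, l']
          (tailVec z.2) i' j'
        rw [iteratedFDeriv_two_apply] at this
        have e := fderiv_clm_apply_const hf2 (tailVec z.2) (basisVec k) (basisVec l')
        simpa [ex, tailVec_basisVec_succ, e] using this

end Coefficients

/-! ### The weight and the lower bound for its Carleman form -/

section Weight

variable {d : ℕ}

/-- The `k`-th component of the moving position vector `x + R φ(t) e₁`. -/
noncomputable def shift (R : ℝ) (φ : ℝ → ℝ) (k : Fin (d + 1)) (z : SpaceTime d) : ℝ :=
  z.2 k + if k = 0 then R * φ z.1 else 0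

/-- The Carleman weight `κ |x + R φ(t) e₁|²`. -/
noncomputable def weight (κ R : ℝ) (φ : ℝ → ℝ) (z : SpaceTime d) : ℝ :=
  κ * ∑ k, shift R φ k z ^ 2

variable {κ R : ℝ} {φ : ℝ → ℝ}

lemma dirD_coord (w : SpaceTime d) (k : Fin (d + 1)) (z : SpaceTime d) :
    dirD w (fun z : SpaceTime d => z.2 k) z = w.2 k := by
  have h : HasFDerivAt (fun z : SpaceTime d => z.2 k)
      ((EuclideanSpace.proj k : EuclideanSpace ℝ (Fin (d + 1)) →L[ℝ] ℝ).comp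
        (ContinuousLinearMap.snd ℝ ℝ _)) z :=
    ((EuclideanSpace.proj k : EuclideanSpace ℝ (Fin (d + 1)) →L[ℝ] ℝ).comp
        (ContinuousLinearMap.snd ℝ ℝ _)).hasFDerivAt
  unfold dirD
  rw [h.fderiv]; rfl

lemma contDiff_coord {m : WithTop ℕ∞} (k : Fin (d + 1)) :
    ContDiff ℝ m (fun z : SpaceTime d => z.2 k) :=
  ((EuclideanSpace.proj k : EuclideanSpace ℝ (Fin (d + 1)) →L[ℝ] ℝ).comp
        (ContinuousLinearMap.snd ℝ ℝ _)).contDiff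

lemma dirD_fst_comp (w : SpaceTime d) {φ : ℝ → ℝ} (hφ : Differentiable ℝ φ) (z : SpaceTime d) :
    dirD w (fun z : SpaceTime d => φ z.1) z = deriv φ z.1 * w.1 := by
  rw [dirD_comp w hφ differentiable_fst]
  congr 1
  unfold dirD
  rw [(hasFDerivAt_fst (𝕜 := ℝ) (p := z)).fderiv]; rfl

lemma ex_snd (l k : Fin (d + 1)) : (ex l : SpaceTime d).2 k = if k = l then 1 else 0 := by
  simp [ex, basisVec]

lemma contDiff_shift {m : WithTop ℕ∞} (hφ : ContDiff ℝ m φ) (k : Fin (d + 1)) :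
    ContDiff ℝ m (shift (d := d) R φ k) := by
  unfold shift
  refine (contDiff_coord k).add ?_
  split_ifs
  · exact contDiff_const.mul (hφ.comp contDiff_fst)
  · exact contDiff_const

lemma contDiff_weight {m : WithTop ℕ∞} (hφ : ContDiff ℝ m φ) :
    ContDiff ℝ m (weight (d := d) κ R φ) :=
  contDiff_const.mul (ContDiff.sum fun k _ => (contDiff_shift hφ k).pow 2)

lemma dirD_shift (hφ : Differentiable ℝ φ) (w : SpaceTime d) (k : Fin (d + 1)) (z : SpaceTime d) :
    dirD w (shift R φ k) z = w.2 k + if k = 0 then R * (deriv φ z.1 * w.1) else 0 := by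
  have h1 : Differentiable ℝ (fun z : SpaceTime d => z.2 k) :=
    (contDiff_coord (m := 1) k).differentiable (by norm_num)
  have h2 : Differentiable ℝ (fun z : SpaceTime d => φ z.1) := by fun_prop
  unfold shift
  split_ifs with h
  · rw [dirD_add _ h1 (by fun_prop), dirD_coord, dirD_const_mul _ _ h2, dirD_fst_comp _ hφ]
  · rw [dirD_add _ h1 (by fun_prop), dirD_coord, dirD_const]

lemma dirD_ex_shift (hφ : Differentiable ℝ φ) (l k : Fin (d + 1)) (z : SpaceTime d) :
    dirD (ex l) (shift R φ k) z = if k = l then 1 else 0 := by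
  rw [dirD_shift hφ, ex_snd]
  simp [ex]

lemma dirD_et_shift (hφ : Differentiable ℝ φ) (k : Fin (d + 1)) (z : SpaceTime d) :
    dirD et (shift R φ k) z = if k = 0 then R * deriv φ z.1 else 0 := by
  rw [dirD_shift hφ]
  simp [et]

lemma dirD_weight (hφ : Differentiable ℝ φ) (w : SpaceTime d) (z : SpaceTime d) :
    dirD w (weight κ R φ) z = 2 * κ * ∑ k, shift R φ k z * dirD w (shift R φ k) z := by
  have h1 : ∀ k, Differentiable ℝ (shift (d := d) R φ k) := fun k => by
    unfold shift
    have h1 : Differentiable ℝ (fun z : SpaceTime d => z.2 k) :=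
      (contDiff_coord (m := 1) k).differentiable (by norm_num)
    split_ifs <;> fun_prop
  unfold weight
  simp_rw [sq]
  rw [dirD_const_mul _ _ (by fun_prop), dirD_sum _ _ (by fun_prop), mul_comm (2 : ℝ) κ, mul_assoc,
    Finset.mul_sum (a := (2 : ℝ))]
  congr 1
  refine Finset.sum_congr rfl fun k _ => ?_
  rw [dirD_mul _ (h1 k) (h1 k)]
  ring

lemma dirD_ex_weight (hφ : Differentiable ℝ φ) (l : Fin (d + 1)) :
    dirD (ex l) (weight (d := d) κ R φ) = fun z => 2 * κ * shift R φ l z := by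
  ext z
  rw [dirD_weight hφ]
  simp [dirD_ex_shift hφ]

lemma dirD_et_weight (hφ : Differentiable ℝ φ) :
    dirD et (weight (d := d) κ R φ) =
      fun z => 2 * κ * R * (deriv φ z.1 * shift R φ 0 z) := by
  ext z
  rw [dirD_weight hφ]
  simp [dirD_et_shift hφ]
  ring

lemma dirD_et_et_weight (hφ : ContDiff ℝ 2 φ) (z : SpaceTime d) :
    dirD et (dirD et (weight (d := d) κ R φ)) z =
      2 * κ * R * (deriv (deriv φ) z.1 * shift R φ 0 z + R * deriv φ z.1 ^ 2) := by
  have h1 : Differentiable ℝ φ := hφ.differentiable (by norm_num)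
  have h2 : Differentiable ℝ (deriv φ) :=
    (ContDiff.deriv' (n := 1) (hφ.of_le (by norm_num))).differentiable (by norm_num)
  have h3 : Differentiable ℝ (shift (d := d) R φ 0) :=
    (contDiff_shift hφ 0).differentiable (by norm_num)
  rw [dirD_et_weight h1, dirD_const_mul _ _ (by fun_prop), dirD_mul _ (by fun_prop) h3,
    dirD_fst_comp _ h2, dirD_et_shift h1]
  simp only [et, if_true]
  ring

variable {A : Fin (d + 1) → Fin (d + 1) → SpaceTime d → ℝ} {lam Lam ε K : ℝ}

lemma weightField_weight (hφ : Differentiable ℝ φ) (l : Fin (d + 1)) :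
    weightField A ex (weight κ R φ) l = fun z => 4 * κ * ∑ m, A l m z * shift R φ m z := by
  ext z
  unfold weightField flux
  simp_rw [dirD_ex_weight hφ]
  rw [Finset.mul_sum, Finset.mul_sum]
  exact Finset.sum_congr rfl fun m _ => by ring

lemma dirD_weightField_weight (hA : Admissible A lam Lam ε K) (hφ : ContDiff ℝ 2 φ)
    (w : SpaceTime d) (l : Fin (d + 1)) (z : SpaceTime d) :
    dirD w (weightField A ex (weight κ R φ) l) z =
      4 * κ * ∑ m, (dirD w (A l m) z * shift R φ m z + A l m z * dirD w (shift R φ m) z) := by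
  have h1 : Differentiable ℝ φ := hφ.differentiable (by norm_num)
  have h3 : ∀ k, Differentiable ℝ (shift (d := d) R φ k) := fun k =>
    (contDiff_shift hφ k).differentiable (by norm_num)
  have h4 : ∀ i j, Differentiable ℝ (A i j) := fun i j =>
    (hA.contDiff i j).differentiable (by norm_num)
  rw [weightField_weight h1, dirD_const_mul _ _ (by fun_prop), dirD_sum _ _ (by fun_prop)]
  congr 1
  exact Finset.sum_congr rfl fun m _ => dirD_mul _ (h4 _ _) (h3 _) z

lemma dirD_ex_weightField (hA : Admissible A lam Lam ε K) (hφ : ContDiff ℝ 2 φ)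
    (k l : Fin (d + 1)) (z : SpaceTime d) :
    dirD (ex k) (weightField A ex (weight κ R φ) l) z =
      4 * κ * (A l k z + ∑ m, dirD (ex k) (A l m) z * shift R φ m z) := by
  rw [dirD_weightField_weight hA hφ]
  simp_rw [dirD_ex_shift (hφ.differentiable (by norm_num)), Finset.sum_add_distrib]
  simp
  left
  ring

lemma dirD_et_weightField (hA : Admissible A lam Lam ε K) (hφ : ContDiff ℝ 2 φ)
    (l : Fin (d + 1)) (z : SpaceTime d) :
    dirD et (weightField A ex (weight κ R φ) l) z = 4 * κ * (A l 0 z * (R * deriv φ z.1)) := by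
  rw [dirD_weightField_weight hA hφ]
  simp_rw [dirD_et_shift (hφ.differentiable (by norm_num)), hA.dirD_et]
  simp

lemma dirD_ex_diverg (hA : Admissible A lam Lam ε K) (hφ : ContDiff ℝ 2 φ)
    (k : Fin (d + 1)) (z : SpaceTime d) :
    dirD (ex k) (diverg ex (weightField A ex (weight κ R φ))) z =
      4 * κ * ∑ l, (dirD (ex k) (A l l) z
        + (∑ m, dirD (ex k) (dirD (ex l) (A l m)) z * shift R φ m z + dirD (ex l) (A l k) z)) := by
  have h1 : Differentiable ℝ φ := hφ.differentiable (by norm_num)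
  have h3 : ∀ k, Differentiable ℝ (shift (d := d) R φ k) := fun k =>
    (contDiff_shift hφ k).differentiable (by norm_num)
  have h4 : ∀ i j, Differentiable ℝ (A i j) := fun i j =>
    (hA.contDiff i j).differentiable (by norm_num)
  have h5 : ∀ w i j, Differentiable ℝ (dirD w (A i j)) := fun w i j =>
    (contDiff_dirD (m := 1) _ (hA.contDiff i j) (by norm_num)).differentiable (by norm_num)
  have e : diverg ex (weightField A ex (weight κ R φ)) =
      fun z => 4 * κ * ∑ l, (A l l z + ∑ m, dirD (ex l) (A l m) z * shift R φ m z) := by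
    ext z
    unfold diverg
    simp_rw [dirD_ex_weightField hA hφ, Finset.mul_sum]
  rw [e, dirD_const_mul _ _ (by fun_prop), dirD_sum _ _ (by fun_prop)]
  congr 1
  refine Finset.sum_congr rfl fun l _ => ?_
  rw [dirD_add _ (by fun_prop) (by fun_prop), dirD_sum _ _ (by fun_prop)]
  congr 1
  simp_rw [dirD_mul _ (h5 _ _ _) (h3 _), dirD_ex_shift h1, Finset.sum_add_distrib]
  simp

lemma dirD_ex_weightPot (hA : Admissible A lam Lam ε K) (hφ : ContDiff ℝ 2 φ)
    (l : Fin (d + 1)) (z : SpaceTime d) :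
    dirD (ex l) (weightPot A ex (weight κ R φ)) z =
      4 * κ ^ 2 * (∑ j, ∑ k, dirD (ex l) (A j k) z * shift R φ j z * shift R φ k z
        + 2 * ∑ k, A l k z * shift R φ k z) := by
  have h1 : Differentiable ℝ φ := hφ.differentiable (by norm_num)
  have h3 : ∀ k, Differentiable ℝ (shift (d := d) R φ k) := fun k =>
    (contDiff_shift hφ k).differentiable (by norm_num)
  have h4 : ∀ i j, Differentiable ℝ (A i j) := fun i j =>
    (hA.contDiff i j).differentiable (by norm_num)
  have e : weightPot A ex (weight κ R φ) =
      fun z => 4 * κ ^ 2 * ∑ j, ∑ k, A j k z * shift R φ j z * shift R φ k z := by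
    ext z
    unfold weightPot
    simp_rw [dirD_ex_weight h1, Finset.mul_sum]
    exact Finset.sum_congr rfl fun j _ => Finset.sum_congr rfl fun k _ => by ring
  have e1 : ∀ j k, dirD (ex l) (fun z => A j k z * shift R φ j z * shift R φ k z) z =
      dirD (ex l) (A j k) z * shift R φ j z * shift R φ k z
      + (A j k z * if j = l then 1 else 0) * shift R φ k z
      + A j k z * shift R φ j z * if k = l then 1 else 0 := by
    intro j k
    rw [dirD_mul _ (by fun_prop) (by fun_prop), dirD_mul _ (by fun_prop) (by fun_prop),
      dirD_ex_shift h1, dirD_ex_shift h1]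
    ring
  rw [e, dirD_const_mul _ _ (by fun_prop), dirD_sum _ _ (by fun_prop)]
  congr 1
  have e2 : ∀ j, dirD (ex l) (fun z => ∑ k, A j k z * shift R φ j z * shift R φ k z) z =
      ∑ k, dirD (ex l) (fun z => A j k z * shift R φ j z * shift R φ k z) z := fun j =>
    dirD_sum _ _ (by fun_prop) z
  simp_rw [e2, e1, Finset.sum_add_distrib]
  simp
  have e3 : ∑ x, A x l z * shift R φ x z = ∑ x, A l x z * shift R φ x z :=
    Finset.sum_congr rfl fun x _ => by rw [hA.symm]
  rw [e3]
  ring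

/-- The weight is pseudoconvex: the commutator density is bounded below in the region
`|x| ≤ R ≤ |x + R φ(t) e₁|`. The block structure enters through `s1` and `s2`: a derivative of `A` is
multiplied by the components of `x + R φ(t) e₁` with nonzero index only, which are those of `x'`. -/
lemma carlemanForm_weight_lower (hlam : 0 < lam) (hLam : 0 < Lam) (hε : 0 ≤ ε) (hK : 0 ≤ K)
    (hA : Admissible A lam Lam ε K) (hφ : ContDiff ℝ 2 φ) {c : ℝ}
    (h1φ : ∀ t, |deriv φ t| ≤ c) (h2φ : ∀ t, |deriv (deriv φ) t| ≤ c)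
    (hsmall : 3 * (d + 1 : ℝ) ^ 3 * Lam * ε ≤ lam ^ 2) (hκ : 0 < κ)
    (hκc : 2 * c + 36 * (d + 1 : ℝ) ^ 7 * Lam ^ 2 * K ^ 2 / lam ^ 2
      + 16 * (d + 1 : ℝ) * Lam ^ 2 * c ^ 2 / lam ^ 2 ≤ κ ^ 2 * lam ^ 2)
    (hR : 1 ≤ R) {z : SpaceTime d} (hz : ‖z.2‖ ≤ R) (hz' : R ^ 2 ≤ ∑ k, shift R φ k z ^ 2)
    (p q : SpaceTime d → ℝ) :
    κ ^ 3 * lam ^ 2 * R ^ 2 * (p z ^ 2 + q z ^ 2) ≤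
      carlemanForm A ex et (weight κ R φ) p q z := by
  have hφ1 : Differentiable ℝ φ := hφ.differentiable (by norm_num)
  have hc : 0 ≤ c := (abs_nonneg _).trans (h1φ 0)
  have hshift : ∀ m ≠ 0, shift R φ m z = z.2 m := by
    intro m hm
    simp [shift, hm]
  have s1 : ∀ k l i m : Fin (d + 1), |dirD (ex k) (A i m) z * shift R φ m z| ≤ ε := by
    intro k l i m
    by_cases hm : m = 0
    · rw [hm, hA.dirD_block _ _ _ _ (Or.inr (Or.inr rfl))]; simpa using hε
    · rw [hshift m hm]; exact hA.small _ _ _ _ _ hm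
  have s2 : ∀ l m k j : Fin (d + 1),
      |A l m z * shift R φ m z * dirD (ex l) (A k j) z| ≤ Lam * ε := by
    intro l m k j
    by_cases hl : l = 0
    · rw [hA.dirD_block _ _ _ _ (Or.inl hl)]; simp; positivity
    by_cases hm : m = 0
    · rw [hm, hA.block _ _ hl]; simp; positivity
    · rw [hshift m hm, mul_assoc, mul_comm (z.2 m), abs_mul]
      exact mul_le_mul (hA.abs_le _ _ _) (hA.small _ _ _ _ _ hm) (abs_nonneg _) hLam.le
  have hN : ((Fintype.card (Fin (d + 1)) : ℕ) : ℝ) = (d : ℝ) + 1 := by simp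
  set N : ℝ := (d : ℝ) + 1 with hNdef
  have hN1 : 1 ≤ N := by rw [hNdef]; linarith [Nat.cast_nonneg (α := ℝ) d]
  have s3 : ∀ k, |dirD (ex k) (diverg ex (weightField A ex (weight κ R φ))) z| ≤
      κ * (12 * N ^ 2 * K * R) := by
    intro k
    rw [dirD_ex_diverg hA hφ, abs_mul, abs_of_pos (by positivity : 0 < 4 * κ)]
    have t1 : ∀ l, |dirD (ex k) (A l l) z
        + (∑ m, dirD (ex k) (dirD (ex l) (A l m)) z * shift R φ m z + dirD (ex l) (A l k) z)| ≤
        K + (N * (K * R) + K) := by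
      intro l
      refine (abs_add_le _ _).trans (add_le_add (hA.dirD_le _ _ _ _) ?_)
      refine (abs_add_le _ _).trans (add_le_add ?_ (hA.dirD_le _ _ _ _))
      rw [← hN]
      refine abs_sum_le_card_mul fun m => ?_
      by_cases hm : m = 0
      · have : dirD (ex l) (A l m) = fun _ => 0 := by
          ext y; exact hA.dirD_block _ _ _ _ (Or.inr (Or.inr hm))
        rw [this, dirD_const]; simp; positivity
      · rw [hshift m hm, abs_mul]
        exact mul_le_mul (hA.dirD_dirD_le _ _ _ _ _) ((PiLp.norm_apply_le z.2 m).trans hz)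
          (abs_nonneg _) hK
    have t2 := abs_sum_le_card_mul t1
    rw [hN] at t2
    have t3 : N * (K + (N * (K * R) + K)) ≤ 3 * N ^ 2 * K * R := by
      have u1 : K ≤ N * K * R := by
        calc K = 1 * K * 1 := by ring
          _ ≤ N * K * R := by gcongr
      nlinarith
    calc 4 * κ * _ ≤ 4 * κ * (3 * N ^ 2 * K * R) := by gcongr; exact t2.trans t3
      _ = _ := by ring
  have s4 : ∀ l, |dirD et (weightField A ex (weight κ R φ) l) z| ≤ κ * (4 * Lam * R * c) := by
    intro l
    rw [dirD_et_weightField hA hφ, abs_mul, abs_of_pos (by positivity : 0 < 4 * κ), abs_mul, abs_mul,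
      abs_of_nonneg (by linarith : 0 ≤ R)]
    calc 4 * κ * (|A l 0 z| * (R * |deriv φ z.1|)) ≤ 4 * κ * (Lam * (R * c)) := by
          gcongr
          · exact hA.abs_le _ _ _
          · exact h1φ _
      _ = _ := by ring
  rw [← hN] at hsmall
  have low : ∀ f : SpaceTime d → ℝ, 3 * κ * lam ^ 2 * ∑ k, dirD (ex k) f z ^ 2
      - κ * (N ^ 3 * Lam ^ 2 * (12 * N ^ 2 * K * R) ^ 2 / (4 * lam ^ 2)) * f z ^ 2 ≤
      commForm A ex (weightField A ex (weight κ R φ)) f z := by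
    intro f
    have := commForm_lower (A := fun i j => A i j z) (dA := fun l i j => dirD (ex l) (A i j) z)
      (z := fun k => shift R φ k z) (ξ := fun k => dirD (ex k) f z) (p := f z)
      (D := fun k => dirD (ex k) (diverg ex (weightField A ex (weight κ R φ))) z)
      hlam hLam hε hκ (fun i j => hA.abs_le z i j) (fun i j => by rw [hA.symm])
      (hA.elliptic z _) (fun k l m => s1 k l l m) s2 s3 hsmall
    rw [hN] at this
    unfold commForm flux
    simp_rw [dirD_ex_weightField hA hφ, weightField_weight hφ1]
    exact this
  have lp := low p
  have lq := low q
  have pot := potential_lower (A := fun i j => A i j z) (dA := fun l i j => dirD (ex l) (A i j) z)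
      (z := fun k => shift R φ k z) (lam := lam) hLam hε hκ (fun i j => hA.abs_le z i j)
      (hA.elliptic z _) (fun k l m => s1 k l l m) hsmall
  have cr := cross_lower (Y := fun l => dirD et (weightField A ex (weight κ R φ) l) z)
    (ξ := fun l => dirD (ex l) p z) (η := fun l => dirD (ex l) q z) (p := p z) (q := q z)
    hlam hκ s4
  have pot' : 16 * κ ^ 3 * lam ^ 2 * ∑ k, shift R φ k z ^ 2 ≤
      ∑ l, weightField A ex (weight κ R φ) l z * dirD (ex l) (weightPot A ex (weight κ R φ)) z := by
    simp_rw [dirD_ex_weightPot hA hφ, weightField_weight hφ1]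
    exact pot
  set S := ∑ k, shift R φ k z ^ 2 with hS
  have tt : -(2 * κ * c * S) ≤ dirD et (dirD et (weight κ R φ)) z := by
    rw [dirD_et_et_weight hφ]
    have u0 : shift R φ 0 z ^ 2 ≤ S :=
      Finset.single_le_sum (f := fun k => shift R φ k z ^ 2) (fun _ _ => sq_nonneg _)
        (Finset.mem_univ _)
    have u1 : R * |shift R φ 0 z| ≤ S := by
      have := sq_nonneg (R - |shift R φ 0 z|)
      have := sq_abs (shift R φ 0 z)
      nlinarith
    have u2 : |R * (deriv (deriv φ) z.1 * shift R φ 0 z)| ≤ c * S := by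
      rw [abs_mul, abs_mul, abs_of_nonneg (by linarith : 0 ≤ R)]
      calc R * (|deriv (deriv φ) z.1| * |shift R φ 0 z|)
          = |deriv (deriv φ) z.1| * (R * |shift R φ 0 z|) := by ring
        _ ≤ c * S := mul_le_mul (h2φ _) u1 (by positivity) hc
    have u3 := neg_abs_le (R * (deriv (deriv φ) z.1 * shift R φ 0 z))
    have u4 : -(c * S) ≤ R * (deriv (deriv φ) z.1 * shift R φ 0 z + R * deriv φ z.1 ^ 2) := by
      have : 0 ≤ R * (R * deriv φ z.1 ^ 2) := by positivity
      linarith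
    have := mul_le_mul_of_nonneg_left u4 (by positivity : 0 ≤ 2 * κ)
    linarith
  set G := ∑ k, dirD (ex k) p z ^ 2 with hG
  set G' := ∑ k, dirD (ex k) q z ^ 2 with hG'
  have hG0 : 0 ≤ κ * lam ^ 2 * (G + G') := by
    have : 0 ≤ G := Finset.sum_nonneg fun _ _ => sq_nonneg _
    have : 0 ≤ G' := Finset.sum_nonneg fun _ _ => sq_nonneg _
    positivity
  rw [hN] at cr
  set P := p z ^ 2 + q z ^ 2 with hP
  have hP0 : 0 ≤ P := by positivity
  have z1 : (16 * κ ^ 3 * lam ^ 2 - 2 * κ * c) * S ≤ dirD et (dirD et (weight κ R φ)) z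
    + ∑ l, weightField A ex (weight κ R φ) l z * dirD (ex l) (weightPot A ex (weight κ R φ)) z := by
    linarith
  have q1 : 0 ≤ 36 * N ^ 7 * Lam ^ 2 * K ^ 2 / lam ^ 2 := by positivity
  have q2 : 0 ≤ 16 * N * Lam ^ 2 * c ^ 2 / lam ^ 2 := by positivity
  have hκc' := mul_le_mul_of_nonneg_left hκc hκ.le
  have hpos : 0 ≤ 16 * κ ^ 3 * lam ^ 2 - 2 * κ * c := by
    have : 0 ≤ κ ^ 3 * lam ^ 2 := by positivity
    have w : 2 * c ≤ κ ^ 2 * lam ^ 2 := by linarith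
    have := mul_le_mul_of_nonneg_left w hκ.le
    linarith
  have z2 : (16 * κ ^ 3 * lam ^ 2 - 2 * κ * c) * R ^ 2 * P ≤
      (dirD et (dirD et (weight κ R φ)) z
    + ∑ l, weightField A ex (weight κ R φ) l z * dirD (ex l) (weightPot A ex (weight κ R φ)) z)
      * P :=
    mul_le_mul_of_nonneg_right ((mul_le_mul_of_nonneg_left hz' hpos).trans z1) hP0
  have c1 : κ * (N ^ 3 * Lam ^ 2 * (12 * N ^ 2 * K * R) ^ 2 / (4 * lam ^ 2)) =
      κ * (36 * N ^ 7 * Lam ^ 2 * K ^ 2 / lam ^ 2) * R ^ 2 := by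
    field_simp; ring
  have c2 : κ * (N * (4 * Lam * R * c) ^ 2 / lam ^ 2) =
      κ * (16 * N * Lam ^ 2 * c ^ 2 / lam ^ 2) * R ^ 2 := by
    field_simp; ring
  rw [c1] at lp lq
  rw [c2] at cr
  have z3 : (2 * κ * c + κ * (36 * N ^ 7 * Lam ^ 2 * K ^ 2 / lam ^ 2)
      + κ * (16 * N * Lam ^ 2 * c ^ 2 / lam ^ 2)) * (R ^ 2 * P) ≤
      κ ^ 3 * lam ^ 2 * (R ^ 2 * P) := by
    refine mul_le_mul_of_nonneg_right ?_ (by positivity)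
    linarith
  have z4 : 0 ≤ κ ^ 3 * lam ^ 2 * (R ^ 2 * P) := by positivity
  unfold carlemanForm
  linarith

end Weight

/-! ### Conjugation and the Carleman inequality -/

section Conjugation

variable {F : Type*} [NormedAddCommGroup F] [NormedSpace ℝ F] {ι : Type*} [Fintype ι]
variable {a : ι → ι → F → ℝ} {v : ι → F} {τ : F} {ψ g h : F → ℝ}

lemma dirD_exp_mul (w : F) (hψ : Differentiable ℝ ψ) (hg : Differentiable ℝ g) (z : F) :
    dirD w (fun y => Real.exp (ψ y) * g y) z =
      Real.exp (ψ z) * (dirD w g z + g z * dirD w ψ z) := by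
  rw [dirD_mul _ (by fun_prop) hg, dirD_comp w Real.differentiable_exp hψ, Real.deriv_exp]
  ring

lemma sum_dirD_mul_flux_comm (hs : ∀ i j, a i j = a j i) (f g : F → ℝ) (z : F) :
    ∑ k, dirD (v k) f z * flux a v g k z = ∑ k, dirD (v k) g z * flux a v f k z := by
  unfold flux
  simp_rw [Finset.mul_sum]
  rw [Finset.sum_comm]
  refine Finset.sum_congr rfl fun i _ => Finset.sum_congr rfl fun j _ => ?_
  rw [hs i j]; ring

lemma divOp_mul (hs : ∀ i j, a i j = a j i) (ha : ∀ i j, ContDiff ℝ 2 (a i j))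
    (hg : ContDiff ℝ 2 g) (hh : ContDiff ℝ 2 h) (z : F) :
    divOp a v (fun y => g y * h y) z = g z * divOp a v h z
      + 2 * ∑ k, dirD (v k) g z * flux a v h k z + h z * divOp a v g z := by
  have dg : Differentiable ℝ g := hg.differentiable (by norm_num)
  have dh : Differentiable ℝ h := hh.differentiable (by norm_num)
  have fg : ∀ k, Differentiable ℝ (flux a v g k) := fun k =>
    (contDiff_flux (m := 1) (fun i j => (ha i j).of_le (by norm_num))
      (hg.of_le (by norm_num)) k).differentiable (by norm_num)
  have fh : ∀ k, Differentiable ℝ (flux a v h k) := fun k =>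
    (contDiff_flux (m := 1) (fun i j => (ha i j).of_le (by norm_num))
      (hh.of_le (by norm_num)) k).differentiable (by norm_num)
  have e : ∀ k, flux a v (fun y => g y * h y) k =
      fun y => g y * flux a v h k y + h y * flux a v g k y := by
    intro k
    ext y
    unfold flux
    rw [Finset.mul_sum, Finset.mul_sum, ← Finset.sum_add_distrib]
    refine Finset.sum_congr rfl fun j _ => ?_
    rw [dirD_mul _ dg dh]; ring
  have e2 : ∀ k, dirD (v k) (flux a v (fun y => g y * h y) k) z =
      g z * dirD (v k) (flux a v h k) z + dirD (v k) g z * flux a v h k z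
        + dirD (v k) h z * flux a v g k z + h z * dirD (v k) (flux a v g k) z := by
    intro k
    rw [e, dirD_add _ (by fun_prop) (by fun_prop), dirD_mul _ dg (fh k), dirD_mul _ dh (fg k)]
    ring
  unfold divOp
  simp_rw [e2, Finset.sum_add_distrib, ← Finset.mul_sum]
  rw [sum_dirD_mul_flux_comm hs h g]
  ring

lemma divOp_exp (ha : ∀ i j, ContDiff ℝ 2 (a i j)) (hψ : ContDiff ℝ 3 ψ) (z : F) :
    divOp a v (fun y => Real.exp (ψ y)) z =
      Real.exp (ψ z) * (weightPot a v ψ z + divOp a v ψ z) := by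
  have dψ : Differentiable ℝ ψ := hψ.differentiable (by norm_num)
  have fψ : ∀ k, Differentiable ℝ (flux a v ψ k) := fun k =>
    (contDiff_flux (m := 1) (fun i j => (ha i j).of_le (by norm_num))
      (hψ.of_le (by norm_num)) k).differentiable (by norm_num)
  have dexp : ∀ w y, dirD w (fun y => Real.exp (ψ y)) y = Real.exp (ψ y) * dirD w ψ y := by
    intro w y
    rw [dirD_comp w Real.differentiable_exp dψ, Real.deriv_exp]
  have e : ∀ k, flux a v (fun y => Real.exp (ψ y)) k =
      fun y => Real.exp (ψ y) * flux a v ψ k y := by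
    intro k
    ext y
    unfold flux
    rw [Finset.mul_sum]
    refine Finset.sum_congr rfl fun j _ => ?_
    rw [dexp]; ring
  have e2 : ∀ k, dirD (v k) (flux a v (fun y => Real.exp (ψ y)) k) z =
      Real.exp (ψ z) * (flux a v ψ k z * dirD (v k) ψ z) +
      Real.exp (ψ z) * dirD (v k) (flux a v ψ k) z := by
    intro k
    rw [e, dirD_exp_mul _ dψ (fψ k)]
    ring
  unfold divOp weightPot
  simp_rw [e2, Finset.sum_add_distrib, ← Finset.mul_sum]
  rw [mul_add]
  congr 2
  refine Finset.sum_congr rfl fun j _ => ?_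
  unfold flux
  rw [Finset.sum_mul]
  exact Finset.sum_congr rfl fun k _ => by ring

/-- The conjugated operator applied to `e^ψ (g + i h)` is `e^ψ` times the original operator applied
to `g + i h`. -/
lemma conjOp_exp_mul (hs : ∀ i j, a i j = a j i) (ha : ∀ i j, ContDiff ℝ 2 (a i j))
    (hψ : ContDiff ℝ 3 ψ) (hg : ContDiff ℝ 2 g) (hh : ContDiff ℝ 2 h) (z : F) :
    conjOp a v τ ψ (fun y => Real.exp (ψ y) * g y) (fun y => Real.exp (ψ y) * h y) z =
      Real.exp (ψ z) * (-dirD τ h z + divOp a v g z) := by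
  have dψ : Differentiable ℝ ψ := hψ.differentiable (by norm_num)
  have dg : Differentiable ℝ g := hg.differentiable (by norm_num)
  have dh : Differentiable ℝ h := hh.differentiable (by norm_num)
  have fψ : ∀ k, Differentiable ℝ (flux a v ψ k) := fun k =>
    (contDiff_flux (m := 1) (fun i j => (ha i j).of_le (by norm_num))
      (hψ.of_le (by norm_num)) k).differentiable (by norm_num)
  have cexp : ContDiff ℝ 2 (fun y => Real.exp (ψ y)) :=
    Real.contDiff_exp.comp (hψ.of_le (by norm_num))
  have eX : diverg v (weightField a v ψ) z = 2 * divOp a v ψ z := by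
    unfold diverg divOp
    rw [Finset.mul_sum]
    exact Finset.sum_congr rfl fun k _ => dirD_const_mul _ _ (fψ k) z
  have e1 : ∑ k, dirD (v k) (fun y => Real.exp (ψ y)) z * flux a v g k z =
      Real.exp (ψ z) * ∑ k, dirD (v k) ψ z * flux a v g k z := by
    rw [Finset.mul_sum]
    refine Finset.sum_congr rfl fun k _ => ?_
    rw [dirD_comp _ Real.differentiable_exp dψ, Real.deriv_exp]; ring
  have eQ : weightPot a v ψ z = ∑ k, dirD (v k) ψ z * flux a v ψ k z := by
    unfold weightPot flux
    refine Finset.sum_congr rfl fun k _ => ?_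
    rw [Finset.mul_sum]
    exact Finset.sum_congr rfl fun k _ => by ring
  have eM : ∑ l, weightField a v ψ l z * dirD (v l) (fun y => Real.exp (ψ y) * g y) z =
      2 * Real.exp (ψ z) * ∑ k, dirD (v k) ψ z * flux a v g k z
      + 2 * Real.exp (ψ z) * (g z * weightPot a v ψ z) := by
    rw [sum_dirD_mul_flux_comm hs ψ g, eQ, Finset.mul_sum, Finset.mul_sum, Finset.mul_sum,
      ← Finset.sum_add_distrib]
    refine Finset.sum_congr rfl fun k _ => ?_
    rw [dirD_exp_mul _ dψ dg]
    unfold weightField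
    ring
  unfold conjOp multOp
  rw [dirD_exp_mul _ dψ dh, divOp_mul hs ha cexp hg, divOp_exp ha hψ, e1, eX, eM]
  ring

lemma conjOp_exp_mul_neg (hs : ∀ i j, a i j = a j i) (ha : ∀ i j, ContDiff ℝ 2 (a i j))
    (hψ : ContDiff ℝ 3 ψ) (hg : ContDiff ℝ 2 g) (hh : ContDiff ℝ 2 h) (z : F) :
    conjOp a v τ ψ (fun y => Real.exp (ψ y) * h y) (fun y => -(Real.exp (ψ y) * g y)) z =
      Real.exp (ψ z) * (dirD τ g z + divOp a v h z) := by
  have := conjOp_exp_mul (v := v) (τ := τ) hs ha hψ hh hg.neg z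
  simp only [mul_neg] at this
  rw [this, dirD_neg]
  ring

end Conjugation

section CarlemanInequality

variable {d : ℕ} {A : Fin (d + 1) → Fin (d + 1) → SpaceTime d → ℝ} {lam Lam ε K κ R : ℝ}
  {φ : ℝ → ℝ}

instance isAddHaarMeasure_volume : (volume : Measure (SpaceTime d)).IsAddHaarMeasure :=
  Measure.prod.instIsAddHaarMeasure volume volume

/-- The conditions on the parameters under which the weight `κ |x + R φ(t) e₁|²` yields a Carleman
inequality. The number `c` bounds the first two derivatives of `φ`. -/
structure GoodParams (d : ℕ) (lam Lam ε K κ c : ℝ) (φ : ℝ → ℝ) : Prop where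
  lam_pos : 0 < lam
  Lam_pos : 0 < Lam
  eps_nonneg : 0 ≤ ε
  K_nonneg : 0 ≤ K
  contDiff : ContDiff ℝ 3 φ
  deriv_le : ∀ t, |deriv φ t| ≤ c
  deriv_deriv_le : ∀ t, |deriv (deriv φ) t| ≤ c
  eps_small : 3 * (d + 1 : ℝ) ^ 3 * Lam * ε ≤ lam ^ 2
  kappa_pos : 0 < κ
  kappa_large : 2 * c + 36 * (d + 1 : ℝ) ^ 7 * Lam ^ 2 * K ^ 2 / lam ^ 2
      + 16 * (d + 1 : ℝ) * Lam ^ 2 * c ^ 2 / lam ^ 2 ≤ κ ^ 2 * lam ^ 2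

/-- Carleman inequality for functions `g₁ + i g₂` supported in a compact set on which the weight is
pseudoconvex. -/
theorem carleman_inequality {c : ℝ} (hP : GoodParams d lam Lam ε K κ c φ)
    (hA : Admissible A lam Lam ε K) (hR : 1 ≤ R) {g₁ g₂ : SpaceTime d → ℝ}
    (h₁ : ContDiff ℝ 2 g₁) (h₂ : ContDiff ℝ 2 g₂) {S : Set (SpaceTime d)} (hSc : IsCompact S)
    (hS : ∀ z ∈ S, ‖z.2‖ ≤ R ∧ R ^ 2 ≤ ∑ k, shift R φ k z ^ 2)
    (hs₁ : tsupport g₁ ⊆ S) (hs₂ : tsupport g₂ ⊆ S) :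
    ∫⁻ z, ENNReal.ofReal (κ ^ 3 * lam ^ 2 * R ^ 2 *
      (Real.exp (weight κ R φ z) ^ 2 * (g₁ z ^ 2 + g₂ z ^ 2))) ≤
    ∫⁻ z, ENNReal.ofReal (Real.exp (weight κ R φ z) ^ 2 *
      ((-dirD et g₂ z + divOp A ex g₁ z) ^ 2 + (dirD et g₁ z + divOp A ex g₂ z) ^ 2)) := by
  have hψ : ContDiff ℝ 3 (weight (d := d) κ R φ) := contDiff_weight hP.contDiff
  have hexp : ContDiff ℝ 2 (fun z : SpaceTime d => Real.exp (weight κ R φ z)) :=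
    Real.contDiff_exp.comp (hψ.of_le (by norm_num))
  set p : SpaceTime d → ℝ := fun z => Real.exp (weight κ R φ z) * g₁ z with hp
  set q : SpaceTime d → ℝ := fun z => Real.exp (weight κ R φ z) * g₂ z with hq
  have sp : tsupport p ⊆ S := (closure_minimal (fun z hz => subset_tsupport _ (by
    simp only [hp, Function.mem_support, ne_eq, mul_eq_zero, not_or] at hz
    exact hz.2)) (isClosed_tsupport g₁)).trans hs₁
  have sq : tsupport q ⊆ S := (closure_minimal (fun z hz => subset_tsupport _ (by
    simp only [hq, Function.mem_support, ne_eq, mul_eq_zero, not_or] at hz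
    exact hz.2)) (isClosed_tsupport g₂)).trans hs₂
  have cp : HasCompactSupport p := hSc.of_isClosed_subset (isClosed_tsupport _) sp
  have cq : HasCompactSupport q := hSc.of_isClosed_subset (isClosed_tsupport _) sq
  have dp : ContDiff ℝ 2 p := hexp.mul h₁
  have dq : ContDiff ℝ 2 q := hexp.mul h₂
  obtain ⟨i1, i2, hle⟩ := integral_carlemanForm_le (v := ex) (τ := et) volume hA.symm hA.dirD_et
    hA.contDiff hψ dp dq cp cq
  have low : ∀ z, κ ^ 3 * lam ^ 2 * R ^ 2 *
      (Real.exp (weight κ R φ z) ^ 2 * (g₁ z ^ 2 + g₂ z ^ 2)) ≤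
      carlemanForm A ex et (weight κ R φ) p q z := by
    intro z
    by_cases hz : z ∈ S
    · have := carlemanForm_weight_lower hP.lam_pos hP.Lam_pos hP.eps_nonneg hP.K_nonneg hA
        (hP.contDiff.of_le (by norm_num)) hP.deriv_le hP.deriv_deriv_le hP.eps_small hP.kappa_pos
        hP.kappa_large hR (hS z hz).1 (hS z hz).2 p q
      refine le_trans (le_of_eq ?_) this
      simp only [hp, hq]; ring
    · rw [carlemanForm_eq_zero (fun h => hz (sp h)) (fun h => hz (sq h)),
        image_eq_zero_of_notMem_tsupport (fun h => hz (hs₁ h)),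
        image_eq_zero_of_notMem_tsupport (fun h => hz (hs₂ h))]
      simp
  have hκ := hP.kappa_pos
  have nn : ∀ z, 0 ≤ carlemanForm A ex et (weight κ R φ) p q z := fun z =>
    le_trans (by positivity) (low z)
  have e : ∀ z, Real.exp (weight κ R φ z) ^ 2 *
      ((-dirD et g₂ z + divOp A ex g₁ z) ^ 2 + (dirD et g₁ z + divOp A ex g₂ z) ^ 2) =
      conjOp A ex et (weight κ R φ) p q z ^ 2
        + conjOp A ex et (weight κ R φ) q (fun y => -p y) z ^ 2 := by
    intro z
    rw [hp, hq, conjOp_exp_mul hA.symm hA.contDiff hψ h₁ h₂,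
      conjOp_exp_mul_neg hA.symm hA.contDiff hψ h₁ h₂]
    ring
  simp_rw [e]
  refine (lintegral_mono fun z => ENNReal.ofReal_le_ofReal (low z)).trans ?_
  rw [← ofReal_integral_eq_lintegral_ofReal i1 (Filter.Eventually.of_forall nn),
    ← ofReal_integral_eq_lintegral_ofReal i2 (Filter.Eventually.of_forall fun z => by positivity)]
  exact ENNReal.ofReal_le_ofReal hle

end CarlemanInequality

/-! ### The time profile and the cutoff -/

section Cutoff

lemma exists_bound_deriv_smoothTransition :
    ∃ C : ℝ, 1 ≤ C ∧ (∀ x, |deriv Real.smoothTransition x| ≤ C) ∧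
      ∀ x, |deriv (deriv Real.smoothTransition) x| ≤ C := by
  have h0 : ContDiff ℝ 2 Real.smoothTransition := Real.smoothTransition.contDiff (n := 2)
  have h1 : ContDiff ℝ 1 (deriv Real.smoothTransition) :=
    ContDiff.deriv' (n := 1) (h0.of_le (by norm_num))
  have h2 : Continuous (deriv (deriv Real.smoothTransition)) :=
    h1.continuous_deriv (by norm_num)
  have s1 : HasCompactSupport (deriv Real.smoothTransition) := by
    refine HasCompactSupport.intro (isCompact_Icc (a := (0 : ℝ)) (b := 1)) fun x hx => ?_
    rw [mem_Icc, not_and_or, not_le, not_le] at hx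
    rcases hx with hx | hx
    · have : Real.smoothTransition =ᶠ[nhds x] fun _ => 0 := by
        filter_upwards [Iio_mem_nhds hx] with y hy
        exact Real.smoothTransition.zero_of_nonpos (le_of_lt hy)
      rw [this.deriv_eq]; simp
    · have : Real.smoothTransition =ᶠ[nhds x] fun _ => 1 := by
        filter_upwards [Ioi_mem_nhds hx] with y hy
        exact Real.smoothTransition.one_of_one_le (le_of_lt hy)
      rw [this.deriv_eq]; simp
  obtain ⟨C1, hC1⟩ := s1.exists_bound_of_continuous h1.continuous
  obtain ⟨C2, hC2⟩ := s1.deriv.exists_bound_of_continuous h2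
  refine ⟨max 1 (max C1 C2), le_max_left _ _, fun x => ?_, fun x => ?_⟩
  · exact (hC1 x).trans ((le_max_left _ _).trans (le_max_right _ _))
  · exact (hC2 x).trans ((le_max_right _ _).trans (le_max_right _ _))

/-- A smooth function of time with values in `[0, 4]`, equal to `4` on `[1/4, 3/4]` and to `0`
outside `[1/8, 7/8]`. -/
noncomputable def timeBump (t : ℝ) : ℝ :=
  4 * (Real.smoothTransition (8 * t - 1) * Real.smoothTransition (7 - 8 * t))

lemma contDiff_timeBump : ContDiff ℝ 3 timeBump := by
  have h0 : ContDiff ℝ 3 Real.smoothTransition := Real.smoothTransition.contDiff (n := 3)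
  unfold timeBump
  exact contDiff_const.mul ((h0.comp (by fun_prop)).mul (h0.comp (by fun_prop)))

lemma timeBump_nonneg (t : ℝ) : 0 ≤ timeBump t :=
  mul_nonneg (by norm_num)
    (mul_nonneg (Real.smoothTransition.nonneg _) (Real.smoothTransition.nonneg _))

lemma timeBump_le (t : ℝ) : timeBump t ≤ 4 := by
  have := mul_le_one₀ (Real.smoothTransition.le_one (8 * t - 1))
    (Real.smoothTransition.nonneg (7 - 8 * t)) (Real.smoothTransition.le_one (7 - 8 * t))
  unfold timeBump
  linarith

lemma timeBump_eq {t : ℝ} (ht : t ∈ Icc (1 / 4 : ℝ) (3 / 4)) : timeBump t = 4 := by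
  unfold timeBump
  rw [Real.smoothTransition.one_of_one_le (by linarith [ht.1]),
    Real.smoothTransition.one_of_one_le (by linarith [ht.2])]
  norm_num

lemma timeBump_eq_zero {t : ℝ} (ht : t ∉ Icc (1 / 8 : ℝ) (7 / 8)) : timeBump t = 0 := by
  rw [mem_Icc, not_and_or, not_le, not_le] at ht
  unfold timeBump
  rcases ht with ht | ht
  · rw [Real.smoothTransition.zero_of_nonpos (by linarith)]; simp
  · rw [Real.smoothTransition.zero_of_nonpos (x := 7 - 8 * t) (by linarith)]; simp

lemma exists_bound_deriv_timeBump :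
    ∃ C : ℝ, (∀ x, |deriv timeBump x| ≤ C) ∧ ∀ x, |deriv (deriv timeBump) x| ≤ C := by
  have h1 : ContDiff ℝ 2 (deriv timeBump) :=
    ContDiff.deriv' (n := 2) (contDiff_timeBump.of_le (by norm_num))
  have h2 : Continuous (deriv (deriv timeBump)) := h1.continuous_deriv (by norm_num)
  have s1 : HasCompactSupport timeBump :=
    HasCompactSupport.intro (isCompact_Icc (a := (1 / 8 : ℝ)) (b := 7 / 8))
      fun x hx => timeBump_eq_zero hx
  obtain ⟨C1, hC1⟩ := s1.deriv.exists_bound_of_continuous h1.continuous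
  obtain ⟨C2, hC2⟩ := s1.deriv.deriv.exists_bound_of_continuous h2
  exact ⟨max C1 C2, fun x => (hC1 x).trans (le_max_left _ _),
    fun x => (hC2 x).trans (le_max_right _ _)⟩

variable {d : ℕ} {R : ℝ}

lemma norm_sq_snd (z : SpaceTime d) : ‖z.2‖ ^ 2 = ∑ k, z.2 k ^ 2 := by
  rw [EuclideanSpace.norm_sq_eq]; simp

/-- The argument `(R² - |x|²) / R` of the spatial cutoff. -/
noncomputable def outerArg (R : ℝ) (z : SpaceTime d) : ℝ := (R ^ 2 - ∑ k, z.2 k ^ 2) / R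

/-- The argument `(|x + R φ(t) e₁|² - R²) / (3 R²)` of the cutoff away from the moving centre. -/
noncomputable def innerArg (R : ℝ) (z : SpaceTime d) : ℝ :=
  ((∑ k, shift R timeBump k z ^ 2) - R ^ 2) / (3 * R ^ 2)

/-- The cutoff: it vanishes unless `|x| ≤ R ≤ |x + R φ(t) e₁|`, and equals `1` if
`|x|² ≤ R² - R` and `|x + R φ(t) e₁| ≥ 2 R`. -/
noncomputable def cutoff (R : ℝ) (z : SpaceTime d) : ℝ :=
  Real.smoothTransition (outerArg R z) * Real.smoothTransition (innerArg R z)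

/-- The region containing the support of the cutoff. -/
def cutoffRegion (d : ℕ) (R : ℝ) : Set (SpaceTime d) :=
  {z | z.1 ∈ Icc (1 / 8 : ℝ) (7 / 8) ∧ ‖z.2‖ ≤ R ∧ R ^ 2 ≤ ∑ k, shift R timeBump k z ^ 2}

/-- The part of the region where the cutoff may fail to be locally constant. -/
def cutoffEdge (d : ℕ) (R : ℝ) : Set (SpaceTime d) :=
  {z | z ∈ cutoffRegion d R ∧ (R - 1 < ‖z.2‖ ∨ ∑ k, shift R timeBump k z ^ 2 ≤ 4 * R ^ 2)}

lemma continuous_sum_shift_sq :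
    Continuous fun z : SpaceTime d => ∑ k, shift R timeBump k z ^ 2 :=
  continuous_finsetSum _ fun k _ => (contDiff_shift contDiff_timeBump k).continuous.pow 2

lemma isClosed_cutoffRegion : IsClosed (cutoffRegion d R) := by
  have h1 : IsClosed {z : SpaceTime d | z.1 ∈ Icc (1 / 8 : ℝ) (7 / 8)} :=
    isClosed_Icc.preimage continuous_fst
  have h2 : IsClosed {z : SpaceTime d | ‖z.2‖ ≤ R} :=
    isClosed_le continuous_snd.norm continuous_const
  have h3 : IsClosed {z : SpaceTime d | R ^ 2 ≤ ∑ k, shift R timeBump k z ^ 2} :=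
    isClosed_le continuous_const continuous_sum_shift_sq
  exact h1.inter (h2.inter h3)

lemma isCompact_cutoffRegion : IsCompact (cutoffRegion d R) := by
  refine ((isCompact_Icc (a := (1 / 8 : ℝ)) (b := 7 / 8)).prod
    (isCompact_closedBall (0 : EuclideanSpace ℝ (Fin (d + 1))) R)).of_isClosed_subset
    isClosed_cutoffRegion fun z hz => ?_
  exact ⟨hz.1, by simpa using hz.2.1⟩

lemma measurableSet_cutoffEdge : MeasurableSet (cutoffEdge d R) := by
  refine isClosed_cutoffRegion.measurableSet.inter (MeasurableSet.union ?_ ?_)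
  · exact (isOpen_lt continuous_const continuous_snd.norm).measurableSet
  · exact (isClosed_le continuous_sum_shift_sq continuous_const).measurableSet

lemma cutoff_nonneg (z : SpaceTime d) : 0 ≤ cutoff R z :=
  mul_nonneg (Real.smoothTransition.nonneg _) (Real.smoothTransition.nonneg _)

lemma cutoff_le_one (z : SpaceTime d) : cutoff R z ≤ 1 :=
  mul_le_one₀ (Real.smoothTransition.le_one _) (Real.smoothTransition.nonneg _)
    (Real.smoothTransition.le_one _)

lemma contDiff_outerArg : ContDiff ℝ 2 (outerArg (d := d) R) :=
  (contDiff_const.sub (ContDiff.sum fun k _ => (contDiff_coord k).pow 2)).div_const _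

lemma contDiff_innerArg : ContDiff ℝ 2 (innerArg (d := d) R) :=
  ((ContDiff.sum fun k _ => ((contDiff_shift contDiff_timeBump k).of_le (by norm_num)).pow 2).sub
    contDiff_const).div_const _

lemma contDiff_cutoff : ContDiff ℝ 2 (cutoff (d := d) R) := by
  have h0 : ContDiff ℝ 2 Real.smoothTransition := Real.smoothTransition.contDiff (n := 2)
  exact (h0.comp contDiff_outerArg).mul (h0.comp contDiff_innerArg)

lemma cutoff_eq_zero (hR : 1 ≤ R) {z : SpaceTime d} (hz : z ∉ cutoffRegion d R) :
    cutoff R z = 0 := by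
  have hR0 : 0 < R := by linarith
  by_contra hne
  unfold cutoff at hne
  rw [mul_eq_zero, not_or, Real.smoothTransition.zero_iff_nonpos,
    Real.smoothTransition.zero_iff_nonpos, not_le, not_le] at hne
  obtain ⟨h1, h2⟩ := hne
  unfold outerArg at h1
  unfold innerArg at h2
  rw [div_pos_iff_of_pos_right hR0, ← norm_sq_snd] at h1
  rw [div_pos_iff_of_pos_right (by positivity)] at h2
  refine hz ⟨?_, ?_, by linarith⟩
  · by_contra ht
    have : ∑ k, shift R timeBump k z ^ 2 = ‖z.2‖ ^ 2 := by
      rw [norm_sq_snd]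
      refine Finset.sum_congr rfl fun k _ => ?_
      simp [shift, timeBump_eq_zero ht]
    linarith
  · exact abs_le_of_sq_le_sq' (by linarith) hR0.le |>.2

/-- Since `0 ≤ φ ≤ 4`, the points of `B_R` lie within `5 R` of the moving centre. -/
lemma sum_shift_sq_le (hR : 0 ≤ R) {z : SpaceTime d} (hz : ‖z.2‖ ≤ R) :
    ∑ k, shift R timeBump k z ^ 2 ≤ 25 * R ^ 2 := by
  have e : ∑ k, shift R timeBump k z ^ 2 =
      ‖z.2‖ ^ 2 + 2 * z.2 0 * (R * timeBump z.1) + (R * timeBump z.1) ^ 2 := by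
    rw [norm_sq_snd, Fin.sum_univ_succ, Fin.sum_univ_succ]
    simp [shift, Fin.succ_ne_zero]
    ring
  have h0 : z.2 0 ≤ R := (le_abs_self _).trans ((PiLp.norm_apply_le z.2 0).trans hz)
  have h1 : 0 ≤ R * timeBump z.1 := mul_nonneg hR (timeBump_nonneg _)
  have h2 : R * timeBump z.1 ≤ R * 4 := mul_le_mul_of_nonneg_left (timeBump_le _) hR
  have h3 : ‖z.2‖ ^ 2 ≤ R ^ 2 := by gcongr
  have h4 : z.2 0 * (R * timeBump z.1) ≤ R * (R * 4) :=
    (mul_le_mul_of_nonneg_right h0 h1).trans (mul_le_mul_of_nonneg_left h2 hR)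
  have h5 : (R * timeBump z.1) ^ 2 ≤ (R * 4) ^ 2 := by gcongr
  rw [e]; nlinarith

/-- While `φ = 4`, the points of `B_R` are at distance at least `3 R` from the moving centre. -/
lemma le_sum_shift_sq {R₀ : ℝ} {z : SpaceTime d} (ht : z.1 ∈ Icc (1 / 4 : ℝ) (3 / 4))
    (hz : ‖z.2‖ ≤ R₀) (hR₀ : R₀ ≤ R) : 9 * R ^ 2 ≤ ∑ k, shift R timeBump k z ^ 2 := by
  have h0 : 0 ≤ R := ((norm_nonneg _).trans hz).trans hR₀
  have h1 : -R ≤ z.2 0 := (abs_le.1 ((PiLp.norm_apply_le z.2 0).trans (hz.trans hR₀))).1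
  have h2 : 3 * R ≤ shift R timeBump 0 z := by
    simp [shift, timeBump_eq ht]
    linarith
  calc 9 * R ^ 2 = (3 * R) ^ 2 := by ring
    _ ≤ shift R timeBump 0 z ^ 2 := by gcongr
    _ ≤ _ := Finset.single_le_sum (f := fun k => shift R timeBump k z ^ 2)
      (fun _ _ => sq_nonneg _) (Finset.mem_univ _)

lemma one_le_outerArg (hR : 0 < R) {z : SpaceTime d} (hz : ‖z.2‖ ^ 2 ≤ R ^ 2 - R) :
    1 ≤ outerArg R z := by
  unfold outerArg
  rw [one_le_div hR, ← norm_sq_snd]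
  linarith

lemma one_le_innerArg (hR : 0 < R) {z : SpaceTime d}
    (hz : 4 * R ^ 2 ≤ ∑ k, shift R timeBump k z ^ 2) : 1 ≤ innerArg R z := by
  unfold innerArg
  rw [one_le_div (by positivity)]
  linarith

lemma cutoff_eq_one (hR : 0 < R) {z : SpaceTime d} (h1 : ‖z.2‖ ^ 2 ≤ R ^ 2 - R)
    (h2 : 4 * R ^ 2 ≤ ∑ k, shift R timeBump k z ^ 2) : cutoff R z = 1 := by
  unfold cutoff
  rw [Real.smoothTransition.one_of_one_le (one_le_outerArg hR h1),
    Real.smoothTransition.one_of_one_le (one_le_innerArg hR h2), one_mul]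

lemma cutoff_locally_const (hR : 1 < R) {z : SpaceTime d} (hz : z ∉ cutoffEdge d R) :
    ∃ c, cutoff R =ᶠ[nhds z] fun _ => c := by
  have hR0 : 0 < R := by linarith
  by_cases h : z ∈ cutoffRegion d R
  · have h2 : ¬ (R - 1 < ‖z.2‖ ∨ ∑ k, shift R timeBump k z ^ 2 ≤ 4 * R ^ 2) := fun h' => hz ⟨h, h'⟩
    rw [not_or, not_lt, not_le] at h2
    refine ⟨1, ?_⟩
    have o1 : {y : SpaceTime d | ‖y.2‖ ^ 2 < R ^ 2 - R} ∈ nhds z := by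
      refine (isOpen_lt (by fun_prop) continuous_const).mem_nhds ?_
      have : ‖z.2‖ ^ 2 ≤ (R - 1) ^ 2 := by gcongr; exact h2.1
      simp only [mem_ofPred_eq]
      nlinarith
    have o2 : {y : SpaceTime d | 4 * R ^ 2 < ∑ k, shift R timeBump k y ^ 2} ∈ nhds z :=
      (isOpen_lt continuous_const continuous_sum_shift_sq).mem_nhds h2.2
    filter_upwards [o1, o2] with y h3 h4
    exact cutoff_eq_one hR0 (le_of_lt h3) (le_of_lt h4)
  · refine ⟨0, ?_⟩
    filter_upwards [isClosed_cutoffRegion.isOpen_compl.mem_nhds h] with y hy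
    exact cutoff_eq_zero hR.le hy

lemma dirD_cutoff_eq_zero (hR : 1 < R) {z : SpaceTime d} (hz : z ∉ cutoffEdge d R)
    (w : SpaceTime d) : dirD w (cutoff R) z = 0 := by
  obtain ⟨c, hc⟩ := cutoff_locally_const hR hz
  exact dirD_eq_zero_of_eventuallyEq w hc

lemma dirD_dirD_cutoff_eq_zero (hR : 1 < R) {z : SpaceTime d} (hz : z ∉ cutoffEdge d R)
    (w w' : SpaceTime d) : dirD w (dirD w' (cutoff R)) z = 0 := by
  obtain ⟨c, hc⟩ := cutoff_locally_const hR hz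
  refine dirD_eq_zero_of_eventuallyEq (c := 0) w ?_
  filter_upwards [hc.eventuallyEq_nhds] with y hy
  exact dirD_eq_zero_of_eventuallyEq w' hy

section Bounds

variable {F : Type*} [NormedAddCommGroup F] [NormedSpace ℝ F]

lemma dirD_dirD_comp (v w : F) {f : F → ℝ} {s : ℝ → ℝ} (hs : ContDiff ℝ 2 s)
    (hf : ContDiff ℝ 2 f) (z : F) :
    dirD v (dirD w (fun y => s (f y))) z =
      deriv (deriv s) (f z) * dirD v f z * dirD w f z + deriv s (f z) * dirD v (dirD w f) z := by
  have ds : Differentiable ℝ s := hs.differentiable (by norm_num)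
  have df : Differentiable ℝ f := hf.differentiable (by norm_num)
  have ds' : Differentiable ℝ (deriv s) :=
    (ContDiff.deriv' (n := 1) (hs.of_le (by norm_num))).differentiable (by norm_num)
  have df' : Differentiable ℝ (dirD w f) :=
    (contDiff_dirD (m := 1) w hf (by norm_num)).differentiable (by norm_num)
  have e : dirD w (fun y => s (f y)) = fun y => deriv s (f y) * dirD w f y := by
    ext y; exact dirD_comp w ds df y
  rw [e, dirD_mul _ (by fun_prop) df', dirD_comp v ds' df]

lemma dirD_dirD_mul (v w : F) {f g : F → ℝ} (hf : ContDiff ℝ 2 f)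
    (hg : ContDiff ℝ 2 g) (z : F) :
    dirD v (dirD w (fun y => f y * g y)) z =
      dirD v (dirD w f) z * g z + dirD w f z * dirD v g z + dirD v f z * dirD w g z
        + f z * dirD v (dirD w g) z := by
  have df : Differentiable ℝ f := hf.differentiable (by norm_num)
  have dg : Differentiable ℝ g := hg.differentiable (by norm_num)
  have df' : Differentiable ℝ (dirD w f) :=
    (contDiff_dirD (m := 1) w hf (by norm_num)).differentiable (by norm_num)
  have dg' : Differentiable ℝ (dirD w g) :=
    (contDiff_dirD (m := 1) w hg (by norm_num)).differentiable (by norm_num)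
  have e : dirD w (fun y => f y * g y) = fun y => dirD w f y * g y + f y * dirD w g y := by
    ext y; exact dirD_mul w df dg y
  rw [e, dirD_add _ (by fun_prop) (by fun_prop), dirD_mul _ df' dg, dirD_mul _ df dg']
  ring

end Bounds

lemma dirD_outerArg (w : SpaceTime d) :
    dirD w (outerArg R) = fun z => (-2 / R) * ∑ k, w.2 k * z.2 k := by
  ext z
  have h1 : ∀ k, Differentiable ℝ (fun z : SpaceTime d => z.2 k) := fun k =>
    (contDiff_coord (m := 1) k).differentiable (by norm_num)
  have e : outerArg (d := d) R = fun z => (1 / R) * (R ^ 2 - ∑ k, z.2 k * z.2 k) := by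
    ext z; unfold outerArg; simp_rw [sq]; ring
  rw [e, dirD_const_mul _ _ (by fun_prop), dirD_sub _ (by fun_prop) (by fun_prop), dirD_const,
    dirD_sum _ _ (by fun_prop), zero_sub]
  simp_rw [dirD_mul _ (h1 _) (h1 _), dirD_coord]
  simp_rw [mul_comm (z.2 _), ← two_mul, ← Finset.mul_sum]
  ring

lemma dirD_innerArg (w : SpaceTime d) (z : SpaceTime d) :
    dirD w (innerArg R) z =
      (2 / (3 * R ^ 2)) * ∑ k, shift R timeBump k z * dirD w (shift R timeBump k) z := by
  have hφ : Differentiable ℝ timeBump := contDiff_timeBump.differentiable (by norm_num)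
  have h1 : Differentiable ℝ (weight (d := d) 1 R timeBump) :=
    (contDiff_weight contDiff_timeBump).differentiable (by norm_num)
  have e : innerArg (d := d) R = fun z => (1 / (3 * R ^ 2)) * (weight 1 R timeBump z - R ^ 2) := by
    ext z; unfold innerArg weight; ring
  rw [e, dirD_const_mul _ _ (by fun_prop), dirD_sub _ (by fun_prop) (by fun_prop), dirD_const,
    dirD_weight hφ]
  ring

/-- On its support region, the first and second spatial derivatives and the time derivative of the
cutoff are bounded independently of `R`. -/
lemma exists_bound_dirD_cutoff (d : ℕ) : ∃ C : ℝ, 0 < C ∧ ∀ R : ℝ, 1 < R → ∀ z : SpaceTime d,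
    z ∈ cutoffRegion d R → |dirD et (cutoff R) z| ≤ C ∧ (∀ k, |dirD (ex k) (cutoff R) z| ≤ C) ∧
      ∀ k l, |dirD (ex k) (dirD (ex l) (cutoff R)) z| ≤ C := by
  obtain ⟨s, hs1, hsd, hsdd⟩ := exists_bound_deriv_smoothTransition
  obtain ⟨c, hc, -⟩ := exists_bound_deriv_timeBump
  have hc0 : 0 ≤ c := (abs_nonneg _).trans (hc 0)
  set B : ℝ := s * (18 + 4 * c) with hB
  have hB0 : 0 < B := by positivity
  refine ⟨2 * B + 2 * B ^ 2, by positivity, fun R hR z hz => ?_⟩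
  have hR0 : 0 < R := by linarith
  have h0 : ContDiff ℝ 2 Real.smoothTransition := Real.smoothTransition.contDiff (n := 2)
  have d0 : Differentiable ℝ Real.smoothTransition := h0.differentiable (by norm_num)
  have dout : Differentiable ℝ (outerArg (d := d) R) :=
    contDiff_outerArg.differentiable (by norm_num)
  have dinn : Differentiable ℝ (innerArg (d := d) R) :=
    contDiff_innerArg.differentiable (by norm_num)
  have hφ : Differentiable ℝ timeBump := contDiff_timeBump.differentiable (by norm_num)
  have hx : ∀ k, |z.2 k| ≤ R := fun k => (PiLp.norm_apply_le z.2 k).trans hz.2.1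
  have hsh : ∀ k, |shift R timeBump k z| ≤ 5 * R := by
    intro k
    refine abs_le_of_sq_le_sq ?_ (by linarith)
    calc shift R timeBump k z ^ 2 ≤ ∑ k, shift R timeBump k z ^ 2 :=
          Finset.single_le_sum (f := fun k => shift R timeBump k z ^ 2)
            (fun _ _ => sq_nonneg _) (Finset.mem_univ _)
      _ ≤ 25 * R ^ 2 := sum_shift_sq_le hR0.le hz.2.1
      _ = (5 * R) ^ 2 := by ring
  -- The divisors `R` and `R²` compensate the factor `R` in `x + R φ e₁`, so the bounds are uniform.
  have o1 : ∀ k, |dirD (ex k) (outerArg R) z| ≤ 4 := by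
    intro k
    rw [dirD_outerArg]
    simp only [ex_snd, ite_mul, one_mul, zero_mul, Finset.sum_ite_eq', Finset.mem_univ, if_true]
    rw [abs_mul, abs_div, abs_of_pos hR0, div_mul_eq_mul_div, div_le_iff₀ hR0]
    have := hx k
    norm_num
    linarith
  have o2 : dirD et (outerArg R) z = 0 := by
    rw [dirD_outerArg]; simp [et]
  have o3 : ∀ k l, |dirD (ex k) (dirD (ex l) (outerArg R)) z| ≤ 2 := by
    intro k l
    have e : dirD (ex l) (outerArg (d := d) R) = fun z => (-2 / R) * z.2 l := by
      rw [dirD_outerArg]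
      ext z
      simp [ex_snd]
    rw [e, dirD_const_mul _ _ ((contDiff_coord (m := 1) l).differentiable (by norm_num)), dirD_coord,
      ex_snd, abs_mul, abs_div, abs_of_pos hR0]
    have : |(-2 : ℝ)| / R ≤ 2 := by rw [div_le_iff₀ hR0]; norm_num; linarith
    split_ifs <;> simp at this ⊢; exact this
  have i1 : ∀ k, |dirD (ex k) (innerArg R) z| ≤ 4 := by
    intro k
    rw [dirD_innerArg]
    simp only [dirD_ex_shift hφ, mul_ite, mul_one, mul_zero, Finset.sum_ite_eq', Finset.mem_univ,
      if_true]
    rw [abs_mul, abs_of_pos (by positivity), div_mul_eq_mul_div, div_le_iff₀ (by positivity)]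
    have := hsh k
    nlinarith
  have i2 : |dirD et (innerArg R) z| ≤ 4 * c := by
    rw [dirD_innerArg]
    simp only [dirD_et_shift hφ, mul_ite, mul_zero, Finset.sum_ite_eq', Finset.mem_univ,
      if_true]
    rw [abs_mul, abs_of_pos (by positivity), div_mul_eq_mul_div, div_le_iff₀ (by positivity), abs_mul,
      abs_mul, abs_of_pos hR0]
    calc 2 * (|shift R timeBump 0 z| * (R * |deriv timeBump z.1|))
        ≤ 2 * ((5 * R) * (R * c)) := by
          gcongr
          · exact hsh 0
          · exact hc _
      _ ≤ 4 * c * (3 * R ^ 2) := by nlinarith [mul_nonneg hc0 (sq_nonneg R)]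
  have i3 : ∀ k l, |dirD (ex k) (dirD (ex l) (innerArg R)) z| ≤ 2 := by
    intro k l
    have e : dirD (ex l) (innerArg (d := d) R) =
        fun z => (2 / (3 * R ^ 2)) * shift R timeBump l z := by
      ext z
      rw [dirD_innerArg]
      simp only [dirD_ex_shift hφ, mul_ite, mul_one, mul_zero, Finset.sum_ite_eq', Finset.mem_univ,
        if_true]
    rw [e, dirD_const_mul _ _ ((contDiff_shift contDiff_timeBump l).differentiable (by norm_num)),
      dirD_ex_shift hφ, abs_mul, abs_of_pos (by positivity : 0 < 2 / (3 * R ^ 2))]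
    have : 2 / (3 * R ^ 2) ≤ 2 := by
      rw [div_le_iff₀ (by positivity)]
      nlinarith
    split_ifs <;> simp; exact this
  have first : ∀ {f : SpaceTime d → ℝ} {w b}, Differentiable ℝ f → |dirD w f z| ≤ b →
      b ≤ 18 + 4 * c → |dirD w (fun y => Real.smoothTransition (f y)) z| ≤ B := by
    intro f w b hf hb hb'
    rw [dirD_comp w d0 hf, abs_mul]
    exact mul_le_mul (hsd _) (hb.trans hb') (abs_nonneg _) (by linarith)
  have second : ∀ {f : SpaceTime d → ℝ} {w w'}, ContDiff ℝ 2 f → |dirD w f z| ≤ 4 →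
      |dirD w' f z| ≤ 4 → |dirD w (dirD w' f) z| ≤ 2 →
      |dirD w (dirD w' (fun y => Real.smoothTransition (f y))) z| ≤ B := by
    intro f w w' hf h1 h2 h3
    rw [dirD_dirD_comp w w' h0 hf]
    refine (abs_add_le _ _).trans ?_
    rw [abs_mul, abs_mul, abs_mul]
    calc _ ≤ s * 4 * 4 + s * 2 := by
          gcongr
          · exact hsdd _
          · exact hsd _
      _ ≤ B := by rw [hB]; nlinarith
  have a1 : |Real.smoothTransition (outerArg R z)| ≤ 1 := by
    rw [abs_of_nonneg (Real.smoothTransition.nonneg _)]; exact Real.smoothTransition.le_one _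
  have a2 : |Real.smoothTransition (innerArg R z)| ≤ 1 := by
    rw [abs_of_nonneg (Real.smoothTransition.nonneg _)]; exact Real.smoothTransition.le_one _
  have c1 : ContDiff ℝ 2 (fun z : SpaceTime d => Real.smoothTransition (outerArg R z)) :=
    h0.comp contDiff_outerArg
  have c2 : ContDiff ℝ 2 (fun z : SpaceTime d => Real.smoothTransition (innerArg R z)) :=
    h0.comp contDiff_innerArg
  have prod1 : ∀ w, |dirD w (fun y => Real.smoothTransition (outerArg R y)) z| ≤ B →
      |dirD w (fun y => Real.smoothTransition (innerArg R y)) z| ≤ B →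
      |dirD w (cutoff R) z| ≤ 2 * B + 2 * B ^ 2 := by
    intro w h1 h2
    unfold cutoff
    rw [dirD_mul _ (c1.differentiable (by norm_num)) (c2.differentiable (by norm_num))]
    refine (abs_add_le _ _).trans ?_
    rw [abs_mul, abs_mul]
    calc _ ≤ B * 1 + 1 * B := by gcongr
      _ ≤ _ := by nlinarith
  have f1 : ∀ k, |dirD (ex k) (fun y => Real.smoothTransition (outerArg R y)) z| ≤ B :=
    fun k => first dout (o1 k) (by linarith)
  have f2 : ∀ k, |dirD (ex k) (fun y => Real.smoothTransition (innerArg R y)) z| ≤ B :=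
    fun k => first dinn (i1 k) (by linarith)
  refine ⟨prod1 _ (first dout (b := 0) (by rw [o2]; simp) (by linarith)) (first dinn i2 (by linarith)),
    fun k => prod1 _ (f1 k) (f2 k), fun k l => ?_⟩
  unfold cutoff
  rw [dirD_dirD_mul _ _ c1 c2]
  refine (abs_add_le _ _).trans ((add_le_add_left ((abs_add_le _ _).trans
    (add_le_add_left (abs_add_le _ _) _)) _).trans ?_)
  rw [abs_mul, abs_mul, abs_mul, abs_mul]
  calc _ ≤ B * 1 + B * B + B * B + 1 * B := by
        gcongr
        · exact second contDiff_outerArg (o1 k) (o1 l) (o3 k l)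
        · exact f1 l
        · exact f2 k
        · exact f1 k
        · exact f2 l
        · exact second contDiff_innerArg (i1 k) (i1 l) (i3 k l)
    _ = _ := by ring

end Cutoff

/-! ### The localized Carleman inequality -/

section Localized

variable {d : ℕ} {A : Fin (d + 1) → Fin (d + 1) → SpaceTime d → ℝ} {lam Lam ε K κ R : ℝ}

/-- The density `|w|² + |∇w|²` of a real function. -/
noncomputable def energyDensity (w : SpaceTime d → ℝ) (z : SpaceTime d) : ℝ :=
  w z ^ 2 + ∑ k, dirD (ex k) w z ^ 2

lemma energyDensity_nonneg (w : SpaceTime d → ℝ) (z : SpaceTime d) : 0 ≤ energyDensity w z :=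
  add_nonneg (sq_nonneg _) (Finset.sum_nonneg fun _ _ => sq_nonneg _)

lemma abs_divOp_le (hA : Admissible A lam Lam ε K) (hLam : 0 < Lam) (hK : 0 ≤ K)
    {χ : SpaceTime d → ℝ} (hχ : ContDiff ℝ 2 χ) {B : ℝ} {z : SpaceTime d}
    (h1 : ∀ k, |dirD (ex k) χ z| ≤ B) (h2 : ∀ k l, |dirD (ex k) (dirD (ex l) χ) z| ≤ B) :
    |divOp A ex χ z| ≤ (d + 1 : ℝ) ^ 2 * ((K + Lam) * B) := by
  have hN : ((Fintype.card (Fin (d + 1)) : ℕ) : ℝ) = (d : ℝ) + 1 := by simp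
  have h4 : ∀ i j, Differentiable ℝ (A i j) := fun i j =>
    (hA.contDiff i j).differentiable (by norm_num)
  have h5 : ∀ k, Differentiable ℝ (dirD (ex k) χ) := fun k =>
    (contDiff_dirD (m := 1) _ hχ (by norm_num)).differentiable (by norm_num)
  unfold divOp
  rw [sq, mul_assoc, ← hN]
  refine abs_sum_le_card_mul fun k => ?_
  unfold flux
  rw [dirD_sum _ _ (by fun_prop)]
  refine abs_sum_le_card_mul fun j => ?_
  rw [dirD_mul _ (h4 _ _) (h5 _), add_mul]
  refine (abs_add_le _ _).trans (add_le_add ?_ ?_)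
  · rw [abs_mul]
    exact mul_le_mul (hA.dirD_le _ _ _ _) (h1 _) (abs_nonneg _) hK
  · rw [abs_mul]
    exact mul_le_mul (hA.abs_le _ _ _) (h2 _ _) (abs_nonneg _) hLam.le

/-- The terms in which derivatives fall on the cutoff are controlled by the energy density. -/
lemma sq_commutator_le (hA : Admissible A lam Lam ε K) (hLam : 0 < Lam) (hK : 0 ≤ K)
    {χ w h : SpaceTime d → ℝ} (hχ : ContDiff ℝ 2 χ) {B : ℝ} {z : SpaceTime d}
    (h0 : |dirD et χ z| ≤ B)
    (h1 : ∀ k, |dirD (ex k) χ z| ≤ B) (h2 : ∀ k l, |dirD (ex k) (dirD (ex l) χ) z| ≤ B) :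
    (dirD et χ z * h z + 2 * ∑ k, dirD (ex k) χ z * flux A ex w k z + w z * divOp A ex χ z) ^ 2 ≤
      (3 * B ^ 2 * (1 + 4 * (d + 1 : ℝ) ^ 3 * Lam ^ 2 + (d + 1 : ℝ) ^ 4 * (K + Lam) ^ 2))
        * (h z ^ 2 + energyDensity w z) := by
  have hN : ((Fintype.card (Fin (d + 1)) : ℕ) : ℝ) = (d : ℝ) + 1 := by simp
  have hB : 0 ≤ B := (abs_nonneg _).trans h0
  have t3 := abs_divOp_le hA hLam hK hχ h1 h2
  set s := ∑ k, |dirD (ex k) w z| with hs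
  have hs0 : 0 ≤ s := Finset.sum_nonneg fun _ _ => abs_nonneg _
  have hs2 : s ^ 2 ≤ ((d : ℝ) + 1) * ∑ k, dirD (ex k) w z ^ 2 := by
    have := sq_sum_abs_le (fun k => dirD (ex k) w z)
    rwa [hN] at this
  set N : ℝ := (d : ℝ) + 1 with hNd
  have hN0 : 0 < N := by positivity
  have t2 : |∑ k, dirD (ex k) χ z * flux A ex w k z| ≤ N * (B * (Lam * s)) := by
    rw [← hN]
    refine abs_sum_le_card_mul fun k => ?_
    rw [abs_mul]
    exact mul_le_mul (h1 k) (abs_sum_mul_le fun j => hA.abs_le _ _ _) (abs_nonneg _) hB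
  set a := dirD et χ z * h z
  set b := ∑ k, dirD (ex k) χ z * flux A ex w k z
  set c := w z * divOp A ex χ z
  have q1 : a ^ 2 ≤ B ^ 2 * h z ^ 2 := by
    rw [mul_pow, ← sq_abs (dirD et χ z)]
    gcongr
  have q2 : b ^ 2 ≤ (N * (B * (Lam * s))) ^ 2 := by
    rw [← sq_abs b]
    gcongr
  have q3 : c ^ 2 ≤ w z ^ 2 * (N ^ 2 * ((K + Lam) * B)) ^ 2 := by
    rw [mul_pow, ← sq_abs (divOp A ex χ z)]
    gcongr
  have q4 : (a + 2 * b + c) ^ 2 ≤ 3 * (a ^ 2 + 4 * b ^ 2 + c ^ 2) := by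
    nlinarith [sq_nonneg (a - 2 * b), sq_nonneg (a - c), sq_nonneg (2 * b - c)]
  have q5 : (N * (B * (Lam * s))) ^ 2 ≤ N ^ 3 * Lam ^ 2 * B ^ 2 * ∑ k, dirD (ex k) w z ^ 2 := by
    calc (N * (B * (Lam * s))) ^ 2 = N ^ 2 * Lam ^ 2 * B ^ 2 * s ^ 2 := by ring
      _ ≤ N ^ 2 * Lam ^ 2 * B ^ 2 * (N * ∑ k, dirD (ex k) w z ^ 2) := by gcongr
      _ = _ := by ring
  set G := ∑ k, dirD (ex k) w z ^ 2 with hG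
  have hG0 : 0 ≤ G := Finset.sum_nonneg fun _ _ => sq_nonneg _
  set C := 1 + 4 * N ^ 3 * Lam ^ 2 + N ^ 4 * (K + Lam) ^ 2 with hC
  have e1 : B ^ 2 * h z ^ 2 ≤ B ^ 2 * C * h z ^ 2 := by
    have : 1 ≤ C := by
      have : 0 ≤ 4 * N ^ 3 * Lam ^ 2 := by positivity
      have : 0 ≤ N ^ 4 * (K + Lam) ^ 2 := by positivity
      linarith
    have : 0 ≤ B ^ 2 * h z ^ 2 := by positivity
    nlinarith
  have e2 : 4 * (N ^ 3 * Lam ^ 2 * B ^ 2 * G) ≤ B ^ 2 * C * G := by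
    have : 4 * N ^ 3 * Lam ^ 2 ≤ C := by
      have : 0 ≤ N ^ 4 * (K + Lam) ^ 2 := by positivity
      linarith
    have := mul_le_mul_of_nonneg_right this (by positivity : 0 ≤ B ^ 2 * G)
    linarith
  have e3 : w z ^ 2 * (N ^ 2 * ((K + Lam) * B)) ^ 2 ≤ B ^ 2 * C * w z ^ 2 := by
    have : N ^ 4 * (K + Lam) ^ 2 ≤ C := by
      have : 0 ≤ 4 * N ^ 3 * Lam ^ 2 := by positivity
      linarith
    have := mul_le_mul_of_nonneg_right this (by positivity : 0 ≤ B ^ 2 * w z ^ 2)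
    linarith
  unfold energyDensity
  rw [← hG]
  linarith

/-- The Carleman inequality localized by the cutoff. The constant depends on the bounds of the
coefficients only. -/
lemma exists_localized_carleman (d : ℕ) {lam Lam ε K κ c : ℝ}
    (hP : GoodParams d lam Lam ε K κ c timeBump) : ∃ C : ℝ, 0 < C ∧
    ∀ A : Fin (d + 1) → Fin (d + 1) → SpaceTime d → ℝ, Admissible A lam Lam ε K →
    ∀ R : ℝ, 1 < R → ∀ w₁ w₂ : SpaceTime d → ℝ, ContDiff ℝ 2 w₁ → ContDiff ℝ 2 w₂ →
    ∫⁻ z, ENNReal.ofReal (κ ^ 3 * lam ^ 2 * R ^ 2 *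
      (Real.exp (weight κ R timeBump z) ^ 2 * (cutoff R z ^ 2 * (w₁ z ^ 2 + w₂ z ^ 2)))) ≤
    ∫⁻ z, ENNReal.ofReal (Real.exp (weight κ R timeBump z) ^ 2 *
      (2 * (cutoff R z ^ 2 *
        ((-dirD et w₂ z + divOp A ex w₁ z) ^ 2 + (dirD et w₁ z + divOp A ex w₂ z) ^ 2))
      + (cutoffEdge d R).indicator (fun z => C * (energyDensity w₁ z + energyDensity w₂ z)) z)) := by
  obtain ⟨B, hB, hχ⟩ := exists_bound_dirD_cutoff d
  have hLam := hP.Lam_pos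
  have hK := hP.K_nonneg
  set D := 3 * B ^ 2 * (1 + 4 * (d + 1 : ℝ) ^ 3 * Lam ^ 2 + (d + 1 : ℝ) ^ 4 * (K + Lam) ^ 2) with hD
  have hD0 : 0 < D := by positivity
  refine ⟨4 * D, by positivity, fun A hA R hR w₁ w₂ h₁ h₂ => ?_⟩
  have hc : ContDiff ℝ 2 (cutoff (d := d) R) := contDiff_cutoff
  have dc : Differentiable ℝ (cutoff (d := d) R) := hc.differentiable (by norm_num)
  have d₁ : Differentiable ℝ w₁ := h₁.differentiable (by norm_num)
  have d₂ : Differentiable ℝ w₂ := h₂.differentiable (by norm_num)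
  have supp : ∀ w : SpaceTime d → ℝ, tsupport (fun z => cutoff R z * w z) ⊆ cutoffRegion d R := by
    intro w
    refine closure_minimal (fun z hz => ?_) isClosed_cutoffRegion
    by_contra h
    exact hz (by simp [cutoff_eq_zero hR.le h])
  have main := carleman_inequality hP hA hR.le (hc.mul h₁) (hc.mul h₂) isCompact_cutoffRegion
    (fun z hz => hz.2) (supp w₁) (supp w₂)
  have e1 : ∀ z, (cutoff R z * w₁ z) ^ 2 + (cutoff R z * w₂ z) ^ 2 =
      cutoff R z ^ 2 * (w₁ z ^ 2 + w₂ z ^ 2) := fun z => by ring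
  simp_rw [e1] at main
  refine main.trans (lintegral_mono fun z => ENNReal.ofReal_le_ofReal ?_)
  refine mul_le_mul_of_nonneg_left ?_ (by positivity)
  rw [dirD_mul _ dc d₁, dirD_mul _ dc d₂, divOp_mul hA.symm hA.contDiff hc h₁,
    divOp_mul hA.symm hA.contDiff hc h₂]
  set F₁ := -dirD et w₂ z + divOp A ex w₁ z with hF₁
  set F₂ := dirD et w₁ z + divOp A ex w₂ z with hF₂
  set X := cutoff R z with hX
  set r₁ := dirD et (cutoff R) z * (-w₂ z)
    + 2 * ∑ k, dirD (ex k) (cutoff R) z * flux A ex w₁ k z + w₁ z * divOp A ex (cutoff R) z with hr₁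
  set r₂ := dirD et (cutoff R) z * w₁ z
    + 2 * ∑ k, dirD (ex k) (cutoff R) z * flux A ex w₂ k z + w₂ z * divOp A ex (cutoff R) z with hr₂
  have g1 : -(dirD et (cutoff R) z * w₂ z + X * dirD et w₂ z) +
      (X * divOp A ex w₁ z + 2 * ∑ k, dirD (ex k) (cutoff R) z * flux A ex w₁ k z
        + w₁ z * divOp A ex (cutoff R) z) = X * F₁ + r₁ := by
    rw [hr₁, hF₁]; ring
  have g2 : (dirD et (cutoff R) z * w₁ z + X * dirD et w₁ z) +
      (X * divOp A ex w₂ z + 2 * ∑ k, dirD (ex k) (cutoff R) z * flux A ex w₂ k z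
        + w₂ z * divOp A ex (cutoff R) z) = X * F₂ + r₂ := by
    rw [hr₂, hF₂]; ring
  rw [g1, g2]
  have hr : 2 * (r₁ ^ 2 + r₂ ^ 2) ≤
      (cutoffEdge d R).indicator (fun z => 4 * D * (energyDensity w₁ z + energyDensity w₂ z)) z := by
    by_cases hz : z ∈ cutoffEdge d R
    · rw [indicator_of_mem hz]
      obtain ⟨b0, b1, b2⟩ := hχ R hR z hz.1
      have k1 := sq_commutator_le hA hLam hK (w := w₁) (h := fun z => -w₂ z) hc b0 b1 b2
      have k2 := sq_commutator_le hA hLam hK (w := w₂) (h := w₁) hc b0 b1 b2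
      have k3 : w₁ z ^ 2 ≤ energyDensity w₁ z :=
        le_add_of_nonneg_right (Finset.sum_nonneg fun _ _ => sq_nonneg _)
      have k4 : w₂ z ^ 2 ≤ energyDensity w₂ z :=
        le_add_of_nonneg_right (Finset.sum_nonneg fun _ _ => sq_nonneg _)
      rw [← hD, ← hr₁, neg_sq] at k1
      rw [← hD, ← hr₂] at k2
      have k5 := mul_le_mul_of_nonneg_left k3 hD0.le
      have k6 := mul_le_mul_of_nonneg_left k4 hD0.le
      linarith
    · rw [indicator_of_notMem hz]
      have z1 : ∀ w, dirD w (cutoff R) z = 0 := dirD_cutoff_eq_zero hR hz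
      have z2 : divOp A ex (cutoff R) z = 0 := by
        have := abs_divOp_le hA hLam hK hc (B := 0) (fun k => by rw [z1]; simp)
          (fun k l => by rw [dirD_dirD_cutoff_eq_zero hR hz]; simp)
        simpa using this
      simp [hr₁, hr₂, z1, z2]
  have s1 := sq_nonneg (X * F₁ - r₁)
  have s2 := sq_nonneg (X * F₂ - r₂)
  nlinarith

end Localized

/-! ### Mollifiers -/

section Mollification

open Filter Topology

variable {F : Type*} [NormedAddCommGroup F] [NormedSpace ℝ F] [FiniteDimensional ℝ F]
  [MeasurableSpace F] [BorelSpace F] {μ : Measure F} [μ.IsAddHaarMeasure]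

lemma eLpNorm_two_sq {α E : Type*} [MeasurableSpace α] [NormedAddCommGroup E] (ν : Measure α)
    (f : α → E) : eLpNorm f 2 ν ^ 2 = ∫⁻ x, ‖f x‖ₑ ^ 2 ∂ν := by
  have := eLpNorm_nnreal_pow_eq_lintegral (f := f) (μ := ν) (p := 2) (by norm_num)
  simpa using this

/-- Translations are continuous in `L²`. -/
lemma tendsto_lintegral_translate_sub {h : F → ℝ} (hh : MemLp h 2 μ) :
    Tendsto (fun ζ => ∫⁻ z, ‖h (z - ζ) - h z‖ₑ ^ 2 ∂μ) (𝓝 0) (𝓝 0) := by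
  let g : F → C(F, F) := fun ζ => ⟨fun z => z - ζ, by fun_prop⟩
  have hg : Continuous g := ContinuousMap.continuous_of_continuous_uncurry _ (by
    change Continuous fun p : F × F => p.2 - p.1
    fun_prop)
  have hmp : ∀ ζ, MeasurePreserving (g ζ) μ μ := fun ζ => measurePreserving_sub_right μ ζ
  have : Fact ((1 : ℝ≥0∞) ≤ 2) := ⟨by norm_num⟩
  have h1 := Filter.Tendsto.compMeasurePreservingLp (f := fun _ => hh.toLp h) (f₀ := hh.toLp h)
    tendsto_const_nhds (hg.tendsto 0) hmp (hmp 0) (by norm_num)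
  simp_rw [Lp.toLp_compMeasurePreserving hh] at h1
  rw [Lp.tendsto_Lp_iff_tendsto_eLpNorm''] at h1
  have e : ∀ ζ, ∫⁻ z, ‖h (z - ζ) - h z‖ₑ ^ 2 ∂μ = eLpNorm (h ∘ g ζ - h ∘ g 0) 2 μ ^ 2 := by
    intro ζ
    rw [eLpNorm_two_sq]
    simp [g]
  simp_rw [e]
  have := ENNReal.Tendsto.pow (n := 2) h1
  simpa using this

lemma sq_lintegral_mul_le {α : Type*} [MeasurableSpace α] {ν : Measure α} {m f : α → ℝ≥0∞}
    (hm : AEMeasurable m ν) (hf : AEMeasurable f ν) :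
    (∫⁻ x, m x * f x ∂ν) ^ 2 ≤ (∫⁻ x, m x ∂ν) * ∫⁻ x, m x * f x ^ 2 ∂ν := by
  have e : ∀ x, m x * f x = (m x ^ (1 / 2 : ℝ)) * (m x ^ (1 / 2 : ℝ) * f x) := by
    intro x
    rw [← mul_assoc, ← ENNReal.rpow_add_of_nonneg _ _ (by norm_num) (by norm_num)]
    norm_num
  have h := ENNReal.lintegral_mul_le_Lp_mul_Lq ν (p := 2) (q := 2)
    (by norm_num [Real.holderConjugate_iff])
    (f := fun x => m x ^ (1 / 2 : ℝ)) (g := fun x => m x ^ (1 / 2 : ℝ) * f x)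
    (hm.pow_const _) ((hm.pow_const _).mul hf)
  simp only [Pi.mul_apply] at h
  simp_rw [← e] at h
  have e1 : ∀ x, (m x ^ (1 / 2 : ℝ)) ^ (2 : ℝ) = m x := by
    intro x; rw [← ENNReal.rpow_mul]; norm_num
  have e2 : ∀ x, (m x ^ (1 / 2 : ℝ) * f x) ^ (2 : ℝ) = m x * f x ^ 2 := by
    intro x
    rw [ENNReal.mul_rpow_of_nonneg _ _ (by norm_num), e1]
    norm_num
  simp_rw [e1, e2] at h
  calc (∫⁻ x, m x * f x ∂ν) ^ 2 ≤ ((∫⁻ x, m x ∂ν) ^ (1 / 2 : ℝ)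
      * (∫⁻ x, m x * f x ^ 2 ∂ν) ^ (1 / 2 : ℝ)) ^ 2 := by gcongr
    _ = _ := by
      rw [mul_pow, ← ENNReal.rpow_natCast, ← ENNReal.rpow_natCast, ← ENNReal.rpow_mul,
        ← ENNReal.rpow_mul]
      norm_num

/-- An averaging operator with kernel dominated by `m` deviates from the identity in `L²` no more
than translations by vectors in the support of `m`. -/
lemma lintegral_sq_average_le {h : F → ℝ} (hh : Measurable h) {k : F → F → ℝ} {m : F → ℝ≥0∞}
    (hm : Measurable m) (hk : ∀ z ζ, ‖k z ζ‖ₑ ≤ m ζ) {δ : ℝ≥0∞}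
    (hδ : ∀ ζ, m ζ ≠ 0 → ∫⁻ z, ‖h (z - ζ) - h z‖ₑ ^ 2 ∂μ ≤ δ) :
    ∫⁻ z, ‖∫ ζ, k z ζ * (h (z - ζ) - h z) ∂μ‖ₑ ^ 2 ∂μ ≤ (∫⁻ ζ, m ζ ∂μ) ^ 2 * δ := by
  have meas : Measurable fun p : F × F => ‖h (p.1 - p.2) - h p.1‖ₑ := by fun_prop
  calc ∫⁻ z, ‖∫ ζ, k z ζ * (h (z - ζ) - h z) ∂μ‖ₑ ^ 2 ∂μ
      ≤ ∫⁻ z, (∫⁻ ζ, m ζ ∂μ) * ∫⁻ ζ, m ζ * ‖h (z - ζ) - h z‖ₑ ^ 2 ∂μ ∂μ := by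
        refine lintegral_mono fun z => ?_
        calc ‖∫ ζ, k z ζ * (h (z - ζ) - h z) ∂μ‖ₑ ^ 2
            ≤ (∫⁻ ζ, ‖k z ζ * (h (z - ζ) - h z)‖ₑ ∂μ) ^ 2 := by
              gcongr; exact enorm_integral_le_lintegral_enorm _
          _ ≤ (∫⁻ ζ, m ζ * ‖h (z - ζ) - h z‖ₑ ∂μ) ^ 2 := by
              gcongr with ζ
              rw [enorm_mul]
              gcongr
              exact hk z ζ
          _ ≤ _ := sq_lintegral_mul_le hm.aemeasurable (by fun_prop)
    _ = (∫⁻ ζ, m ζ ∂μ) * ∫⁻ z, ∫⁻ ζ, m ζ * ‖h (z - ζ) - h z‖ₑ ^ 2 ∂μ ∂μ := by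
        rw [lintegral_const_mul _ (Measurable.lintegral_prod_right (by fun_prop))]
    _ = (∫⁻ ζ, m ζ ∂μ) * ∫⁻ ζ, m ζ * ∫⁻ z, ‖h (z - ζ) - h z‖ₑ ^ 2 ∂μ ∂μ := by
        rw [lintegral_lintegral_swap (by fun_prop)]
        congr 2
        ext ζ
        rw [lintegral_const_mul _ (by fun_prop)]
    _ ≤ (∫⁻ ζ, m ζ ∂μ) * ∫⁻ ζ, m ζ * δ ∂μ := by
        refine mul_le_mul' le_rfl (lintegral_mono fun ζ => ?_)
        by_cases h0 : m ζ = 0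
        · simp [h0]
        · exact mul_le_mul' le_rfl (hδ ζ h0)
    _ = _ := by rw [lintegral_mul_const _ hm]; ring

/-- The convolution `∫ h(t) ρ(z - t) dt` with a mollifier `ρ`. -/
noncomputable def moll (μ : Measure F) (ρ h : F → ℝ) (z : F) : ℝ := ∫ t, h t * ρ (z - t) ∂μ

lemma moll_eq_integral_sub (ρ h : F → ℝ) (z : F) :
    moll μ ρ h z = ∫ ζ, h (z - ζ) * ρ ζ ∂μ := by
  unfold moll
  rw [← integral_sub_left_eq_self _ μ z]
  simp

variable {ρ h : F → ℝ}

lemma contDiff_moll (hc : HasCompactSupport ρ) (hρ : ContDiff ℝ (⊤ : ℕ∞) ρ)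
    (hh : LocallyIntegrable h μ) : ContDiff ℝ (⊤ : ℕ∞) (moll μ ρ h) :=
  hc.contDiff_convolution_right (ContinuousLinearMap.mul ℝ ℝ) hh hρ

lemma dirD_moll (hc : HasCompactSupport ρ) (hρ : ContDiff ℝ 1 ρ)
    (hh : LocallyIntegrable h μ) (v : F) : dirD v (moll μ ρ h) = moll μ (dirD v ρ) h := by
  ext z
  have h1 := hc.hasFDerivAt_convolution_right (ContinuousLinearMap.mul ℝ ℝ) hh hρ z
  have h2 : fderiv ℝ (moll μ ρ h) z = _ := h1.fderiv
  unfold dirD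
  rw [h2, convolution_precompR_apply (ContinuousLinearMap.mul ℝ ℝ) hh (hc.fderiv ℝ)
    (hρ.continuous_fderiv one_ne_zero)]
  rfl

lemma integrable_mul_comp_sub (hc : HasCompactSupport ρ) (hρ : Continuous ρ)
    (hh : LocallyIntegrable h μ) (z : F) : Integrable (fun t => h t * ρ (z - t)) μ := by
  exact (hc.convolutionExists_right (ContinuousLinearMap.mul ℝ ℝ) hh hρ) z

lemma integrable_comp_sub_mul (hc : HasCompactSupport ρ) (hρ : Continuous ρ)
    (hh : LocallyIntegrable h μ) (z : F) : Integrable (fun ζ => h (z - ζ) * ρ ζ) μ := by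
  have := (integrable_mul_comp_sub hc hρ hh z).comp_sub_left z
  simpa using this

/-- A family of mollifiers indexed by a radius `r > 0`. The functions `r ∂ᵥ ρ_r` are bounded in `L¹`
uniformly in `r`, which is what Friedrichs' lemma needs. -/
structure IsMollifier (μ : Measure F) (ρ : ℝ → F → ℝ) : Prop where
  contDiff : ∀ r, 0 < r → ContDiff ℝ (⊤ : ℕ∞) (ρ r)
  nonneg : ∀ r, 0 < r → ∀ z, 0 ≤ ρ r z
  support : ∀ r, 0 < r → ∀ z, r < ‖z‖ → ρ r z = 0
  integral_eq : ∀ r, 0 < r → ∫ z, ρ r z ∂μ = 1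
  deriv_le : ∀ v : F, ∃ C : ℝ, 0 ≤ C ∧ ∀ r, 0 < r → ∫ z, r * |dirD v (ρ r) z| ∂μ ≤ C

lemma dirD_comp_smul (v : F) {f : F → ℝ} (hf : Differentiable ℝ f) (c : ℝ) (z : F) :
    dirD v (fun y => f (c • y)) z = c * dirD v f (c • z) := by
  have h1 : HasFDerivAt (fun y : F => c • y) (c • ContinuousLinearMap.id ℝ F) z :=
    (hasFDerivAt_id z).const_smul c
  have h2 := ((hf (c • z)).hasFDerivAt.comp z h1).fderiv
  have h3 : fderiv ℝ (fun y => f (c • y)) z = _ := h2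
  unfold dirD
  rw [h3]
  simp

lemma exists_isMollifier (μ : Measure F) [μ.IsAddHaarMeasure] : ∃ ρ, IsMollifier μ ρ := by
  let b : ContDiffBump (0 : F) := ⟨1 / 2, 1, by norm_num, by norm_num⟩
  let f : F → ℝ := b.normed μ
  let n : ℕ := Module.finrank ℝ F
  have hf : ContDiff ℝ (⊤ : ℕ∞) f := b.contDiff_normed
  have hf1 : ContDiff ℝ 1 f := hf.of_le (by exact_mod_cast le_top)
  have df : Differentiable ℝ f := hf1.differentiable (by norm_num)
  have hfc : HasCompactSupport f := b.hasCompactSupport_normed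
  refine ⟨fun r z => (r ^ n)⁻¹ * f (r⁻¹ • z), ⟨fun r hr => ?_, fun r hr z => ?_, fun r hr z hz => ?_,
    fun r hr => ?_, fun v => ?_⟩⟩
  · exact contDiff_const.mul (hf.comp (contDiff_const_smul _))
  · exact mul_nonneg (by positivity) (b.nonneg_normed _)
  · have : f (r⁻¹ • z) = 0 := by
      have h1 : r⁻¹ • z ∉ Function.support f := by
        simp only [f, b.support_normed_eq, Metric.mem_ball, dist_zero_right, norm_smul, norm_inv,
          Real.norm_eq_abs, abs_of_pos hr, not_lt]
        change 1 ≤ _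
        rw [inv_mul_eq_div, one_le_div hr]
        exact hz.le
      simpa using h1
    simp [this]
  · rw [integral_const_mul, Measure.integral_comp_inv_smul_of_nonneg μ f hr.le, b.integral_normed]
    simp only [smul_eq_mul, mul_one]
    exact inv_mul_cancel₀ (by positivity)
  · refine ⟨∫ z, |dirD v f z| ∂μ, integral_nonneg fun _ => abs_nonneg _, fun r hr => ?_⟩
    have e : ∀ z, r * |dirD v (fun z => (r ^ n)⁻¹ * f (r⁻¹ • z)) z| =
        (r ^ n)⁻¹ * |dirD v f (r⁻¹ • z)| := by
      intro z
      rw [dirD_const_mul _ _ (by fun_prop), dirD_comp_smul v df, abs_mul, abs_mul,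
        abs_of_pos (by positivity), abs_of_pos (inv_pos.2 hr)]
      field_simp
    simp_rw [e]
    rw [integral_const_mul,
      Measure.integral_comp_inv_smul_of_nonneg μ (fun z => |dirD v f z|) hr.le, smul_eq_mul,
      ← mul_assoc, inv_mul_cancel₀ (by positivity), one_mul]

end Mollification

/-! ### Convergence of mollifications and Friedrichs' lemma -/

section Friedrichs

open Filter Topology

lemma enorm_sq_eq (x : ℝ) : ‖x‖ₑ ^ 2 = ENNReal.ofReal (x ^ 2) := by
  rw [Real.enorm_eq_ofReal_abs, ← ENNReal.ofReal_pow (abs_nonneg _), sq_abs]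

lemma enorm_add_sq_le (x y : ℝ) : ‖x + y‖ₑ ^ 2 ≤ 2 * ‖x‖ₑ ^ 2 + 2 * ‖y‖ₑ ^ 2 := by
  rw [enorm_sq_eq, enorm_sq_eq, enorm_sq_eq,
    show (2 : ℝ≥0∞) = ENNReal.ofReal 2 by simp, ← ENNReal.ofReal_mul (by norm_num),
    ← ENNReal.ofReal_mul (by norm_num), ← ENNReal.ofReal_add (by positivity) (by positivity)]
  exact ENNReal.ofReal_le_ofReal (by nlinarith [sq_nonneg (x - y)])

lemma enorm_sum_sq_le {ι : Type*} (s : Finset ι) (f : ι → ℝ) :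
    ‖∑ i ∈ s, f i‖ₑ ^ 2 ≤ s.card * ∑ i ∈ s, ‖f i‖ₑ ^ 2 := by
  simp_rw [enorm_sq_eq]
  rw [← ENNReal.ofReal_sum_of_nonneg (fun _ _ => sq_nonneg _), ← ENNReal.ofReal_natCast,
    ← ENNReal.ofReal_mul (by positivity)]
  exact ENNReal.ofReal_le_ofReal sq_sum_le_card_mul_sum_sq

variable {F : Type*} [NormedAddCommGroup F] [NormedSpace ℝ F] [FiniteDimensional ℝ F]
  [MeasurableSpace F] [BorelSpace F] {μ : Measure F} [μ.IsAddHaarMeasure]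
  {ρ : ℝ → F → ℝ} {h a : F → ℝ}

/-- Averages of `h (z - ζ) - h z` against kernels bounded in `L¹` and concentrating at `ζ = 0` tend to
zero in `L²`. -/
lemma tendsto_average_sub {k : ℝ → F → F → ℝ} {m : ℝ → F → ℝ≥0∞} {M : ℝ≥0∞} (hM : M ≠ ∞)
    (hh : Measurable h) (hL : MemLp h 2 μ)
    (hm : ∀ r, 0 < r → Measurable (m r)) (hk : ∀ r, 0 < r → ∀ z ζ, ‖k r z ζ‖ₑ ≤ m r ζ)
    (hs : ∀ r, 0 < r → ∀ ζ, r < ‖ζ‖ → m r ζ = 0) (hi : ∀ r, 0 < r → ∫⁻ ζ, m r ζ ∂μ ≤ M) :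
    Tendsto (fun r => ∫⁻ z, ‖∫ ζ, k r z ζ * (h (z - ζ) - h z) ∂μ‖ₑ ^ 2 ∂μ) (𝓝[>] 0) (𝓝 0) := by
  rw [ENNReal.tendsto_nhds_zero]
  intro ε hε
  have hδ : 0 < ε / M ^ 2 := ENNReal.div_pos hε.ne' (ENNReal.pow_ne_top hM)
  have h1 := (ENNReal.tendsto_nhds_zero.1 (tendsto_lintegral_translate_sub hL)) _ hδ
  obtain ⟨s, hs0, hs1⟩ := Metric.eventually_nhds_iff.1 h1
  filter_upwards [Ioo_mem_nhdsGT hs0] with r hr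
  refine (lintegral_sq_average_le hh (hm r hr.1) (hk r hr.1) (δ := ε / M ^ 2)
    fun ζ hζ => hs1 ?_).trans ?_
  · rw [dist_zero_right]
    refine lt_of_le_of_lt ?_ hr.2
    by_contra hlt
    exact hζ (hs r hr.1 ζ (not_le.1 hlt))
  · calc (∫⁻ ζ, m r ζ ∂μ) ^ 2 * (ε / M ^ 2) ≤ M ^ 2 * (ε / M ^ 2) := by
          gcongr; exact hi r hr.1
      _ ≤ ε := ENNReal.mul_div_le

lemma IsMollifier.hasCompactSupport (hρ : IsMollifier μ ρ) {r : ℝ} (hr : 0 < r) :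
    HasCompactSupport (ρ r) :=
  HasCompactSupport.intro (isCompact_closedBall (0 : F) r) fun z hz =>
    hρ.support r hr z (by simpa using hz)

lemma IsMollifier.contDiff_one (hρ : IsMollifier μ ρ) {r : ℝ} (hr : 0 < r) :
    ContDiff ℝ 1 (ρ r) := (hρ.contDiff r hr).of_le (by exact_mod_cast le_top)

lemma IsMollifier.integrable (hρ : IsMollifier μ ρ) {r : ℝ} (hr : 0 < r) :
    Integrable (ρ r) μ :=
  (hρ.contDiff_one hr).continuous.integrable_of_hasCompactSupport (hρ.hasCompactSupport hr)

lemma IsMollifier.continuous_dirD (hρ : IsMollifier μ ρ) {r : ℝ} (hr : 0 < r) (v : F) :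
    Continuous (dirD v (ρ r)) :=
  (contDiff_dirD (m := 0) v (hρ.contDiff_one hr) (by norm_num)).continuous

lemma IsMollifier.integrable_dirD (hρ : IsMollifier μ ρ) {r : ℝ} (hr : 0 < r) (v : F) :
    Integrable (dirD v (ρ r)) μ :=
  (hρ.continuous_dirD hr v).integrable_of_hasCompactSupport
    (hasCompactSupport_dirD v (hρ.hasCompactSupport hr))

lemma IsMollifier.dirD_eq_zero (hρ : IsMollifier μ ρ) {r : ℝ} (hr : 0 < r) (v : F) {z : F}
    (hz : r < ‖z‖) : dirD v (ρ r) z = 0 := by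
  refine dirD_eq_zero_of_eventuallyEq (c := 0) v ?_
  filter_upwards [(isOpen_lt continuous_const continuous_norm).mem_nhds hz] with y hy
  exact hρ.support r hr y hy

lemma locallyIntegrable_of_memLp_two (hL : MemLp h 2 μ) : LocallyIntegrable h μ :=
  hL.locallyIntegrable (by norm_num)

/-- Mollifications converge in `L²`. -/
lemma tendsto_moll_sub (hρ : IsMollifier μ ρ) (hh : Measurable h) (hL : MemLp h 2 μ) :
    Tendsto (fun r => ∫⁻ z, ‖moll μ (ρ r) h z - h z‖ₑ ^ 2 ∂μ) (𝓝[>] 0) (𝓝 0) := by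
  have key := tendsto_average_sub (μ := μ) (k := fun r _ ζ => ρ r ζ)
    (m := fun r ζ => ENNReal.ofReal (ρ r ζ)) (M := 1) (by simp) hh hL
    (fun r hr => ((hρ.contDiff r hr).continuous.measurable).ennreal_ofReal)
    (fun r hr z ζ => by rw [Real.enorm_of_nonneg (hρ.nonneg r hr ζ)])
    (fun r hr ζ hζ => by rw [hρ.support r hr ζ hζ]; simp)
    (fun r hr => by
      rw [← ofReal_integral_eq_lintegral_ofReal (hρ.integrable hr)
        (Eventually.of_forall (hρ.nonneg r hr)), hρ.integral_eq r hr]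
      simp)
  refine key.congr' ?_
  filter_upwards [self_mem_nhdsWithin] with r hr
  have hr : 0 < r := hr
  refine lintegral_congr fun z => ?_
  congr 2
  have i1 := integrable_comp_sub_mul (hρ.hasCompactSupport hr) (hρ.contDiff r hr).continuous
    (locallyIntegrable_of_memLp_two hL) z
  rw [moll_eq_integral_sub]
  calc ∫ ζ, ρ r ζ * (h (z - ζ) - h z) ∂μ = ∫ ζ, (h (z - ζ) * ρ r ζ - h z * ρ r ζ) ∂μ := by
        congr 1; ext ζ; ring
    _ = _ := by
        rw [integral_sub i1 ((hρ.integrable hr).const_mul _), integral_const_mul,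
          hρ.integral_eq r hr, mul_one]

/-- Friedrichs' lemma: the commutator of mollification with a first order operator `∂ᵥ (a ·)` tends
to zero in `L²`. -/
lemma tendsto_friedrichs (hρ : IsMollifier μ ρ) (hh : Measurable h) (hL : MemLp h 2 μ) (v : F)
    {L : ℝ} (ha : ContDiff ℝ 2 a) (ha0 : ∀ z, |a z| ≤ L) (ha1 : ∀ z, |dirD v a z| ≤ L)
    (ha2 : ∀ z y, |a z - a y| ≤ L * ‖z - y‖)
    (ha3 : ∀ z y, |dirD v a z - dirD v a y| ≤ L * ‖z - y‖) :
    Tendsto (fun r => ∫⁻ z, ‖dirD v (fun y => a y * moll μ (ρ r) h y) z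
      - dirD v (moll μ (ρ r) (fun t => a t * h t)) z‖ₑ ^ 2 ∂μ) (𝓝[>] 0) (𝓝 0) := by
  have hL0 : 0 ≤ L := (abs_nonneg _).trans (ha0 0)
  obtain ⟨C, hC, hCρ⟩ := hρ.deriv_le v
  have hloc := locallyIntegrable_of_memLp_two hL
  have hLa : MemLp (fun t => a t * h t) 2 μ :=
    MemLp.of_le_mul hL ((ha.continuous.measurable.mul hh).aestronglyMeasurable)
      (Eventually.of_forall fun z => by
        rw [norm_mul]; exact mul_le_mul_of_nonneg_right (ha0 z) (norm_nonneg _))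
  have hloca := locallyIntegrable_of_memLp_two hLa
  have dva : Continuous (dirD v a) := (contDiff_dirD (m := 1) v ha (by norm_num)).continuous
  let k : ℝ → F → F → ℝ := fun r z ζ => dirD v a z * ρ r ζ + (a z - a (z - ζ)) * dirD v (ρ r) ζ
  let m : ℝ → F → ℝ≥0∞ := fun r ζ => ENNReal.ofReal (L * ρ r ζ + L * (r * |dirD v (ρ r) ζ|))
  have km : ∀ r, 0 < r → ∀ z ζ, ‖k r z ζ‖ₑ ≤ m r ζ := by
    intro r hr z ζ
    rw [Real.enorm_eq_ofReal_abs]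
    refine ENNReal.ofReal_le_ofReal ((abs_add_le _ _).trans (add_le_add ?_ ?_))
    · rw [abs_mul, abs_of_nonneg (hρ.nonneg r hr ζ)]
      exact mul_le_mul_of_nonneg_right (ha1 z) (hρ.nonneg r hr ζ)
    · by_cases hζ : r < ‖ζ‖
      · rw [hρ.dirD_eq_zero hr v hζ]; simp
      · rw [abs_mul, ← mul_assoc]
        refine mul_le_mul_of_nonneg_right ((ha2 _ _).trans ?_) (abs_nonneg _)
        rw [sub_sub_cancel]
        exact mul_le_mul_of_nonneg_left (not_lt.1 hζ) hL0
  have key := tendsto_average_sub (μ := μ) (k := k) (m := m) (M := ENNReal.ofReal (L + L * C))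
    (by simp) hh hL
    (fun r hr => by
      have := (hρ.contDiff r hr).continuous
      have := hρ.continuous_dirD hr v
      exact (Continuous.measurable (by fun_prop)).ennreal_ofReal) km
    (fun r hr ζ hζ => by simp [m, hρ.support r hr ζ hζ, hρ.dirD_eq_zero hr v hζ])
    (fun r hr => by
      have i1 := (hρ.integrable hr).const_mul L
      have i2 : Integrable (fun ζ => L * (r * |dirD v (ρ r) ζ|)) μ :=
        ((hρ.integrable_dirD hr v).abs.const_mul r).const_mul L
      have i12 : Integrable (fun ζ => L * ρ r ζ + L * (r * |dirD v (ρ r) ζ|)) μ := i1.add i2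
      change ∫⁻ ζ, ENNReal.ofReal (L * ρ r ζ + L * (r * |dirD v (ρ r) ζ|)) ∂μ ≤ _
      rw [← ofReal_integral_eq_lintegral_ofReal i12 (Eventually.of_forall fun ζ => by
        have := hρ.nonneg r hr ζ
        positivity)]
      refine ENNReal.ofReal_le_ofReal ?_
      rw [integral_add i1 i2, integral_const_mul, integral_const_mul, hρ.integral_eq r hr, mul_one]
      gcongr
      exact hCρ r hr)
  have lim2 : Tendsto (fun r : ℝ => 2 * (ENNReal.ofReal ((L * r) ^ 2) * ∫⁻ z, ‖h z‖ₑ ^ 2 ∂μ))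
      (𝓝[>] 0) (𝓝 0) := by
    have hfin : ∫⁻ z, ‖h z‖ₑ ^ 2 ∂μ ≠ ∞ := by
      rw [← eLpNorm_two_sq]; exact ENNReal.pow_ne_top hL.2.ne
    have c1 : Tendsto (fun r : ℝ => ENNReal.ofReal ((L * r) ^ 2)) (𝓝[>] 0) (𝓝 0) := by
      have : Tendsto (fun r : ℝ => ENNReal.ofReal ((L * r) ^ 2)) (𝓝 0)
          (𝓝 (ENNReal.ofReal ((L * 0) ^ 2))) :=
        (ENNReal.continuous_ofReal.comp (by fun_prop)).tendsto 0
      simp only [mul_zero, ne_eq, OfNat.ofNat_ne_zero, not_false_eq_true, zero_pow,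
        ENNReal.ofReal_zero] at this
      exact this.mono_left nhdsWithin_le_nhds
    have c2 := ENNReal.Tendsto.mul_const (b := ∫⁻ z, ‖h z‖ₑ ^ 2 ∂μ) c1 (Or.inr hfin)
    have c3 := ENNReal.Tendsto.const_mul (a := 2) c2 (Or.inr (by norm_num))
    simpa using c3
  have lim1 := ENNReal.Tendsto.const_mul (a := 2) key (Or.inr (by norm_num))
  have lim := lim1.add lim2
  simp only [mul_zero, add_zero] at lim
  refine tendsto_of_tendsto_of_tendsto_of_le_of_le' tendsto_const_nhds lim
    (Eventually.of_forall fun _ => zero_le) ?_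
  filter_upwards [self_mem_nhdsWithin] with r hr
  have hr : 0 < r := hr
  have hc := hρ.hasCompactSupport hr
  have hcD := hasCompactSupport_dirD v hc
  have h1 := hρ.contDiff_one hr
  have hcont := h1.continuous
  have hcontD := hρ.continuous_dirD hr v
  -- The commutator is an averaging operator plus a multiplication by a function of size `L r`.
  have rep : ∀ z, dirD v (fun y => a y * moll μ (ρ r) h y) z
      - dirD v (moll μ (ρ r) (fun t => a t * h t)) z =
      ∫ ζ, k r z ζ * (h (z - ζ) - h z) ∂μ
        + h z * ∫ ζ, (dirD v a z - dirD v a (z - ζ)) * ρ r ζ ∂μ := by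
    intro z
    have da : Differentiable ℝ a := ha.differentiable (by norm_num)
    have dm : Differentiable ℝ (moll μ (ρ r) h) :=
      (contDiff_moll hc (hρ.contDiff r hr) hloc).differentiable (by simp)
    rw [dirD_mul v da dm, dirD_moll hc h1 hloc, dirD_moll hc h1 hloca, moll_eq_integral_sub,
      moll_eq_integral_sub, moll_eq_integral_sub]
    have i1 := integrable_comp_sub_mul hc hcont hloc z
    have i2 := integrable_comp_sub_mul hcD hcontD hloc z
    have i3 := integrable_comp_sub_mul hcD hcontD hloca z
    have i4 : Integrable (fun ζ => (dirD v a z - dirD v a (z - ζ)) * ρ r ζ) μ :=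
      Continuous.integrable_of_hasCompactSupport (by fun_prop) hc.mul_left
    have i5 : Integrable (k r z) μ := by
      have cont_a := ha.continuous
      refine Integrable.add ((hρ.integrable hr).const_mul _)
        (Continuous.integrable_of_hasCompactSupport (by fun_prop) hcD.mul_left)
    have ek : ∫ ζ, k r z ζ ∂μ = ∫ ζ, (dirD v a z - dirD v a (z - ζ)) * ρ r ζ ∂μ := by
      have cz : ContDiff ℝ 1 (fun ζ => (a z - a (z - ζ)) * ρ r ζ) :=
        (contDiff_const.sub ((ha.of_le (by norm_num)).comp (contDiff_const.sub contDiff_id))).mul h1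
      have zero := integral_dirD_eq_zero μ v cz hc.mul_left
      have dρ : Differentiable ℝ (ρ r) := h1.differentiable (by norm_num)
      have e : ∀ ζ, dirD v (fun ζ => (a z - a (z - ζ)) * ρ r ζ) ζ =
          k r z ζ - (dirD v a z - dirD v a (z - ζ)) * ρ r ζ := by
        intro ζ
        have e1 : dirD v (fun ζ => a (z - ζ)) ζ = - dirD v a (z - ζ) := by
          have g1 : HasFDerivAt (fun ζ : F => z - ζ) (-ContinuousLinearMap.id ℝ F) ζ := by
            simpa using (hasFDerivAt_id ζ).const_sub z
          have g2 := ((da (z - ζ)).hasFDerivAt.comp ζ g1).fderiv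
          have g3 : fderiv ℝ (fun ζ => a (z - ζ)) ζ = _ := g2
          unfold dirD
          rw [g3]; simp
        rw [dirD_mul v (by fun_prop) dρ, dirD_sub v (by fun_prop) (by fun_prop), dirD_const, e1]
        simp only [k]
        ring
      simp_rw [e] at zero
      rw [integral_sub i5 i4] at zero
      linarith
    rw [← ek]
    have e1 : ∫ ζ, k r z ζ * (h (z - ζ) - h z) ∂μ =
        ∫ ζ, k r z ζ * h (z - ζ) ∂μ - h z * ∫ ζ, k r z ζ ∂μ := by
      have i6 : Integrable (fun ζ => k r z ζ * h (z - ζ)) μ := by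
        have := ((i1.const_mul (dirD v a z)).add (i2.const_mul (a z))).sub i3
        refine this.congr (Eventually.of_forall fun ζ => ?_)
        simp only [k, Pi.add_apply, Pi.sub_apply]
        ring
      rw [← integral_const_mul, ← integral_sub i6 (i5.const_mul _)]
      congr 1; ext ζ; ring
    have e2 : ∫ ζ, k r z ζ * h (z - ζ) ∂μ =
        dirD v a z * ∫ ζ, h (z - ζ) * ρ r ζ ∂μ + a z * ∫ ζ, h (z - ζ) * dirD v (ρ r) ζ ∂μ
          - ∫ ζ, a (z - ζ) * h (z - ζ) * dirD v (ρ r) ζ ∂μ := by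
      have i12 : Integrable (fun ζ => dirD v a z * (h (z - ζ) * ρ r ζ)
          + a z * (h (z - ζ) * dirD v (ρ r) ζ)) μ := (i1.const_mul _).add (i2.const_mul _)
      rw [← integral_const_mul, ← integral_const_mul, ← integral_add (i1.const_mul _)
        (i2.const_mul _), ← integral_sub i12 i3]
      congr 1; ext ζ; simp only [k]; ring
    rw [e1, e2]
    ring
  have small : ∀ z, |∫ ζ, (dirD v a z - dirD v a (z - ζ)) * ρ r ζ ∂μ| ≤ L * r := by
    intro z
    have : ∀ ζ, ‖(dirD v a z - dirD v a (z - ζ)) * ρ r ζ‖ ≤ L * r * ρ r ζ := by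
      intro ζ
      by_cases hζ : r < ‖ζ‖
      · rw [hρ.support r hr ζ hζ]; simp
      · rw [norm_mul, Real.norm_eq_abs, Real.norm_eq_abs, abs_of_nonneg (hρ.nonneg r hr ζ)]
        refine mul_le_mul_of_nonneg_right ((ha3 _ _).trans ?_) (hρ.nonneg r hr ζ)
        rw [sub_sub_cancel]
        exact mul_le_mul_of_nonneg_left (not_lt.1 hζ) hL0
    have h2 := norm_integral_le_of_norm_le ((hρ.integrable hr).const_mul (L * r))
      (Eventually.of_forall this)
    rwa [integral_const_mul, hρ.integral_eq r hr, mul_one, Real.norm_eq_abs] at h2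
  have hkm : Measurable fun z => ‖∫ ζ, k r z ζ * (h (z - ζ) - h z) ∂μ‖ₑ ^ 2 := by
    have cont_a := ha.continuous
    have : StronglyMeasurable (fun p : F × F => k r p.1 p.2 * (h (p.1 - p.2) - h p.1)) := by
      refine Measurable.stronglyMeasurable ?_
      have : Measurable (fun p : F × F => k r p.1 p.2) := Continuous.measurable (by fun_prop)
      fun_prop
    exact (this.integral_prod_right (ν := μ)).measurable.enorm.pow_const _
  calc ∫⁻ z, ‖dirD v (fun y => a y * moll μ (ρ r) h y) z
      - dirD v (moll μ (ρ r) (fun t => a t * h t)) z‖ₑ ^ 2 ∂μ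
      ≤ ∫⁻ z, (2 * ‖∫ ζ, k r z ζ * (h (z - ζ) - h z) ∂μ‖ₑ ^ 2
        + 2 * (ENNReal.ofReal ((L * r) ^ 2) * ‖h z‖ₑ ^ 2)) ∂μ := by
        refine lintegral_mono fun z => ?_
        rw [rep]
        refine (enorm_add_sq_le _ _).trans (add_le_add le_rfl ?_)
        rw [enorm_mul, mul_pow, mul_comm (‖h z‖ₑ ^ 2)]
        gcongr
        rw [enorm_sq_eq]
        refine ENNReal.ofReal_le_ofReal ?_
        rw [← sq_abs]
        gcongr
        exact small z
    _ = _ := by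
        rw [lintegral_add_left (hkm.const_mul _), lintegral_const_mul _ hkm,
          lintegral_const_mul _ (by fun_prop), lintegral_const_mul _ (by fun_prop)]

end Friedrichs

/-! ### The mollified equation -/

section Residual

open Filter Topology

variable {d : ℕ} {A : Fin (d + 1) → Fin (d + 1) → SpaceTime d → ℝ} {lam Lam ε K : ℝ}

lemma fderiv_apply_eq_sum (g : SpaceTime d → ℝ) (z w : SpaceTime d) :
    fderiv ℝ g z w = w.1 * dirD et g z + ∑ k, w.2 k * dirD (ex k) g z := by
  have e : w = w.1 • (et : SpaceTime d) + ∑ k, w.2 k • (ex k : SpaceTime d) := by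
    refine Prod.ext ?_ ?_
    · simp [et, ex, Prod.fst_sum]
    · ext i
      simp [et, ex, Prod.snd_sum, basisVec, Finset.sum_apply, Pi.single_apply]
  conv_lhs => rw [e]
  simp [dirD, map_add, map_sum]

lemma abs_sub_le_of_dirD_le {g : SpaceTime d → ℝ} (hg : Differentiable ℝ g)
    (h0 : ∀ z, dirD et g z = 0) (h1 : ∀ k z, |dirD (ex k) g z| ≤ K) (z y : SpaceTime d) :
    |g z - g y| ≤ ((d + 1 : ℝ) * K) * ‖z - y‖ := by
  have hK : 0 ≤ K := (abs_nonneg _).trans (h1 0 z)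
  have hN : ((Fintype.card (Fin (d + 1)) : ℕ) : ℝ) = (d : ℝ) + 1 := by simp
  refine Convex.norm_image_sub_le_of_norm_fderiv_le (𝕜 := ℝ) (f := g) (s := univ)
    (fun x _ => hg x) (fun x _ => ?_) convex_univ (mem_univ y) (mem_univ z)
  refine ContinuousLinearMap.opNorm_le_bound _ (by positivity) fun w => ?_
  rw [fderiv_apply_eq_sum, h0, mul_zero, zero_add, Real.norm_eq_abs, ← hN, mul_assoc]
  refine abs_sum_le_card_mul fun k => ?_
  rw [abs_mul, mul_comm]
  refine mul_le_mul (h1 _ _) ?_ (abs_nonneg _) hK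
  exact (PiLp.norm_apply_le w.2 k).trans (norm_snd_le w)

lemma Admissible.friedrichs_bounds (hA : Admissible A lam Lam ε K) (hLam : 0 < Lam) (hK : 0 ≤ K)
    (k i j : Fin (d + 1)) : ∃ L : ℝ, (∀ z, |A i j z| ≤ L) ∧ (∀ z, |dirD (ex k) (A i j) z| ≤ L) ∧
      (∀ z y, |A i j z - A i j y| ≤ L * ‖z - y‖) ∧
      ∀ z y, |dirD (ex k) (A i j) z - dirD (ex k) (A i j) y| ≤ L * ‖z - y‖ := by
  have hK' : K ≤ (d + 1 : ℝ) * K := by nlinarith [Nat.cast_nonneg (α := ℝ) d]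
  refine ⟨Lam + (d + 1 : ℝ) * K, fun z => (hA.abs_le z i j).trans ?_,
    fun z => (hA.dirD_le k i j z).trans (by linarith), fun z y => ?_, fun z y => ?_⟩
  · have : 0 ≤ (d + 1 : ℝ) * K := by positivity
    linarith
  · refine (abs_sub_le_of_dirD_le ((hA.contDiff i j).differentiable (by norm_num))
      (hA.dirD_et i j) (fun k z => hA.dirD_le k i j z) z y).trans ?_
    gcongr
    linarith
  · refine (abs_sub_le_of_dirD_le ((contDiff_dirD (m := 1) _ (hA.contDiff i j)
      (by norm_num)).differentiable (by norm_num)) (fun z => ?_)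
      (fun l z => hA.dirD_dirD_le l k i j z) z y).trans ?_
    · rw [dirD_comm _ _ (hA.contDiff i j)]
      have : dirD et (A i j) = fun _ => 0 := by ext y; exact hA.dirD_et i j y
      rw [this, dirD_const]
    · gcongr
      linarith

variable {ρ : ℝ → SpaceTime d → ℝ} {T U W : SpaceTime d → ℝ} {G : Fin (d + 1) → SpaceTime d → ℝ}

/-- `G` is the weak spatial gradient of `U`. -/
def IsWeakGrad (U : SpaceTime d → ℝ) (G : Fin (d + 1) → SpaceTime d → ℝ) : Prop :=
  ∀ φ : SpaceTime d → ℝ, ContDiff ℝ (⊤ : ℕ∞) φ → HasCompactSupport φ → ∀ k,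
    ∫ z, U z * dirD (ex k) φ z = -∫ z, G k z * φ z

/-- The weak form of `∂ₜ T + ∑ ∂ₖ (a_{kj} G_j) + W = 0` on `(0, 1) × ℝᵈ⁺¹`. -/
def IsWeakEq (A : Fin (d + 1) → Fin (d + 1) → SpaceTime d → ℝ) (T : SpaceTime d → ℝ)
    (G : Fin (d + 1) → SpaceTime d → ℝ) (W : SpaceTime d → ℝ) : Prop :=
  ∀ φ : SpaceTime d → ℝ, ContDiff ℝ (⊤ : ℕ∞) φ → HasCompactSupport φ →
    tsupport φ ⊆ Ioo (0 : ℝ) 1 ×ˢ univ →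
    ∫ z, T z * dirD et φ z =
      ∫ z, (-(∑ k, ∑ j, A k j z * G j z * dirD (ex k) φ z) + W z * φ z)

lemma dirD_comp_const_sub (v : SpaceTime d) {f : SpaceTime d → ℝ} (hf : Differentiable ℝ f)
    (z t : SpaceTime d) : dirD v (fun t => f (z - t)) t = -dirD v f (z - t) := by
  have g1 : HasFDerivAt (fun ζ : SpaceTime d => z - ζ) (-ContinuousLinearMap.id ℝ _) t := by
    simpa using (hasFDerivAt_id t).const_sub z
  have g2 := ((hf (z - t)).hasFDerivAt.comp t g1).fderiv
  have g3 : fderiv ℝ (fun t => f (z - t)) t = _ := g2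
  unfold dirD
  rw [g3]; simp

lemma hasCompactSupport_comp_const_sub {f : SpaceTime d → ℝ} (hf : HasCompactSupport f)
    (z : SpaceTime d) : HasCompactSupport (fun t => f (z - t)) :=
  hf.comp_homeomorph (Homeomorph.subLeft z)

lemma dirD_moll_of_isWeakGrad (hρ : IsMollifier volume ρ) {r : ℝ} (hr : 0 < r)
    (hU : LocallyIntegrable U volume) (h : IsWeakGrad U G) (k : Fin (d + 1)) :
    dirD (ex k) (moll volume (ρ r) U) = moll volume (ρ r) (G k) := by
  have hc := hρ.hasCompactSupport hr
  have h1 := hρ.contDiff_one hr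
  rw [dirD_moll hc h1 hU]
  ext z
  have h2 := h (fun t => ρ r (z - t)) ((hρ.contDiff r hr).comp (contDiff_const.sub contDiff_id))
    (hasCompactSupport_comp_const_sub hc z) k
  simp_rw [dirD_comp_const_sub _ (h1.differentiable (by norm_num)), mul_neg, integral_neg] at h2
  exact neg_inj.1 h2

/-- The residual of the mollified equation, at times where the mollifier sees only the interval
`(0, 1)`: a sum of Friedrichs commutators and the mollification error of `W`. -/
lemma residual_eq (hρ : IsMollifier volume ρ) {r : ℝ} (hr : 0 < r) (hr' : r < 1 / 8)
    (hA : Admissible A lam Lam ε K)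
    (hT : LocallyIntegrable T volume) (hU : LocallyIntegrable U volume)
    (hW : LocallyIntegrable W volume)
    (hAG : ∀ k j, LocallyIntegrable (fun t => A k j t * G j t) volume)
    (hG : IsWeakGrad U G) (hG' : ∀ k, LocallyIntegrable (G k) volume)
    (hE : IsWeakEq A T G W) {z : SpaceTime d}
    (hz : z.1 ∈ Icc (1 / 8 : ℝ) (7 / 8)) :
    dirD et (moll volume (ρ r) T) z + divOp A ex (moll volume (ρ r) U) z + W z =
      ∑ k, ∑ j, (dirD (ex k) (fun y => A k j y * moll volume (ρ r) (G j) y) z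
        - dirD (ex k) (moll volume (ρ r) (fun t => A k j t * G j t)) z)
      + -(moll volume (ρ r) W z - W z) := by
  have hc := hρ.hasCompactSupport hr
  have h1 := hρ.contDiff_one hr
  have dρ : Differentiable ℝ (ρ r) := h1.differentiable (by norm_num)
  have hsupp : tsupport (fun t => ρ r (z - t)) ⊆ Ioo (0 : ℝ) 1 ×ˢ univ := by
    have : tsupport (fun t => ρ r (z - t)) ⊆ Metric.closedBall z r := by
      refine closure_minimal (fun t ht => ?_) Metric.isClosed_closedBall
      rw [Metric.mem_closedBall, dist_comm, dist_eq_norm]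
      by_contra hlt
      exact ht (hρ.support r hr _ (not_le.1 hlt))
    intro t ht
    have h2 := this ht
    rw [Metric.mem_closedBall, dist_eq_norm] at h2
    have h3 : |t.1 - z.1| ≤ r := (norm_fst_le (t - z)).trans h2
    rw [abs_le] at h3
    refine ⟨⟨?_, ?_⟩, mem_univ _⟩
    · linarith [hz.1]
    · linarith [hz.2]
  have h2 := hE (fun t => ρ r (z - t)) ((hρ.contDiff r hr).comp (contDiff_const.sub contDiff_id))
    (hasCompactSupport_comp_const_sub hc z) hsupp
  simp_rw [dirD_comp_const_sub _ dρ, mul_neg, integral_neg, Finset.sum_neg_distrib, neg_neg] at h2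
  have i1 : ∀ k j, Integrable (fun t => A k j t * G j t * dirD (ex k) (ρ r) (z - t)) volume :=
    fun k j => integrable_mul_comp_sub (hasCompactSupport_dirD _ hc) (hρ.continuous_dirD hr _)
      (hAG k j) z
  rw [integral_add (integrable_finsetSum _ fun k _ => integrable_finsetSum _ fun j _ => i1 k j)
    (integrable_mul_comp_sub hc h1.continuous hW z),
    integral_finsetSum _ (fun k _ => integrable_finsetSum _ fun j _ => i1 k j)] at h2
  simp_rw [integral_finsetSum _ (fun j _ => i1 _ j)] at h2
  have dm : ∀ j, Differentiable ℝ (moll volume (ρ r) (G j)) := fun j =>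
    (contDiff_moll hc (hρ.contDiff r hr) (hG' j)).differentiable (by simp)
  have dA : ∀ i j, Differentiable ℝ (A i j) := fun i j =>
    (hA.contDiff i j).differentiable (by norm_num)
  have e1 : divOp A ex (moll volume (ρ r) U) z =
      ∑ k, ∑ j, dirD (ex k) (fun y => A k j y * moll volume (ρ r) (G j) y) z := by
    unfold divOp
    refine Finset.sum_congr rfl fun k _ => ?_
    rw [← dirD_sum _ _ (by fun_prop)]
    unfold flux
    simp_rw [dirD_moll_of_isWeakGrad hρ hr hU hG]
  rw [e1, dirD_moll hc h1 hT]
  simp_rw [dirD_moll hc h1 (hAG _ _), Finset.sum_sub_distrib]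
  change -moll volume (dirD et (ρ r)) T z = _ at h2
  change -moll volume (dirD et (ρ r)) T z = (∑ k, ∑ j, moll volume (dirD (ex k) (ρ r))
    (fun t => A k j t * G j t) z) + moll volume (ρ r) W z at h2
  linarith

/-- The mollified functions solve the equation up to an error tending to zero in `L²`. -/
lemma tendsto_residual (hρ : IsMollifier volume ρ) (hA : Admissible A lam Lam ε K)
    (hLam : 0 < Lam) (hK : 0 ≤ K) (hT : MemLp T 2 volume) (hU : MemLp U 2 volume)
    (hWm : Measurable W) (hW : MemLp W 2 volume) (hGm : ∀ k, Measurable (G k))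
    (hG2 : ∀ k, MemLp (G k) 2 volume) (hG : IsWeakGrad U G) (hE : IsWeakEq A T G W) :
    Tendsto (fun r => ∫⁻ z in Icc (1 / 8 : ℝ) (7 / 8) ×ˢ univ,
      ‖dirD et (moll volume (ρ r) T) z + divOp A ex (moll volume (ρ r) U) z + W z‖ₑ ^ 2)
      (𝓝[>] 0) (𝓝 0) := by
  have fr : ∀ k j, Tendsto (fun r => ∫⁻ z, ‖dirD (ex k) (fun y => A k j y
      * moll volume (ρ r) (G j) y) z
      - dirD (ex k) (moll volume (ρ r) (fun t => A k j t * G j t)) z‖ₑ ^ 2) (𝓝[>] 0) (𝓝 0) := by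
    intro k j
    obtain ⟨L, l0, l1, l2, l3⟩ := hA.friedrichs_bounds hLam hK k k j
    exact tendsto_friedrichs hρ (hGm j) (hG2 j) (ex k) (hA.contDiff k j) l0 l1 l2 l3
  have hAG2 : ∀ k j, MemLp (fun t => A k j t * G j t) 2 volume := fun k j =>
    MemLp.of_le_mul (c := Lam) (hG2 j)
      (((hA.contDiff k j).continuous.measurable.mul (hGm j)).aestronglyMeasurable)
      (Eventually.of_forall fun z => by
        rw [norm_mul]; exact mul_le_mul_of_nonneg_right (hA.abs_le z k j) (norm_nonneg _))
  have wl := tendsto_moll_sub hρ hWm hW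
  set N : ℝ≥0∞ := ((Finset.univ : Finset (Fin (d + 1))).card : ℝ≥0∞) with hN
  have hNt : N ≠ ∞ := by rw [hN]; exact ENNReal.natCast_ne_top _
  have lim : Tendsto (fun r => 2 * (N * ∑ k, N * ∑ j, ∫⁻ z, ‖dirD (ex k) (fun y => A k j y
      * moll volume (ρ r) (G j) y) z
      - dirD (ex k) (moll volume (ρ r) (fun t => A k j t * G j t)) z‖ₑ ^ 2)
      + 2 * ∫⁻ z, ‖moll volume (ρ r) W z - W z‖ₑ ^ 2) (𝓝[>] 0) (𝓝 0) := by
    have l1 : ∀ k, Tendsto (fun r => N * ∑ j, ∫⁻ z, ‖dirD (ex k) (fun y => A k j y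
      * moll volume (ρ r) (G j) y) z
      - dirD (ex k) (moll volume (ρ r) (fun t => A k j t * G j t)) z‖ₑ ^ 2) (𝓝[>] 0) (𝓝 0) := by
      intro k
      have := ENNReal.Tendsto.const_mul (a := N)
        (tendsto_finsetSum Finset.univ fun j _ => fr k j) (Or.inr hNt)
      simpa using this
    have l2 := ENNReal.Tendsto.const_mul (a := 2) (ENNReal.Tendsto.const_mul (a := N)
        (tendsto_finsetSum Finset.univ fun k _ => l1 k) (Or.inr hNt)) (Or.inr (by norm_num))
    have l3 := ENNReal.Tendsto.const_mul (a := 2) wl (Or.inr (by norm_num))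
    simpa using l2.add l3
  refine tendsto_of_tendsto_of_tendsto_of_le_of_le' tendsto_const_nhds lim
    (Eventually.of_forall fun _ => zero_le) ?_
  filter_upwards [Ioo_mem_nhdsGT (show (0 : ℝ) < 1 / 8 by norm_num)] with r hr
  have hc := hρ.hasCompactSupport hr.1
  have cfr : ∀ k j, Measurable (fun z => ‖dirD (ex k) (fun y => A k j y
      * moll volume (ρ r) (G j) y) z
      - dirD (ex k) (moll volume (ρ r) (fun t => A k j t * G j t)) z‖ₑ ^ 2) := by
    intro k j
    have m1 : ContDiff ℝ 1 (fun y => A k j y * moll volume (ρ r) (G j) y) :=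
      ((hA.contDiff k j).of_le (by norm_num)).mul ((contDiff_moll hc (hρ.contDiff r hr.1)
        (locallyIntegrable_of_memLp_two (hG2 j))).of_le (by exact_mod_cast le_top))
    have m2 : ContDiff ℝ 1 (moll volume (ρ r) (fun t => A k j t * G j t)) :=
      (contDiff_moll hc (hρ.contDiff r hr.1)
        (locallyIntegrable_of_memLp_two (hAG2 k j))).of_le (by exact_mod_cast le_top)
    have m3 := (contDiff_dirD (m := 0) (ex k) m1 (by norm_num)).continuous
    have m4 := (contDiff_dirD (m := 0) (ex k) m2 (by norm_num)).continuous
    exact ((m3.sub m4).measurable).enorm.pow_const _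
  calc ∫⁻ z in Icc (1 / 8 : ℝ) (7 / 8) ×ˢ univ,
      ‖dirD et (moll volume (ρ r) T) z + divOp A ex (moll volume (ρ r) U) z + W z‖ₑ ^ 2
      ≤ ∫⁻ z in Icc (1 / 8 : ℝ) (7 / 8) ×ˢ univ,
        (2 * (N * ∑ k, N * ∑ j, ‖dirD (ex k) (fun y => A k j y
      * moll volume (ρ r) (G j) y) z
      - dirD (ex k) (moll volume (ρ r) (fun t => A k j t * G j t)) z‖ₑ ^ 2)
        + 2 * ‖moll volume (ρ r) W z - W z‖ₑ ^ 2) := by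
        refine setLIntegral_mono' (measurableSet_Icc.prod MeasurableSet.univ) fun z hz => ?_
        rw [residual_eq hρ hr.1 hr.2 hA (locallyIntegrable_of_memLp_two hT)
          (locallyIntegrable_of_memLp_two hU) (locallyIntegrable_of_memLp_two hW)
          (fun k j => locallyIntegrable_of_memLp_two (hAG2 k j)) hG
          (fun k => locallyIntegrable_of_memLp_two (hG2 k)) hE hz.1]
        refine (enorm_add_sq_le _ _).trans (add_le_add ?_ ?_)
        · gcongr
          refine (enorm_sum_sq_le _ _).trans ?_
          gcongr
          exact enorm_sum_sq_le _ _
        · rw [enorm_neg]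
    _ ≤ ∫⁻ z, (2 * (N * ∑ k, N * ∑ j, ‖dirD (ex k) (fun y => A k j y
      * moll volume (ρ r) (G j) y) z
      - dirD (ex k) (moll volume (ρ r) (fun t => A k j t * G j t)) z‖ₑ ^ 2)
        + 2 * ‖moll volume (ρ r) W z - W z‖ₑ ^ 2) := setLIntegral_le_lintegral _ _
    _ = _ := by
      have hs : ∀ k, Measurable (fun z => ∑ j, ‖dirD (ex k) (fun y => A k j y
        * moll volume (ρ r) (G j) y) z
        - dirD (ex k) (moll volume (ρ r) (fun t => A k j t * G j t)) z‖ₑ ^ 2) :=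
        fun k => Finset.measurable_sum _ fun j _ => cfr k j
      have hs2 : Measurable (fun z => ∑ k, N * ∑ j, ‖dirD (ex k) (fun y => A k j y
        * moll volume (ρ r) (G j) y) z
        - dirD (ex k) (moll volume (ρ r) (fun t => A k j t * G j t)) z‖ₑ ^ 2) :=
        Finset.measurable_sum _ fun k _ => (hs k).const_mul _
      rw [lintegral_add_left ((hs2.const_mul _).const_mul _),
        lintegral_const_mul _ (hs2.const_mul _), lintegral_const_mul _ hs2,
        lintegral_finsetSum _ (fun k _ => (hs k).const_mul _),
        lintegral_const_mul' 2 _ (by norm_num)]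
      simp_rw [lintegral_const_mul _ (hs _)]
      simp_rw [lintegral_finsetSum _ (fun j _ => cfr _ j)]

end Residual

/-! ### Real and imaginary parts of a weak solution -/

section RealForm

open Filter Topology

variable {d : ℕ}

/-- The time slab `[0, 1] × ℝᵈ⁺¹`. -/
def slab (d : ℕ) : Set (SpaceTime d) := Icc (0 : ℝ) 1 ×ˢ univ

lemma measurableSet_slab : MeasurableSet (slab d) := measurableSet_Icc.prod MeasurableSet.univ

/-- Real and imaginary parts of a solution `u = U₁ + i U₂`, extended by zero outside the slab, with
their weak gradients `G₁`, `G₂` and the potential terms `W₁ = V U₁`, `W₂ = V U₂`. All functions are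
everywhere defined measurable representatives. -/
structure IsRealForm (A : Fin (d + 1) → Fin (d + 1) → SpaceTime d → ℝ) (M : ℝ)
    (u : SpaceTime d → ℂ) (Du : SpaceTime d → EuclideanSpace ℂ (Fin (d + 1)))
    (U₁ U₂ : SpaceTime d → ℝ) (G₁ G₂ : Fin (d + 1) → SpaceTime d → ℝ)
    (W₁ W₂ : SpaceTime d → ℝ) : Prop where
  measurable_fun₁ : Measurable U₁
  measurable_fun₂ : Measurable U₂
  measurable_grad₁ : ∀ k, Measurable (G₁ k)
  measurable_grad₂ : ∀ k, Measurable (G₂ k)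
  measurable_pot₁ : Measurable W₁
  measurable_pot₂ : Measurable W₂
  memLp_fun₁ : MemLp U₁ 2 volume
  memLp_fun₂ : MemLp U₂ 2 volume
  memLp_grad₁ : ∀ k, MemLp (G₁ k) 2 volume
  memLp_grad₂ : ∀ k, MemLp (G₂ k) 2 volume
  abs_pot₁_le : ∀ᵐ z, |W₁ z| ≤ |M| * |U₁ z|
  abs_pot₂_le : ∀ᵐ z, |W₂ z| ≤ |M| * |U₂ z|
  isWeakGrad₁ : IsWeakGrad U₁ G₁
  isWeakGrad₂ : IsWeakGrad U₂ G₂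
  isWeakEq₁ : IsWeakEq A U₁ G₂ W₂
  isWeakEq₂ : IsWeakEq A (fun z => -U₂ z) G₁ W₁
  fun_eq : ∀ᵐ z, z ∈ slab d → u z = U₁ z + Complex.I * U₂ z
  grad_eq : ∀ᵐ z, z ∈ slab d → ∀ k, Du z k = G₁ k z + Complex.I * G₂ k z

lemma integral_eq_add_I_mul {α : Type*} [MeasurableSpace α] {μ : Measure α} {F : α → ℂ}
    {f g : α → ℝ} (hF : ∀ᵐ z ∂μ, F z = f z + Complex.I * g z) (hf : Integrable f μ)
    (hg : Integrable g μ) :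
    ∫ z, F z ∂μ = ((∫ z, f z ∂μ : ℝ) : ℂ) + Complex.I * ((∫ z, g z ∂μ : ℝ) : ℂ) := by
  rw [integral_congr_ae hF, integral_add hf.ofReal (hg.ofReal.const_mul _),
    integral_const_mul, integral_complex_ofReal, integral_complex_ofReal]

lemma setIntegral_eq_add_I_mul {α : Type*} [MeasurableSpace α] {μ : Measure α} {s : Set α}
    (hs : MeasurableSet s) {F : α → ℂ} {f g : α → ℝ}
    (hF : ∀ᵐ z ∂μ, z ∈ s → F z = f z + Complex.I * g z)
    (hf : Integrable f μ) (hg : Integrable g μ) (hf0 : ∀ z, z ∉ s → f z = 0)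
    (hg0 : ∀ z, z ∉ s → g z = 0) :
    ∫ z in s, F z ∂μ = ((∫ z, f z ∂μ : ℝ) : ℂ) + Complex.I * ((∫ z, g z ∂μ : ℝ) : ℂ) := by
  rw [setIntegral_congr_ae hs hF, setIntegral_eq_integral_of_forall_compl_eq_zero
    (fun z hz => by simp [hf0 z hz, hg0 z hz])]
  exact integral_eq_add_I_mul (Eventually.of_forall fun _ => rfl) hf hg

lemma memLp_indicator_of_le {E : Type*} [NormedAddCommGroup E] {F : SpaceTime d → E}
    {f : SpaceTime d → ℝ} (hF : MemLp F 2 (volume.restrict (slab d))) (hf : Measurable f)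
    (h : ∀ᵐ z ∂volume.restrict (slab d), ‖f z‖ ≤ ‖F z‖) : MemLp ((slab d).indicator f) 2 volume :=
  (memLp_indicator_iff_restrict measurableSet_slab).2 (hF.mono hf.aestronglyMeasurable h)

lemma integrable_mul_of_memLp {U φ : SpaceTime d → ℝ} (hU : MemLp U 2 volume) (hφ : Continuous φ)
    (hc : HasCompactSupport φ) : Integrable (fun z => U z * φ z) volume :=
  (locallyIntegrable_of_memLp_two hU).integrable_smul_right_of_hasCompactSupport hφ hc

lemma fderiv_ofReal_comp {φ : SpaceTime d → ℝ} (hφ : Differentiable ℝ φ) (v z : SpaceTime d) :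
    fderiv ℝ (fun z => (φ z : ℂ)) z v = ((dirD v φ z : ℝ) : ℂ) := by
  have : fderiv ℝ (fun z => (φ z : ℂ)) z = _ :=
    (Complex.ofRealCLM.hasFDerivAt.comp z (hφ z).hasFDerivAt).fderiv
  rw [this]; rfl

lemma fderiv_slice {φ : SpaceTime d → ℝ} (hφ : Differentiable ℝ φ) (t : ℝ)
    (x : EuclideanSpace ℝ (Fin (d + 1))) (k : Fin (d + 1)) :
    fderiv ℝ (fun x => (φ (t, x) : ℂ)) x (basisVec k) = ((dirD (ex k) φ (t, x) : ℝ) : ℂ) := by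
  have h1 : HasFDerivAt (fun x : EuclideanSpace ℝ (Fin (d + 1)) => (t, x))
    (ContinuousLinearMap.inr ℝ ℝ (EuclideanSpace ℝ (Fin (d + 1)))) x := hasFDerivAt_prodMk_right t x
  have : fderiv ℝ (fun x => (φ (t, x) : ℂ)) x = _ :=
    (Complex.ofRealCLM.hasFDerivAt.comp x ((hφ (t, x)).hasFDerivAt.comp x h1)).fderiv
  rw [this]; rfl

lemma hasCompactSupport_slice {φ : SpaceTime d → ℝ} (hφ : HasCompactSupport φ) (t : ℝ) :
    HasCompactSupport (fun x => (φ (t, x) : ℂ)) := by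
  have hk : IsCompact (Prod.snd '' tsupport φ) := hφ.isCompact.image continuous_snd
  refine HasCompactSupport.intro hk fun x hx => ?_
  have : φ (t, x) = 0 := image_eq_zero_of_notMem_tsupport fun h => hx ⟨_, h, rfl⟩
  simp [this]

/-- The weak gradients of almost all time slices assemble to a weak gradient in space-time. -/
lemma isWeakGrad_of_slice {u : SpaceTime d → ℂ}
    {Du : SpaceTime d → EuclideanSpace ℂ (Fin (d + 1))} {U₁ U₂ : SpaceTime d → ℝ}
    {G₁ G₂ : Fin (d + 1) → SpaceTime d → ℝ}
    (hs : ∀ᵐ t ∂(volume.restrict (Icc (0 : ℝ) 1)), IsH1 (fun x => u (t, x)) (fun x => Du (t, x)))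
    (h1 : MemLp U₁ 2 volume) (h2 : MemLp U₂ 2 volume) (h3 : ∀ k, MemLp (G₁ k) 2 volume)
    (h4 : ∀ k, MemLp (G₂ k) 2 volume)
    (hu : ∀ᵐ z, z ∈ slab d → u z = U₁ z + Complex.I * U₂ z)
    (hDu : ∀ᵐ z, z ∈ slab d → ∀ k, Du z k = G₁ k z + Complex.I * G₂ k z)
    (h10 : ∀ z, z ∉ slab d → U₁ z = 0) (h20 : ∀ z, z ∉ slab d → U₂ z = 0)
    (h30 : ∀ k z, z ∉ slab d → G₁ k z = 0) (h40 : ∀ k z, z ∉ slab d → G₂ k z = 0) :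
    IsWeakGrad U₁ G₁ ∧ IsWeakGrad U₂ G₂ := by
  have key : ∀ φ : SpaceTime d → ℝ, ContDiff ℝ (⊤ : ℕ∞) φ → HasCompactSupport φ → ∀ k,
      (∀ᵐ t : ℝ, ∫ x, U₁ (t, x) * dirD (ex k) φ (t, x) = -∫ x, G₁ k (t, x) * φ (t, x)) ∧
      ∀ᵐ t : ℝ, ∫ x, U₂ (t, x) * dirD (ex k) φ (t, x) = -∫ x, G₂ k (t, x) * φ (t, x) := by
    intro φ hφ hc k
    have hφ1 : ContDiff ℝ 1 φ := hφ.of_le (by exact_mod_cast le_top)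
    have dφ : Differentiable ℝ φ := hφ1.differentiable (by norm_num)
    have cφ := (contDiff_dirD (m := 0) (ex k) hφ1 (by norm_num)).continuous
    have sφ := hasCompactSupport_dirD (ex k) hc
    have i1 := (integrable_mul_of_memLp h1 cφ sφ).prod_right_ae
    have i2 := (integrable_mul_of_memLp h2 cφ sφ).prod_right_ae
    have i3 := (integrable_mul_of_memLp (h3 k) hφ1.continuous hc).prod_right_ae
    have i4 := (integrable_mul_of_memLp (h4 k) hφ1.continuous hc).prod_right_ae
    have a1 := Measure.ae_ae_of_ae_prod hu
    have a2 := Measure.ae_ae_of_ae_prod hDu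
    rw [ae_restrict_iff' measurableSet_Icc] at hs
    rw [← eventually_and]
    filter_upwards [i1, i2, i3, i4, a1, a2, hs] with t i1 i2 i3 i4 a1 a2 hs
    by_cases ht : t ∈ Icc (0 : ℝ) 1
    · have hψ : ContDiff ℝ (⊤ : ℕ∞) (fun x : EuclideanSpace ℝ (Fin (d + 1)) => (φ (t, x) : ℂ)) :=
        Complex.ofRealCLM.contDiff.comp (hφ.comp (contDiff_const.prodMk contDiff_id))
      have e := (hs ht).weak_deriv _ hψ (hasCompactSupport_slice hc t) k
      simp_rw [fderiv_slice dφ] at e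
      rw [integral_eq_add_I_mul
        (f := fun x => U₁ (t, x) * dirD (ex k) φ (t, x))
        (g := fun x => U₂ (t, x) * dirD (ex k) φ (t, x)) ?_ i1 i2,
        integral_eq_add_I_mul
        (f := fun x => G₁ k (t, x) * φ (t, x))
        (g := fun x => G₂ k (t, x) * φ (t, x)) ?_ i3 i4] at e
      · have er := congrArg Complex.re e
        have ei := congrArg Complex.im e
        simp only [Complex.add_re, Complex.add_im, Complex.neg_re, Complex.neg_im, Complex.mul_re,
          Complex.mul_im, Complex.I_re, Complex.I_im, Complex.ofReal_re, Complex.ofReal_im] at er ei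
        constructor <;> linarith
      · filter_upwards [a2] with x hx
        rw [hx ⟨ht, mem_univ _⟩ k]; push_cast; ring
      · filter_upwards [a1] with x hx
        rw [hx ⟨ht, mem_univ _⟩]; push_cast; ring
    · have hn : ∀ x : EuclideanSpace ℝ (Fin (d + 1)), (t, x) ∉ slab d := fun x h => ht h.1
      simp [h10 _ (hn _), h20 _ (hn _), h30 _ _ (hn _), h40 _ _ (hn _)]
  refine ⟨fun φ hφ hc k => ?_, fun φ hφ hc k => ?_⟩ <;>
  · have hφ1 : ContDiff ℝ 1 φ := hφ.of_le (by exact_mod_cast le_top)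
    have cφ := (contDiff_dirD (m := 0) (ex k) hφ1 (by norm_num)).continuous
    have sφ := hasCompactSupport_dirD (ex k) hc
    rw [Measure.volume_eq_prod, integral_prod _ (integrable_mul_of_memLp ‹_› cφ sφ),
      integral_prod _ (integrable_mul_of_memLp (by first | exact h3 k | exact h4 k)
        hφ1.continuous hc), ← integral_neg]
    exact integral_congr_ae (by first | exact (key φ hφ hc k).1 | exact (key φ hφ hc k).2)

/-- The complex equation, tested with real functions, splits into a system of two real ones. -/
lemma isWeakEq_of_isWeakSolution {𝒜 : EuclideanSpace ℝ (Fin (d + 1)) →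
      Matrix (Fin (d + 1)) (Fin (d + 1)) ℝ} {V : SpaceTime d → ℝ} {u : SpaceTime d → ℂ}
    {Du : SpaceTime d → EuclideanSpace ℂ (Fin (d + 1))} {U₁ U₂ : SpaceTime d → ℝ}
    {G₁ G₂ : Fin (d + 1) → SpaceTime d → ℝ} {W₁ W₂ : SpaceTime d → ℝ}
    (hsol : IsWeakSolution 𝒜 V u Du) (hA : ∀ i j, Continuous fun z : SpaceTime d => 𝒜 z.2 i j)
    (h1 : MemLp U₁ 2 volume) (h2 : MemLp U₂ 2 volume) (h3 : ∀ k, MemLp (G₁ k) 2 volume)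
    (h4 : ∀ k, MemLp (G₂ k) 2 volume) (h5 : MemLp W₁ 2 volume) (h6 : MemLp W₂ 2 volume)
    (hu : ∀ᵐ z, z ∈ slab d → u z = U₁ z + Complex.I * U₂ z)
    (hDu : ∀ᵐ z, z ∈ slab d → ∀ k, Du z k = G₁ k z + Complex.I * G₂ k z)
    (hV : ∀ᵐ z, z ∈ slab d → V z * u z = W₁ z + Complex.I * W₂ z) :
    IsWeakEq (fun i j z => 𝒜 z.2 i j) U₁ G₂ W₂ ∧
      IsWeakEq (fun i j z => 𝒜 z.2 i j) (fun z => -U₂ z) G₁ W₁ := by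
  have key : ∀ φ : SpaceTime d → ℝ, ContDiff ℝ (⊤ : ℕ∞) φ → HasCompactSupport φ →
      tsupport φ ⊆ Ioo (0 : ℝ) 1 ×ˢ univ →
      (∫ z, U₁ z * dirD et φ z =
        ∫ z, (-(∑ k, ∑ j, 𝒜 z.2 k j * G₂ j z * dirD (ex k) φ z) + W₂ z * φ z)) ∧
      (∫ z, -U₂ z * dirD et φ z =
        ∫ z, (-(∑ k, ∑ j, 𝒜 z.2 k j * G₁ j z * dirD (ex k) φ z) + W₁ z * φ z)) := by
    intro φ hφ hc hsupp
    have hφ1 : ContDiff ℝ 1 φ := hφ.of_le (by exact_mod_cast le_top)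
    have dφ : Differentiable ℝ φ := hφ1.differentiable (by norm_num)
    have cφ : ∀ v, Continuous (dirD v φ) := fun v =>
      (contDiff_dirD (m := 0) v hφ1 (by norm_num)).continuous
    have sφ : ∀ v, HasCompactSupport (dirD v φ) := fun v => hasCompactSupport_dirD v hc
    have z0 : ∀ z, z ∉ Ioo (0 : ℝ) 1 ×ˢ (univ : Set (EuclideanSpace ℝ (Fin (d + 1)))) → φ z = 0 :=
      fun z hz => image_eq_zero_of_notMem_tsupport fun h => hz (hsupp h)
    have zd : ∀ v z, z ∉ Ioo (0 : ℝ) 1 ×ˢ (univ : Set (EuclideanSpace ℝ (Fin (d + 1)))) →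
        dirD v φ z = 0 := fun v z hz => by
      refine dirD_eq_zero_of_eventuallyEq (c := 0) v ?_
      exact notMem_tsupport_iff_eventuallyEq.1 fun h => hz (hsupp h)
    have sub : Ioo (0 : ℝ) 1 ×ˢ (univ : Set (EuclideanSpace ℝ (Fin (d + 1)))) ⊆ slab d :=
      prod_mono Ioo_subset_Icc_self subset_rfl
    have hm : MeasurableSet (Ioo (0 : ℝ) 1 ×ˢ (univ : Set (EuclideanSpace ℝ (Fin (d + 1))))) :=
      measurableSet_Ioo.prod MeasurableSet.univ
    have iAG : ∀ G : Fin (d + 1) → SpaceTime d → ℝ, (∀ k, MemLp (G k) 2 volume) → ∀ W,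
        MemLp W 2 volume → Integrable (fun z => -(∑ k, ∑ j, 𝒜 z.2 k j * G j z * dirD (ex k) φ z)
          + W z * φ z) volume := by
      intro G hG W hW
      refine ((integrable_finsetSum _ fun k _ => integrable_finsetSum _ fun j _ => ?_).neg).add
        (integrable_mul_of_memLp hW hφ1.continuous hc)
      have := integrable_mul_of_memLp (hG j) ((hA k j).mul (cφ (ex k))) ((sφ (ex k)).mul_left)
      refine this.congr (Eventually.of_forall fun z => ?_)
      simp only [Pi.mul_apply]; ring
    have e := hsol (fun z => (φ z : ℂ)) (Complex.ofRealCLM.contDiff.comp hφ)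
      (hc.comp_left (g := fun x : ℝ => (x : ℂ)) (by simp))
      ((closure_mono (by intro z hz h; exact hz (by simp [h]))).trans hsupp)
    simp_rw [fderiv_ofReal_comp dφ] at e
    rw [setIntegral_eq_add_I_mul hm (f := fun z => U₁ z * dirD et φ z)
        (g := fun z => U₂ z * dirD et φ z) ?_ (integrable_mul_of_memLp h1 (cφ _) (sφ _))
        (integrable_mul_of_memLp h2 (cφ _) (sφ _)) (fun z hz => by simp [zd _ z hz])
        (fun z hz => by simp [zd _ z hz]),
      setIntegral_eq_add_I_mul hm
        (f := fun z => -(∑ k, ∑ j, 𝒜 z.2 k j * G₁ j z * dirD (ex k) φ z) + W₁ z * φ z)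
        (g := fun z => -(∑ k, ∑ j, 𝒜 z.2 k j * G₂ j z * dirD (ex k) φ z) + W₂ z * φ z)
        ?_ (iAG _ h3 _ h5) (iAG _ h4 _ h6) (fun z hz => by simp [zd _ z hz, z0 z hz])
        (fun z hz => by simp [zd _ z hz, z0 z hz])] at e
    · have er := congrArg Complex.re e
      have ei := congrArg Complex.im e
      simp only [Complex.add_re, Complex.add_im, Complex.neg_re, Complex.neg_im, Complex.mul_re,
        Complex.mul_im, Complex.I_re, Complex.I_im, Complex.ofReal_re, Complex.ofReal_im] at er ei
      refine ⟨by linarith, ?_⟩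
      simp_rw [neg_mul (U₂ _), integral_neg]
      linarith
    · filter_upwards [hDu, hV] with z hz1 hz2 hz
      rw [hz2 (sub hz)]
      simp_rw [hz1 (sub hz)]
      push_cast
      have : ∀ k j, (𝒜 z.2 k j : ℂ) * (G₁ j z + Complex.I * G₂ j z) *
          (dirD (0, basisVec k) φ z : ℝ) = 𝒜 z.2 k j * G₁ j z * (dirD (ex k) φ z : ℝ)
          + Complex.I * (𝒜 z.2 k j * G₂ j z * (dirD (ex k) φ z : ℝ)) := fun k j => by
        unfold ex; ring
      simp_rw [this, Finset.sum_add_distrib, ← Finset.mul_sum]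
      ring
    · filter_upwards [hu] with z hz1 hz
      rw [hz1 (sub hz)]; unfold et; push_cast; ring
  exact ⟨fun φ h h' h'' => (key φ h h' h'').1, fun φ h h' h'' => (key φ h h' h'').2⟩

/-- Every weak solution has a real form. -/
lemma exists_isRealForm {𝒜 : EuclideanSpace ℝ (Fin (d + 1)) →
      Matrix (Fin (d + 1)) (Fin (d + 1)) ℝ} {V : SpaceTime d → ℝ} {u : SpaceTime d → ℂ}
    {Du : SpaceTime d → EuclideanSpace ℂ (Fin (d + 1))} {M : ℝ}
    (hA : ∀ i j, Continuous fun z : SpaceTime d => 𝒜 z.2 i j)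
    (hV : MemLp V ∞ (volume.restrict (Icc (0 : ℝ) 1 ×ˢ univ)))
    (hVM : eLpNorm V ∞ (volume.restrict (Icc (0 : ℝ) 1 ×ˢ univ)) ≤ ENNReal.ofReal M)
    (hu : MemL2H1 u Du) (hsol : IsWeakSolution 𝒜 V u Du) :
    ∃ U₁ U₂ G₁ G₂ W₁ W₂, IsRealForm (fun i j z => 𝒜 z.2 i j) M u Du U₁ U₂ G₁ G₂ W₁ W₂ := by
  obtain ⟨u', hu'm, hu'⟩ := hu.memLp_fun.aestronglyMeasurable
  obtain ⟨D', hD'm, hD'⟩ := hu.memLp_grad.aestronglyMeasurable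
  obtain ⟨V', hV'm, hV'⟩ := hV.aestronglyMeasurable
  have m1 : Measurable fun z => (u' z).re := Complex.measurable_re.comp hu'm.measurable
  have m2 : Measurable fun z => (u' z).im := Complex.measurable_im.comp hu'm.measurable
  have mD : ∀ k, Measurable fun z => D' z k := fun k =>
    (EuclideanSpace.proj (𝕜 := ℂ) k).continuous.measurable.comp hD'm.measurable
  have m3 : ∀ k, Measurable fun z => (D' z k).re := fun k => Complex.measurable_re.comp (mD k)
  have m4 : ∀ k, Measurable fun z => (D' z k).im := fun k => Complex.measurable_im.comp (mD k)
  have p1 : MemLp ((slab d).indicator fun z => (u' z).re) 2 volume :=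
    memLp_indicator_of_le hu.memLp_fun m1 (hu'.mono fun z hz => by
      rw [hz]; exact Complex.abs_re_le_norm _)
  have p2 : MemLp ((slab d).indicator fun z => (u' z).im) 2 volume :=
    memLp_indicator_of_le hu.memLp_fun m2 (hu'.mono fun z hz => by
      rw [hz]; exact Complex.abs_im_le_norm _)
  have p3 : ∀ k, MemLp ((slab d).indicator fun z => (D' z k).re) 2 volume := fun k =>
    memLp_indicator_of_le hu.memLp_grad (m3 k) (hD'.mono fun z hz => by
      rw [hz]; exact (Complex.abs_re_le_norm _).trans (PiLp.norm_apply_le _ _))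
  have p4 : ∀ k, MemLp ((slab d).indicator fun z => (D' z k).im) 2 volume := fun k =>
    memLp_indicator_of_le hu.memLp_grad (m4 k) (hD'.mono fun z hz => by
      rw [hz]; exact (Complex.abs_im_le_norm _).trans (PiLp.norm_apply_le _ _))
  have hu'2 : ∀ᵐ z, z ∈ slab d → u z = u' z := (ae_restrict_iff' measurableSet_slab).1 hu'
  have hD'2 : ∀ᵐ z, z ∈ slab d → Du z = D' z := (ae_restrict_iff' measurableSet_slab).1 hD'
  have hV'2 : ∀ᵐ z, z ∈ slab d → V z = V' z := (ae_restrict_iff' measurableSet_slab).1 hV'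
  have fe : ∀ᵐ z, z ∈ slab d → u z = ((slab d).indicator (fun z => (u' z).re) z : ℝ)
      + Complex.I * ((slab d).indicator (fun z => (u' z).im) z : ℝ) := by
    filter_upwards [hu'2] with z hz hzs
    rw [hz hzs, indicator_of_mem hzs, indicator_of_mem hzs, mul_comm, Complex.re_add_im]
  have ge : ∀ᵐ z, z ∈ slab d → ∀ k, Du z k = ((slab d).indicator (fun z => (D' z k).re) z : ℝ)
      + Complex.I * ((slab d).indicator (fun z => (D' z k).im) z : ℝ) := by
    filter_upwards [hD'2] with z hz hzs k
    rw [hz hzs, indicator_of_mem hzs, indicator_of_mem hzs, mul_comm, Complex.re_add_im]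
  have Vle : ∀ᵐ z, z ∈ slab d → |V' z| ≤ |M| := by
    have h1 : ∀ᵐ z ∂volume.restrict (slab d), ‖V z‖ₑ ≤ ENNReal.ofReal M := by
      rw [eLpNorm_exponent_top] at hVM
      filter_upwards [ae_le_eLpNormEssSup (f := V) (μ := volume.restrict (slab d))] with z hz
      exact hz.trans hVM
    filter_upwards [(ae_restrict_iff' measurableSet_slab).1 h1, hV'2] with z h1 h2 hz
    have h3 := h1 hz
    rw [h2 hz, Real.enorm_eq_ofReal_abs] at h3
    have h4 := h3.trans (ENNReal.ofReal_le_ofReal (le_abs_self M))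
    exact (ENNReal.ofReal_le_ofReal_iff (abs_nonneg M)).1 h4
  have ab : ∀ f : SpaceTime d → ℝ, ∀ᵐ z, |V' z * (slab d).indicator f z| ≤
      |M| * |(slab d).indicator f z| := fun f => by
    filter_upwards [Vle] with z hz
    by_cases h : z ∈ slab d
    · rw [abs_mul]; exact mul_le_mul_of_nonneg_right (hz h) (abs_nonneg _)
    · simp [h]
  have s1 := measurableSet_slab (d := d)
  have p5 : MemLp (fun z => V' z * (slab d).indicator (fun z => (u' z).re) z) 2 volume :=
    MemLp.of_le_mul p1 (hV'm.measurable.mul (m1.indicator s1)).aestronglyMeasurable (ab _)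
  have p6 : MemLp (fun z => V' z * (slab d).indicator (fun z => (u' z).im) z) 2 volume :=
    MemLp.of_le_mul p2 (hV'm.measurable.mul (m2.indicator s1)).aestronglyMeasurable (ab _)
  obtain ⟨w1, w2⟩ := isWeakGrad_of_slice hu.slice p1 p2 p3 p4 fe ge
    (fun z hz => indicator_of_notMem hz _) (fun z hz => indicator_of_notMem hz _)
    (fun k z hz => indicator_of_notMem hz _) (fun k z hz => indicator_of_notMem hz _)
  obtain ⟨w3, w4⟩ := isWeakEq_of_isWeakSolution hsol hA p1 p2 p3 p4 p5 p6 fe ge (by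
    filter_upwards [fe, hV'2] with z h1 h2 hz
    rw [h1 hz, h2 hz]; push_cast; ring)
  exact ⟨_, _, _, _, _, _,
    { measurable_fun₁ := m1.indicator s1
      measurable_fun₂ := m2.indicator s1
      measurable_grad₁ := fun k => (m3 k).indicator s1
      measurable_grad₂ := fun k => (m4 k).indicator s1
      measurable_pot₁ := hV'm.measurable.mul (m1.indicator s1)
      measurable_pot₂ := hV'm.measurable.mul (m2.indicator s1)
      memLp_fun₁ := p1
      memLp_fun₂ := p2
      memLp_grad₁ := p3
      memLp_grad₂ := p4
      abs_pot₁_le := ab _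
      abs_pot₂_le := ab _
      isWeakGrad₁ := w1
      isWeakGrad₂ := w2
      isWeakEq₁ := w3
      isWeakEq₂ := w4
      fun_eq := fe
      grad_eq := ge }⟩

end RealForm

/-! ### Smooth approximation and size of the weights -/

section Approximation

open Filter Topology

variable {d : ℕ} {A : Fin (d + 1) → Fin (d + 1) → SpaceTime d → ℝ} {lam Lam ε K M : ℝ}
  {u : SpaceTime d → ℂ} {Du : SpaceTime d → EuclideanSpace ℂ (Fin (d + 1))}
  {U₁ U₂ : SpaceTime d → ℝ} {G₁ G₂ : Fin (d + 1) → SpaceTime d → ℝ} {W₁ W₂ : SpaceTime d → ℝ}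

lemma IsRealForm.memLp_pot₁ (h : IsRealForm A M u Du U₁ U₂ G₁ G₂ W₁ W₂) : MemLp W₁ 2 volume :=
  MemLp.of_le_mul h.memLp_fun₁ h.measurable_pot₁.aestronglyMeasurable h.abs_pot₁_le

lemma IsRealForm.memLp_pot₂ (h : IsRealForm A M u Du U₁ U₂ G₁ G₂ W₁ W₂) : MemLp W₂ 2 volume :=
  MemLp.of_le_mul h.memLp_fun₂ h.measurable_pot₂.aestronglyMeasurable h.abs_pot₂_le

/-- A weak solution is approximated in `L²`, with its gradient, by smooth functions that solve the
equation up to an error small in `L²`. -/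
lemma IsRealForm.exists_smooth_approx (h : IsRealForm A M u Du U₁ U₂ G₁ G₂ W₁ W₂)
    (hA : Admissible A lam Lam ε K) (hLam : 0 < Lam) (hK : 0 ≤ K) {δ : ℝ≥0∞} (hδ : 0 < δ) :
    ∃ w₁ w₂ : SpaceTime d → ℝ, ContDiff ℝ 2 w₁ ∧ ContDiff ℝ 2 w₂ ∧
      ∫⁻ z, ‖w₁ z - U₁ z‖ₑ ^ 2 ≤ δ ∧ ∫⁻ z, ‖w₂ z - U₂ z‖ₑ ^ 2 ≤ δ ∧
      (∀ k, ∫⁻ z, ‖dirD (ex k) w₁ z - G₁ k z‖ₑ ^ 2 ≤ δ) ∧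
      (∀ k, ∫⁻ z, ‖dirD (ex k) w₂ z - G₂ k z‖ₑ ^ 2 ≤ δ) ∧
      ∫⁻ z in Icc (1 / 8 : ℝ) (7 / 8) ×ˢ univ,
        ‖-dirD et w₂ z + divOp A ex w₁ z + W₁ z‖ₑ ^ 2 ≤ δ ∧
      ∫⁻ z in Icc (1 / 8 : ℝ) (7 / 8) ×ˢ univ,
        ‖dirD et w₁ z + divOp A ex w₂ z + W₂ z‖ₑ ^ 2 ≤ δ := by
  obtain ⟨ρ, hρ⟩ := exists_isMollifier (volume : Measure (SpaceTime d))
  have l1 := locallyIntegrable_of_memLp_two h.memLp_fun₁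
  have l2 := locallyIntegrable_of_memLp_two h.memLp_fun₂
  have t1 := tendsto_moll_sub hρ h.measurable_fun₁ h.memLp_fun₁
  have t2 := tendsto_moll_sub hρ h.measurable_fun₂ h.memLp_fun₂
  have t3 := fun k => tendsto_moll_sub hρ (h.measurable_grad₁ k) (h.memLp_grad₁ k)
  have t4 := fun k => tendsto_moll_sub hρ (h.measurable_grad₂ k) (h.memLp_grad₂ k)
  have t5 := tendsto_residual hρ hA hLam hK h.memLp_fun₂.neg h.memLp_fun₁ h.measurable_pot₁
    h.memLp_pot₁ h.measurable_grad₁ h.memLp_grad₁ h.isWeakGrad₁ h.isWeakEq₂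
  have t6 := tendsto_residual hρ hA hLam hK h.memLp_fun₁ h.memLp_fun₂ h.measurable_pot₂
    h.memLp_pot₂ h.measurable_grad₂ h.memLp_grad₂ h.isWeakGrad₂ h.isWeakEq₁
  have ev : ∀ {f : ℝ → ℝ≥0∞}, Tendsto f (𝓝[>] 0) (𝓝 0) → ∀ᶠ r in 𝓝[>] 0, f r ≤ δ := fun hf =>
    (ENNReal.tendsto_nhds_zero.1 hf) δ hδ
  obtain ⟨r, e1, e2, e3, e4, e5, e6, hr⟩ := ((ev t1).and <| (ev t2).and <|
    (eventually_all.2 fun k => ev (t3 k)).and <| (eventually_all.2 fun k => ev (t4 k)).and <|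
    (ev t5).and <| (ev t6).and self_mem_nhdsWithin).exists
  have hr : 0 < r := hr
  have hc := hρ.hasCompactSupport hr
  have neg : ∀ z, dirD et (moll volume (ρ r) (-U₂)) z = -dirD et (moll volume (ρ r) U₂) z := by
    intro z
    have : moll volume (ρ r) (-U₂) = fun z => -moll volume (ρ r) U₂ z := by
      ext z; simp [moll, integral_neg]
    rw [this, dirD_neg]
  refine ⟨moll volume (ρ r) U₁, moll volume (ρ r) U₂,
    contDiff_infty.1 (contDiff_moll hc (hρ.contDiff r hr) l1) 2,
    contDiff_infty.1 (contDiff_moll hc (hρ.contDiff r hr) l2) 2, e1, e2,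
    fun k => ?_, fun k => ?_, ?_, e6⟩
  · rw [dirD_moll_of_isWeakGrad hρ hr l1 h.isWeakGrad₁]; exact e3 k
  · rw [dirD_moll_of_isWeakGrad hρ hr l2 h.isWeakGrad₂]; exact e4 k
  · simp_rw [neg] at e5; exact e5

end Approximation

section WeightedBounds

variable {d : ℕ} {κ R : ℝ}

/-- The squared weight `e^{2ψ} χ²`. -/
noncomputable def bulkWeight (d : ℕ) (κ R : ℝ) (z : SpaceTime d) : ℝ≥0∞ :=
  ENNReal.ofReal (Real.exp (weight κ R timeBump z) ^ 2 * cutoff R z ^ 2)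

/-- The squared weight `e^{2ψ}` on the region where the cutoff varies. -/
noncomputable def edgeWeight (d : ℕ) (κ R : ℝ) : SpaceTime d → ℝ≥0∞ :=
  (cutoffEdge d R).indicator fun z => ENNReal.ofReal (Real.exp (weight κ R timeBump z) ^ 2)

lemma continuous_weight : Continuous (weight (d := d) κ R timeBump) :=
  (contDiff_weight (contDiff_timeBump)).continuous

lemma measurable_bulkWeight : Measurable (bulkWeight d κ R) :=
  ((((continuous_weight.rexp).pow 2).mul
    (contDiff_cutoff.continuous.pow 2)).measurable).ennreal_ofReal

lemma measurable_edgeWeight : Measurable (edgeWeight d κ R) :=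
  (((continuous_weight.rexp).pow 2).measurable.ennreal_ofReal).indicator measurableSet_cutoffEdge

lemma exp_weight_sq (z : SpaceTime d) : Real.exp (weight κ R timeBump z) ^ 2 =
    Real.exp (2 * κ * ∑ k, shift R timeBump k z ^ 2) := by
  rw [← Real.exp_nat_mul]; congr 1; unfold weight; push_cast; ring

lemma exp_weight_sq_le (hκ : 0 ≤ κ) {z : SpaceTime d} {q : ℝ}
    (hq : ∑ k, shift R timeBump k z ^ 2 ≤ q) :
    Real.exp (weight κ R timeBump z) ^ 2 ≤ Real.exp (2 * κ * q) := by
  rw [exp_weight_sq]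
  exact Real.exp_le_exp.2 (mul_le_mul_of_nonneg_left hq (by positivity))

/-- The cutoff keeps `|x + R φ(t) e₁| ≤ 5 R`, whence the constant `50 = 2 · 5²`. -/
lemma bulkWeight_le (hκ : 0 ≤ κ) (hR : 1 ≤ R) (z : SpaceTime d) :
    bulkWeight d κ R z ≤ (Icc (1 / 8 : ℝ) (7 / 8) ×ˢ univ).indicator
      (fun _ => ENNReal.ofReal (Real.exp (50 * κ * R ^ 2))) z := by
  unfold bulkWeight
  by_cases hz : z ∈ cutoffRegion d R
  · have hs : z ∈ Icc (1 / 8 : ℝ) (7 / 8) ×ˢ (univ : Set (EuclideanSpace ℝ (Fin (d + 1)))) :=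
      ⟨hz.1, mem_univ _⟩
    rw [indicator_of_mem hs]
    refine ENNReal.ofReal_le_ofReal ?_
    have h1 := exp_weight_sq_le hκ (sum_shift_sq_le (by linarith) hz.2.1)
    have h2 : cutoff R z ^ 2 ≤ 1 := pow_le_one₀ (cutoff_nonneg z) (cutoff_le_one z)
    calc _ ≤ Real.exp (2 * κ * (25 * R ^ 2)) * 1 :=
          mul_le_mul h1 h2 (sq_nonneg _) (Real.exp_pos _).le
      _ = _ := by rw [mul_one]; congr 1; ring
  · rw [cutoff_eq_zero hR hz]; simp

/-- The edge consists of points within `2 R` of the moving centre and of the outer shell, whence the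
constants `8 = 2 · 2²` and `50 = 2 · 5²`. -/
lemma edgeWeight_le (hκ : 0 ≤ κ) (hR : 0 ≤ R) (z : SpaceTime d) :
    edgeWeight d κ R z ≤ (Icc (1 / 8 : ℝ) (7 / 8) ×ˢ univ).indicator
        (fun _ => ENNReal.ofReal (Real.exp (8 * κ * R ^ 2))) z +
      (Icc (1 / 8 : ℝ) (7 / 8) ×ˢ (Metric.closedBall 0 R \ Metric.closedBall 0 (R - 1))).indicator
        (fun _ => ENNReal.ofReal (Real.exp (50 * κ * R ^ 2))) z := by
  unfold edgeWeight
  by_cases hz : z ∈ cutoffEdge d R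
  · rw [indicator_of_mem hz]
    obtain ⟨hz1, hz2 | hz2⟩ := hz
    · rw [indicator_of_mem (s := Icc (1 / 8 : ℝ) (7 / 8) ×ˢ (Metric.closedBall 0 R \ _))
        ⟨hz1.1, by simpa using hz1.2.1, by simpa using hz2⟩]
      refine (ENNReal.ofReal_le_ofReal ?_).trans le_add_self
      refine (exp_weight_sq_le hκ (sum_shift_sq_le hR hz1.2.1)).trans_eq ?_
      congr 1; ring
    · rw [indicator_of_mem (s := Icc (1 / 8 : ℝ) (7 / 8) ×ˢ univ) ⟨hz1.1, mem_univ _⟩]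
      refine (ENNReal.ofReal_le_ofReal ?_).trans le_self_add
      refine (exp_weight_sq_le hκ hz2).trans_eq ?_
      congr 1; ring
  · rw [indicator_of_notMem hz]; exact zero_le

lemma edgeWeight_le_const (hκ : 0 ≤ κ) (hR : 0 ≤ R) (z : SpaceTime d) :
    edgeWeight d κ R z ≤ ENNReal.ofReal (Real.exp (50 * κ * R ^ 2)) := by
  unfold edgeWeight
  by_cases hz : z ∈ cutoffEdge d R
  · rw [indicator_of_mem hz]
    refine ENNReal.ofReal_le_ofReal ?_
    refine (exp_weight_sq_le hκ (sum_shift_sq_le hR hz.1.2.1)).trans_eq ?_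
    congr 1; ring
  · rw [indicator_of_notMem hz]; exact zero_le

/-- On the cylinder carrying the mass of the solution the weight is at least `e^{18κR²}`. -/
lemma le_bulkWeight (hκ : 0 ≤ κ) {R₀ : ℝ} (hR₀ : R₀ ^ 2 ≤ R ^ 2 - R) (hR : 0 < R) (hR' : R₀ ≤ R)
    {z : SpaceTime d} (hz : z ∈ Icc (1 / 4 : ℝ) (3 / 4) ×ˢ Metric.closedBall
      (0 : EuclideanSpace ℝ (Fin (d + 1))) R₀) :
    ENNReal.ofReal (Real.exp (18 * κ * R ^ 2)) ≤ bulkWeight d κ R z := by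
  have hx : ‖z.2‖ ≤ R₀ := by simpa using hz.2
  have h1 := le_sum_shift_sq hz.1 hx hR'
  have h2 : cutoff R z = 1 := cutoff_eq_one hR
    ((pow_le_pow_left₀ (norm_nonneg _) hx 2).trans hR₀) (by nlinarith [sq_nonneg R])
  unfold bulkWeight
  rw [h2, exp_weight_sq, one_pow, mul_one]
  refine ENNReal.ofReal_le_ofReal (Real.exp_le_exp.2 ?_)
  calc 18 * κ * R ^ 2 = 2 * κ * (9 * R ^ 2) := by ring
    _ ≤ _ := mul_le_mul_of_nonneg_left h1 (by positivity)

end WeightedBounds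

/-! ### The Carleman estimate for weak solutions -/

section WeightedEstimate

variable {d : ℕ} {A : Fin (d + 1) → Fin (d + 1) → SpaceTime d → ℝ} {lam Lam ε K κ c M R : ℝ}
  {φ : ℝ → ℝ}
  {u : SpaceTime d → ℂ} {Du : SpaceTime d → EuclideanSpace ℂ (Fin (d + 1))}
  {U₁ U₂ : SpaceTime d → ℝ} {G₁ G₂ : Fin (d + 1) → SpaceTime d → ℝ} {W₁ W₂ : SpaceTime d → ℝ}

/-- The density `U² + |G|²` of a function `U` with gradient `G`. -/
noncomputable def gradDensity (U : SpaceTime d → ℝ) (G : Fin (d + 1) → SpaceTime d → ℝ)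
    (z : SpaceTime d) : ℝ≥0∞ :=
  ‖U z‖ₑ ^ 2 + ∑ k, ‖G k z‖ₑ ^ 2

lemma measurable_gradDensity {U : SpaceTime d → ℝ} {G : Fin (d + 1) → SpaceTime d → ℝ}
    (hU : Measurable U) (hG : ∀ k, Measurable (G k)) : Measurable (gradDensity U G) :=
  (hU.enorm.pow_const 2).add (Finset.measurable_sum _ fun k _ => (hG k).enorm.pow_const 2)

lemma ofReal_energyDensity (w : SpaceTime d → ℝ) (z : SpaceTime d) :
    ENNReal.ofReal (energyDensity w z) = gradDensity w (fun k => dirD (ex k) w) z := by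
  unfold energyDensity gradDensity
  rw [ENNReal.ofReal_add (sq_nonneg _) (Finset.sum_nonneg fun _ _ => sq_nonneg _),
    ENNReal.ofReal_sum_of_nonneg fun _ _ => sq_nonneg _]
  simp_rw [enorm_sq_eq]

lemma Admissible.measurable_divOp (hA : Admissible A lam Lam ε K) {w : SpaceTime d → ℝ}
    (hw : ContDiff ℝ 2 w) : Measurable (divOp A ex w) := by
  unfold divOp
  exact Finset.measurable_sum _ fun k _ => (contDiff_dirD (m := 0) _ (contDiff_flux (m := 1)
    (fun i j => (hA.contDiff i j).of_le (by norm_num)) hw k) (by norm_num)).continuous.measurable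

/-- The localized Carleman inequality between extended nonnegative integrals. -/
lemma exists_lintegral_carleman (d : ℕ) (hP : GoodParams d lam Lam ε K κ c timeBump) :
    ∃ C : ℝ, 0 < C ∧ ∀ A : Fin (d + 1) → Fin (d + 1) → SpaceTime d → ℝ,
      Admissible A lam Lam ε K → ∀ R : ℝ, 1 < R → ∀ w₁ w₂ : SpaceTime d → ℝ,
      ContDiff ℝ 2 w₁ → ContDiff ℝ 2 w₂ →
      ENNReal.ofReal (κ ^ 3 * lam ^ 2 * R ^ 2) *
          ∫⁻ z, bulkWeight d κ R z * (‖w₁ z‖ₑ ^ 2 + ‖w₂ z‖ₑ ^ 2) ≤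
        2 * (∫⁻ z, bulkWeight d κ R z * (‖-dirD et w₂ z + divOp A ex w₁ z‖ₑ ^ 2 +
          ‖dirD et w₁ z + divOp A ex w₂ z‖ₑ ^ 2)) +
        ENNReal.ofReal C * ∫⁻ z, edgeWeight d κ R z *
          (gradDensity w₁ (fun k => dirD (ex k) w₁) z +
            gradDensity w₂ (fun k => dirD (ex k) w₂) z) := by
  obtain ⟨C, hC, h⟩ := exists_localized_carleman d hP
  refine ⟨C, hC, fun A hA R hR w₁ w₂ h1 h2 => ?_⟩
  have hκ := hP.kappa_pos
  have key := h A hA R hR w₁ w₂ h1 h2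
  have c1 : ∀ (w : SpaceTime d → ℝ), ContDiff ℝ 2 w → ∀ v, Measurable (dirD v w) := fun w hw v =>
    (contDiff_dirD (m := 1) v hw (by norm_num)).continuous.measurable
  have c2 := fun w hw => hA.measurable_divOp (w := w) hw
  have mF : Measurable fun z => bulkWeight d κ R z * (‖-dirD et w₂ z + divOp A ex w₁ z‖ₑ ^ 2 +
      ‖dirD et w₁ z + divOp A ex w₂ z‖ₑ ^ 2) :=
    measurable_bulkWeight.mul (((((c1 w₂ h2 et).neg.add (c2 w₁ h1)).enorm).pow_const 2).add
      ((((c1 w₁ h1 et).add (c2 w₂ h2)).enorm).pow_const 2))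
  rw [← lintegral_const_mul' _ _ ENNReal.ofReal_ne_top, ← lintegral_const_mul' _ _ (by norm_num),
    ← lintegral_const_mul' _ _ ENNReal.ofReal_ne_top, ← lintegral_add_left (mF.const_mul _)]
  refine (le_of_eq ?_).trans (key.trans (lintegral_mono fun z => ?_))
  · refine lintegral_congr fun z => ?_
    unfold bulkWeight
    rw [enorm_sq_eq, enorm_sq_eq, ← ENNReal.ofReal_add (sq_nonneg _) (sq_nonneg _),
      ← ENNReal.ofReal_mul (by positivity), ← ENNReal.ofReal_mul (by positivity)]
    congr 1; ring
  · simp only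
    rw [mul_add]
    refine ENNReal.ofReal_add_le.trans (add_le_add (le_of_eq ?_) (le_of_eq ?_))
    · unfold bulkWeight
      rw [enorm_sq_eq, enorm_sq_eq, ← ENNReal.ofReal_add (sq_nonneg _) (sq_nonneg _),
        ← ENNReal.ofReal_mul (by positivity), ← mul_assoc, ← mul_assoc, mul_comm _ (2 : ℝ),
        mul_assoc, mul_assoc, ENNReal.ofReal_mul (by norm_num), ENNReal.ofReal_ofNat, mul_assoc]
    · unfold edgeWeight
      by_cases hz : z ∈ cutoffEdge d R
      · rw [indicator_of_mem hz, indicator_of_mem hz, ← ofReal_energyDensity,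
          ← ofReal_energyDensity, ← ENNReal.ofReal_add (energyDensity_nonneg _ _)
          (energyDensity_nonneg _ _), ← ENNReal.ofReal_mul (by positivity),
          ← ENNReal.ofReal_mul hC.le]
        congr 1; ring
      · simp [indicator_of_notMem hz]

lemma lintegral_mul_le_of_le {α : Type*} [MeasurableSpace α] {μ : Measure α} {p f : α → ℝ≥0∞}
    {X δ : ℝ≥0∞} (hX : X ≠ ∞) (hp : ∀ z, p z ≤ X) (hf : ∫⁻ z, f z ∂μ ≤ δ) :
    ∫⁻ z, p z * f z ∂μ ≤ X * δ := by
  calc _ ≤ ∫⁻ z, X * f z ∂μ := lintegral_mono fun z => mul_le_mul_left (hp z) _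
    _ = X * ∫⁻ z, f z ∂μ := lintegral_const_mul' _ _ hX
    _ ≤ _ := mul_le_mul_right hf _

lemma lintegral_mul_le_of_le_indicator {α : Type*} [MeasurableSpace α] {μ : Measure α}
    {p f : α → ℝ≥0∞} {X δ : ℝ≥0∞} {s : Set α} (hs : MeasurableSet s) (hX : X ≠ ∞)
    (hp : ∀ z, p z ≤ s.indicator (fun _ => X) z) (hf : ∫⁻ z in s, f z ∂μ ≤ δ) :
    ∫⁻ z, p z * f z ∂μ ≤ X * δ := by
  calc _ ≤ ∫⁻ z, s.indicator (fun z => X * f z) z ∂μ := lintegral_mono fun z => by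
        refine (mul_le_mul_left (hp z) _).trans_eq ?_
        by_cases h : z ∈ s <;> simp [h]
    _ = X * ∫⁻ z in s, f z ∂μ := by rw [lintegral_indicator hs, lintegral_const_mul' _ _ hX]
    _ ≤ _ := mul_le_mul_right hf _

/-- An error of size `c δ` with `c` finite may be dropped when `δ` is arbitrary. -/
lemma ennreal_le_of_add_mul {x y c : ℝ≥0∞} (hc : c ≠ ∞)
    (h : ∀ δ : ℝ≥0∞, 0 < δ → x ≤ y + c * δ) : x ≤ y := by
  refine ENNReal.le_of_forall_pos_le_add fun e he _ => ?_
  refine (h (e / c) (ENNReal.div_pos (by simpa using he.ne') hc)).trans ?_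
  gcongr
  exact ENNReal.mul_div_le

/-- The Carleman estimate for a weak solution; the potential is absorbed when `R` is large. -/
lemma IsRealForm.carleman (h : IsRealForm A M u Du U₁ U₂ G₁ G₂ W₁ W₂)
    (hA : Admissible A lam Lam ε K) (hLam : 0 < Lam) (hK : 0 ≤ K) (hκ : 0 ≤ κ) (hR : 1 < R)
    {C a : ℝ} (ha : 16 * M ^ 2 ≤ a)
    (hC : ∀ w₁ w₂ : SpaceTime d → ℝ, ContDiff ℝ 2 w₁ → ContDiff ℝ 2 w₂ →
      ENNReal.ofReal a * ∫⁻ z, bulkWeight d κ R z * (‖w₁ z‖ₑ ^ 2 + ‖w₂ z‖ₑ ^ 2) ≤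
        2 * (∫⁻ z, bulkWeight d κ R z * (‖-dirD et w₂ z + divOp A ex w₁ z‖ₑ ^ 2 +
          ‖dirD et w₁ z + divOp A ex w₂ z‖ₑ ^ 2)) +
        ENNReal.ofReal C * ∫⁻ z, edgeWeight d κ R z *
          (gradDensity w₁ (fun k => dirD (ex k) w₁) z +
            gradDensity w₂ (fun k => dirD (ex k) w₂) z)) :
    ENNReal.ofReal a * ∫⁻ z, bulkWeight d κ R z * (‖U₁ z‖ₑ ^ 2 + ‖U₂ z‖ₑ ^ 2) ≤
      ENNReal.ofReal (8 * C) * ∫⁻ z, edgeWeight d κ R z *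
        (gradDensity U₁ G₁ z + gradDensity U₂ G₂ z) := by
  set X := ENNReal.ofReal (Real.exp (50 * κ * R ^ 2)) with hXd
  have hX : X ≠ ∞ := ENNReal.ofReal_ne_top
  set p := bulkWeight d κ R with hpd
  set q := edgeWeight d κ R with hqd
  set s : Set (SpaceTime d) := Icc (1 / 8 : ℝ) (7 / 8) ×ˢ univ with hsd
  have hs : MeasurableSet s := measurableSet_Icc.prod MeasurableSet.univ
  have hp := bulkWeight_le (d := d) hκ hR.le
  have hp' : ∀ z, p z ≤ X := fun z => (hp z).trans (indicator_le_self _ _ z)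
  have hq : ∀ z, q z ≤ X := edgeWeight_le_const hκ (by linarith)
  have mp : Measurable p := measurable_bulkWeight
  have mq : Measurable q := measurable_edgeWeight
  set J := ∫⁻ z, p z * (‖U₁ z‖ₑ ^ 2 + ‖U₂ z‖ₑ ^ 2) with hJ
  set Q := ∫⁻ z, q z * (gradDensity U₁ G₁ z + gradDensity U₂ G₂ z) with hQ
  have mU : Measurable fun z => p z * (‖U₁ z‖ₑ ^ 2 + ‖U₂ z‖ₑ ^ 2) :=
    mp.mul ((h.measurable_fun₁.enorm.pow_const 2).add (h.measurable_fun₂.enorm.pow_const 2))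
  have mQ : Measurable fun z => q z * (gradDensity U₁ G₁ z + gradDensity U₂ G₂ z) :=
    mq.mul ((measurable_gradDensity h.measurable_fun₁ h.measurable_grad₁).add
      (measurable_gradDensity h.measurable_fun₂ h.measurable_grad₂))
  have fin2 : ∀ {U : SpaceTime d → ℝ}, MemLp U 2 volume → ∫⁻ z, ‖U z‖ₑ ^ 2 ≠ ∞ := fun hU => by
    rw [← eLpNorm_two_sq]; exact ENNReal.pow_ne_top hU.2.ne
  have hJt : J ≠ ∞ := by
    refine ne_top_of_le_ne_top ?_ (lintegral_mul_le_of_le hX hp' le_rfl)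
    rw [lintegral_add_left (h.measurable_fun₁.enorm.pow_const 2)]
    exact ENNReal.mul_ne_top hX (ENNReal.add_ne_top.2 ⟨fin2 h.memLp_fun₁, fin2 h.memLp_fun₂⟩)
  have potential : ∀ {U W : SpaceTime d → ℝ}, (∀ᵐ z, |W z| ≤ |M| * |U z|) →
      ∀ᵐ z, ‖W z‖ₑ ^ 2 ≤ ENNReal.ofReal (M ^ 2) * ‖U z‖ₑ ^ 2 := fun hW => by
    filter_upwards [hW] with z hz
    rw [enorm_sq_eq, enorm_sq_eq, ← ENNReal.ofReal_mul (sq_nonneg _)]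
    refine ENNReal.ofReal_le_ofReal ?_
    have := pow_le_pow_left₀ (abs_nonneg _) hz 2
    rwa [mul_pow, sq_abs, sq_abs, sq_abs] at this
  set N : ℝ≥0∞ := ((Finset.univ : Finset (Fin (d + 1))).card : ℝ≥0∞) with hN
  have hNt : N ≠ ∞ := by rw [hN]; exact ENNReal.natCast_ne_top _
  have main : ENNReal.ofReal a * J ≤
      8 * ENNReal.ofReal (M ^ 2) * J + 4 * ENNReal.ofReal C * Q := by
    refine ennreal_le_of_add_mul (c := 16 * X + 4 * ENNReal.ofReal C * X * (2 * (1 + N))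
      + 4 * ENNReal.ofReal a * X) ?_ fun δ hδ => ?_
    · finiteness
    obtain ⟨w₁, w₂, c1, c2, a1, a2, a3, a4, a5, a6⟩ := h.exists_smooth_approx hA hLam hK hδ
    have hw := hC w₁ w₂ c1 c2
    have cD : ∀ (w : SpaceTime d → ℝ), ContDiff ℝ 2 w → ∀ v, Measurable (dirD v w) :=
      fun w hw v => (contDiff_dirD (m := 1) v hw (by norm_num)).continuous.measurable
    have cO := fun w hw => hA.measurable_divOp (w := w) hw
    have b1 : J ≤ 2 * (∫⁻ z, p z * (‖w₁ z‖ₑ ^ 2 + ‖w₂ z‖ₑ ^ 2)) + 2 * (X * (δ + δ)) := by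
      have m1 : Measurable fun z => p z * (‖w₁ z‖ₑ ^ 2 + ‖w₂ z‖ₑ ^ 2) :=
        mp.mul ((c1.continuous.measurable.enorm.pow_const 2).add
          (c2.continuous.measurable.enorm.pow_const 2))
      have m2 : Measurable fun z => ‖w₁ z - U₁ z‖ₑ ^ 2 :=
        (c1.continuous.measurable.sub h.measurable_fun₁).enorm.pow_const 2
      have e1 : ∫⁻ z, p z * (‖w₁ z - U₁ z‖ₑ ^ 2 + ‖w₂ z - U₂ z‖ₑ ^ 2) ≤ X * (δ + δ) :=
        lintegral_mul_le_of_le hX hp' (by rw [lintegral_add_left m2]; exact add_le_add a1 a2)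
      refine le_trans ?_ (add_le_add_right (mul_le_mul_right e1 2) _)
      rw [← lintegral_const_mul' _ _ (by norm_num), ← lintegral_const_mul' _ _ (by norm_num),
        ← lintegral_add_left (m1.const_mul _)]
      refine lintegral_mono fun z => ?_
      have k1 : ‖U₁ z‖ₑ ^ 2 ≤ 2 * ‖w₁ z‖ₑ ^ 2 + 2 * ‖w₁ z - U₁ z‖ₑ ^ 2 := by
        have := enorm_add_sq_le (w₁ z) (-(w₁ z - U₁ z))
        rw [enorm_neg] at this
        convert this using 3; ring
      have k2 : ‖U₂ z‖ₑ ^ 2 ≤ 2 * ‖w₂ z‖ₑ ^ 2 + 2 * ‖w₂ z - U₂ z‖ₑ ^ 2 := by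
        have := enorm_add_sq_le (w₂ z) (-(w₂ z - U₂ z))
        rw [enorm_neg] at this
        convert this using 3; ring
      calc _ ≤ p z * ((2 * ‖w₁ z‖ₑ ^ 2 + 2 * ‖w₁ z - U₁ z‖ₑ ^ 2) +
            (2 * ‖w₂ z‖ₑ ^ 2 + 2 * ‖w₂ z - U₂ z‖ₑ ^ 2)) := by gcongr
        _ = _ := by ring
    -- The equation replaces the source term by the potential term and the residual.
    have b2 : ∫⁻ z, p z * (‖-dirD et w₂ z + divOp A ex w₁ z‖ₑ ^ 2 +
        ‖dirD et w₁ z + divOp A ex w₂ z‖ₑ ^ 2) ≤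
        2 * ENNReal.ofReal (M ^ 2) * J + 2 * (X * (δ + δ)) := by
      have m2 : Measurable fun z => ‖-dirD et w₂ z + divOp A ex w₁ z + W₁ z‖ₑ ^ 2 :=
        (((cD w₂ c2 et).neg.add (cO w₁ c1)).add h.measurable_pot₁).enorm.pow_const 2
      have e1 : ∫⁻ z, p z * (‖-dirD et w₂ z + divOp A ex w₁ z + W₁ z‖ₑ ^ 2 +
          ‖dirD et w₁ z + divOp A ex w₂ z + W₂ z‖ₑ ^ 2) ≤ X * (δ + δ) :=
        lintegral_mul_le_of_le_indicator hs hX hp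
          (by rw [lintegral_add_left m2]; exact add_le_add a5 a6)
      refine le_trans ?_ (add_le_add_right (mul_le_mul_right e1 2) _)
      rw [← lintegral_const_mul' _ _ (by finiteness), ← lintegral_const_mul' _ _ (by norm_num),
        ← lintegral_add_left (mU.const_mul _)]
      refine lintegral_mono_ae ?_
      filter_upwards [potential h.abs_pot₁_le, potential h.abs_pot₂_le] with z k3 k4
      have k1 := enorm_add_sq_le (-dirD et w₂ z + divOp A ex w₁ z + W₁ z) (-W₁ z)
      have k2 := enorm_add_sq_le (dirD et w₁ z + divOp A ex w₂ z + W₂ z) (-W₂ z)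
      rw [enorm_neg, add_neg_cancel_right] at k1 k2
      calc _ ≤ p z * ((2 * ‖-dirD et w₂ z + divOp A ex w₁ z + W₁ z‖ₑ ^ 2 +
              2 * (ENNReal.ofReal (M ^ 2) * ‖U₁ z‖ₑ ^ 2)) +
            (2 * ‖dirD et w₁ z + divOp A ex w₂ z + W₂ z‖ₑ ^ 2 +
              2 * (ENNReal.ofReal (M ^ 2) * ‖U₂ z‖ₑ ^ 2))) := by
            gcongr
            · exact k1.trans (by gcongr)
            · exact k2.trans (by gcongr)
        _ = _ := by ring
    have b3 : ∫⁻ z, q z * (gradDensity w₁ (fun k => dirD (ex k) w₁) z +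
        gradDensity w₂ (fun k => dirD (ex k) w₂) z) ≤ 2 * Q + 2 * (X * (2 * (1 + N) * δ)) := by
      have md : ∀ {w U : SpaceTime d → ℝ} {G : Fin (d + 1) → SpaceTime d → ℝ}, ContDiff ℝ 2 w →
          Measurable U → (∀ k, Measurable (G k)) → Measurable
          (gradDensity (fun z => w z - U z) fun k z => dirD (ex k) w z - G k z) :=
        fun hw hU hG => measurable_gradDensity (hw.continuous.measurable.sub hU)
          fun k => (cD _ hw _).sub (hG k)
      have hd : ∀ {w U : SpaceTime d → ℝ} {G : Fin (d + 1) → SpaceTime d → ℝ}, ContDiff ℝ 2 w →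
          Measurable U → (∀ k, Measurable (G k)) → ∫⁻ z, ‖w z - U z‖ₑ ^ 2 ≤ δ →
          (∀ k, ∫⁻ z, ‖dirD (ex k) w z - G k z‖ₑ ^ 2 ≤ δ) →
          ∫⁻ z, gradDensity (fun z => w z - U z) (fun k z => dirD (ex k) w z - G k z) z
            ≤ (1 + N) * δ := by
        intro w U G hw hU hG h1 h2
        unfold gradDensity
        beta_reduce
        rw [lintegral_add_left (f := fun z => ‖w z - U z‖ₑ ^ 2)
            ((hw.continuous.measurable.sub hU).enorm.pow_const 2),
          lintegral_finsetSum (f := fun k z => ‖dirD (ex k) w z - G k z‖ₑ ^ 2) _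
            fun k _ => ((cD _ hw _).sub (hG k)).enorm.pow_const 2,
          add_mul, one_mul]
        refine add_le_add h1 ((Finset.sum_le_card_nsmul _ _ δ fun k _ => h2 k).trans_eq ?_)
        rw [nsmul_eq_mul]
      have hl : ∀ {w U : SpaceTime d → ℝ} {G : Fin (d + 1) → SpaceTime d → ℝ} (z),
          gradDensity w (fun k => dirD (ex k) w) z ≤ 2 * gradDensity U G z + 2 *
            gradDensity (fun z => w z - U z) (fun k z => dirD (ex k) w z - G k z) z := by
        intro w U G z
        have sq : ∀ x y : ℝ, ‖x‖ₑ ^ 2 ≤ 2 * ‖y‖ₑ ^ 2 + 2 * ‖x - y‖ₑ ^ 2 := fun x y => by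
          simpa using enorm_add_sq_le y (x - y)
        unfold gradDensity
        calc _ ≤ (2 * ‖U z‖ₑ ^ 2 + 2 * ‖w z - U z‖ₑ ^ 2) + ∑ k,
              (2 * ‖G k z‖ₑ ^ 2 + 2 * ‖dirD (ex k) w z - G k z‖ₑ ^ 2) := by
              gcongr <;> exact sq _ _
          _ = _ := by rw [Finset.sum_add_distrib, ← Finset.mul_sum, ← Finset.mul_sum]; ring
      have e1 : ∫⁻ z, q z *
          (gradDensity (fun z => w₁ z - U₁ z) (fun k z => dirD (ex k) w₁ z - G₁ k z) z +
          gradDensity (fun z => w₂ z - U₂ z) (fun k z => dirD (ex k) w₂ z - G₂ k z) z)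
          ≤ X * (2 * (1 + N) * δ) := by
        refine lintegral_mul_le_of_le hX hq ?_
        rw [lintegral_add_left (md c1 h.measurable_fun₁ h.measurable_grad₁)]
        refine (add_le_add (hd c1 h.measurable_fun₁ h.measurable_grad₁ a1 a3)
          (hd c2 h.measurable_fun₂ h.measurable_grad₂ a2 a4)).trans_eq (by ring)
      refine le_trans ?_ (add_le_add_right (mul_le_mul_right e1 2) _)
      rw [← lintegral_const_mul' _ _ (by norm_num), ← lintegral_const_mul' _ _ (by norm_num),
        ← lintegral_add_left (mQ.const_mul _)]
      refine lintegral_mono fun z => ?_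
      calc _ ≤ q z * ((2 * gradDensity U₁ G₁ z + 2 *
            gradDensity (fun z => w₁ z - U₁ z) (fun k z => dirD (ex k) w₁ z - G₁ k z) z) +
            (2 * gradDensity U₂ G₂ z + 2 *
            gradDensity (fun z => w₂ z - U₂ z) (fun k z => dirD (ex k) w₂ z - G₂ k z) z)) := by
            gcongr <;> exact hl z
        _ = _ := by ring
    calc ENNReal.ofReal a * J
        ≤ ENNReal.ofReal a * (2 * (∫⁻ z, p z * (‖w₁ z‖ₑ ^ 2 + ‖w₂ z‖ₑ ^ 2))
          + 2 * (X * (δ + δ))) := by gcongr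
      _ = 2 * (ENNReal.ofReal a * ∫⁻ z, p z * (‖w₁ z‖ₑ ^ 2 + ‖w₂ z‖ₑ ^ 2))
          + 4 * ENNReal.ofReal a * X * δ := by ring
      _ ≤ 2 * (2 * (2 * ENNReal.ofReal (M ^ 2) * J + 2 * (X * (δ + δ))) +
          ENNReal.ofReal C * (2 * Q + 2 * (X * (2 * (1 + N) * δ))))
          + 4 * ENNReal.ofReal a * X * δ := by
          gcongr
          refine hw.trans ?_
          gcongr
      _ = _ := by ring
  -- Since `16 M² ≤ a`, half of the left hand side absorbs the potential.
  have half : 2 * (8 * ENNReal.ofReal (M ^ 2) * J) ≤ ENNReal.ofReal a * J := by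
    calc 2 * (8 * ENNReal.ofReal (M ^ 2) * J) = ENNReal.ofReal (16 * M ^ 2) * J := by
          rw [ENNReal.ofReal_mul (by norm_num)]; norm_num; ring
      _ ≤ _ := by gcongr
  have hat : ENNReal.ofReal a * J ≠ ∞ := ENNReal.mul_ne_top ENNReal.ofReal_ne_top hJt
  have e8 : ENNReal.ofReal (8 * C) * Q = 2 * (4 * ENNReal.ofReal C * Q) := by
    rw [ENNReal.ofReal_mul (by norm_num)]; norm_num; ring
  rw [e8]
  refine (ENNReal.add_le_add_iff_left hat).1 ?_
  calc ENNReal.ofReal a * J + ENNReal.ofReal a * J = 2 * (ENNReal.ofReal a * J) := by ring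
    _ ≤ 2 * (8 * ENNReal.ofReal (M ^ 2) * J + 4 * ENNReal.ofReal C * Q) := by gcongr
    _ ≤ _ := by rw [mul_add]; gcongr

end WeightedEstimate

/-! ### The lower bound on shells -/

section LowerBound

open Filter

variable {d : ℕ} {A : Fin (d + 1) → Fin (d + 1) → SpaceTime d → ℝ} {lam Lam ε K κ M R : ℝ}
  {u : SpaceTime d → ℂ} {Du : SpaceTime d → EuclideanSpace ℂ (Fin (d + 1))}
  {U₁ U₂ : SpaceTime d → ℝ} {G₁ G₂ : Fin (d + 1) → SpaceTime d → ℝ} {W₁ W₂ : SpaceTime d → ℝ}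

lemma enorm_add_I_mul_sq (x y : ℝ) :
    ‖(x : ℂ) + Complex.I * y‖ₑ ^ 2 = ‖x‖ₑ ^ 2 + ‖y‖ₑ ^ 2 := by
  rw [enorm_sq_eq, enorm_sq_eq, ← ENNReal.ofReal_add (sq_nonneg _) (sq_nonneg _), ← ofReal_norm,
    ← ENNReal.ofReal_pow (norm_nonneg _), Complex.sq_norm, mul_comm, Complex.normSq_add_mul_I]

lemma enorm_euclideanSpace_sq (v : EuclideanSpace ℂ (Fin (d + 1))) :
    ‖v‖ₑ ^ 2 = ∑ k, ‖v k‖ₑ ^ 2 := by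
  simp_rw [← ofReal_norm, ← ENNReal.ofReal_pow (norm_nonneg _)]
  rw [EuclideanSpace.norm_sq_eq, ENNReal.ofReal_sum_of_nonneg fun _ _ => sq_nonneg _]

lemma IsRealForm.enorm_fun_sq (h : IsRealForm A M u Du U₁ U₂ G₁ G₂ W₁ W₂) :
    ∀ᵐ z, z ∈ slab d → ‖u z‖ₑ ^ 2 = ‖U₁ z‖ₑ ^ 2 + ‖U₂ z‖ₑ ^ 2 := by
  filter_upwards [h.fun_eq] with z hz hs
  rw [hz hs, enorm_add_I_mul_sq]

lemma IsRealForm.energy_eq (h : IsRealForm A M u Du U₁ U₂ G₁ G₂ W₁ W₂) :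
    ∀ᵐ z, z ∈ slab d → gradDensity U₁ G₁ z + gradDensity U₂ G₂ z = ‖u z‖ₑ ^ 2 + ‖Du z‖ₑ ^ 2 := by
  filter_upwards [h.enorm_fun_sq, h.grad_eq] with z hz hg hs
  rw [hz hs, enorm_euclideanSpace_sq]
  simp_rw [hg hs, enorm_add_I_mul_sq, Finset.sum_add_distrib]
  unfold gradDensity
  ring

/-- The bulk term is bounded below by the mass on the inner cylinder. -/
lemma IsRealForm.le_bulk (h : IsRealForm A M u Du U₁ U₂ G₁ G₂ W₁ W₂) (hκ : 0 ≤ κ) {R₀ : ℝ}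
    (hR₀ : R₀ ^ 2 ≤ R ^ 2 - R) (hR : 0 < R) (hR' : R₀ ≤ R) :
    ENNReal.ofReal (Real.exp (18 * κ * R ^ 2)) * (∫⁻ z in Icc (1 / 4 : ℝ) (3 / 4) ×ˢ
      Metric.closedBall (0 : EuclideanSpace ℝ (Fin (d + 1))) R₀, ‖u z‖ₑ ^ 2) ≤
    ∫⁻ z, bulkWeight d κ R z * (‖U₁ z‖ₑ ^ 2 + ‖U₂ z‖ₑ ^ 2) := by
  rw [← lintegral_const_mul' _ _ ENNReal.ofReal_ne_top]
  refine (setLIntegral_mono_ae' (measurableSet_Icc.prod measurableSet_closedBall) ?_).trans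
    (setLIntegral_le_lintegral _ _)
  filter_upwards [h.enorm_fun_sq] with z hz hs
  have hs' : z ∈ slab d := ⟨⟨by linarith [hs.1.1], by linarith [hs.1.2]⟩, mem_univ _⟩
  rw [hz hs']
  exact mul_le_mul_left (le_bulkWeight hκ hR₀ hR hR' hs) _

/-- The edge term is bounded by the total energy, with a small weight, and the energy in the
shell, with a large weight. -/
lemma IsRealForm.edge_le (h : IsRealForm A M u Du U₁ U₂ G₁ G₂ W₁ W₂) (hκ : 0 ≤ κ) (hR : 0 ≤ R) :
    ∫⁻ z, edgeWeight d κ R z * (gradDensity U₁ G₁ z + gradDensity U₂ G₂ z) ≤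
      ENNReal.ofReal (Real.exp (8 * κ * R ^ 2)) * energyOn u Du (Icc (1 / 8) (7 / 8)) univ +
      ENNReal.ofReal (Real.exp (50 * κ * R ^ 2)) * energyOn u Du (Icc (1 / 8) (7 / 8))
        (Metric.closedBall 0 R \ Metric.closedBall 0 (R - 1)) := by
  have mg : Measurable fun z => gradDensity U₁ G₁ z + gradDensity U₂ G₂ z :=
    (measurable_gradDensity h.measurable_fun₁ h.measurable_grad₁).add
      (measurable_gradDensity h.measurable_fun₂ h.measurable_grad₂)
  have part : ∀ (S : Set (EuclideanSpace ℝ (Fin (d + 1)))) (X : ℝ), MeasurableSet S →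
      ∫⁻ z, (Icc (1 / 8 : ℝ) (7 / 8) ×ˢ S).indicator (fun _ => ENNReal.ofReal X) z *
        (gradDensity U₁ G₁ z + gradDensity U₂ G₂ z) =
      ENNReal.ofReal X * energyOn u Du (Icc (1 / 8) (7 / 8)) S := by
    intro S X hS
    have hm : MeasurableSet (Icc (1 / 8 : ℝ) (7 / 8) ×ˢ S) := measurableSet_Icc.prod hS
    have e : ∀ z, (Icc (1 / 8 : ℝ) (7 / 8) ×ˢ S).indicator (fun _ => ENNReal.ofReal X) z *
        (gradDensity U₁ G₁ z + gradDensity U₂ G₂ z) = (Icc (1 / 8 : ℝ) (7 / 8) ×ˢ S).indicator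
        (fun z => ENNReal.ofReal X * (gradDensity U₁ G₁ z + gradDensity U₂ G₂ z)) z := by
      intro z
      by_cases hz : z ∈ Icc (1 / 8 : ℝ) (7 / 8) ×ˢ S
      · rw [indicator_of_mem hz, indicator_of_mem hz]
      · rw [indicator_of_notMem hz, indicator_of_notMem hz, zero_mul]
    simp_rw [e]
    rw [lintegral_indicator hm, lintegral_const_mul' _ _ ENNReal.ofReal_ne_top]
    congr 1
    refine setLIntegral_congr_fun_ae hm ?_
    filter_upwards [h.energy_eq] with z hz hs
    exact hz ⟨⟨by linarith [hs.1.1], by linarith [hs.1.2]⟩, mem_univ _⟩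
  have m1 : Measurable fun z : SpaceTime d => (Icc (1 / 8 : ℝ) (7 / 8) ×ˢ univ).indicator
      (fun _ => ENNReal.ofReal (Real.exp (8 * κ * R ^ 2))) z *
        (gradDensity U₁ G₁ z + gradDensity U₂ G₂ z) :=
    (measurable_const.indicator (measurableSet_Icc.prod MeasurableSet.univ)).mul mg
  rw [← part _ _ MeasurableSet.univ, ← part _ _ (measurableSet_closedBall.diff
    measurableSet_closedBall), ← lintegral_add_left m1]
  refine lintegral_mono fun z => ?_
  rw [← add_mul]
  exact mul_le_mul_left (edgeWeight_le hκ hR z) _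

/-- Comparison of the growth rates of the weight: the part of the edge term carried by the total
energy is absorbed for large `R`. -/
lemma shell_lower_bound {a b C E₁ E₂ : ℝ} {S : ℝ≥0∞} (hκ : 0 ≤ κ) (hb : 0 ≤ b) (hC : 0 < C)
    (hba : b ≤ a) (hlarge : 16 * C * E₁ ^ 2 ≤ a * E₂ ^ 2)
    (h : ENNReal.ofReal a * (ENNReal.ofReal (Real.exp (18 * κ * R ^ 2)) * ENNReal.ofReal (E₂ ^ 2)) ≤
      ENNReal.ofReal (8 * C) * (ENNReal.ofReal (Real.exp (8 * κ * R ^ 2)) *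
        ENNReal.ofReal (E₁ ^ 2) + ENNReal.ofReal (Real.exp (50 * κ * R ^ 2)) * S)) :
    ENNReal.ofReal (b * E₂ ^ 2 / (16 * C) * Real.exp (-(32 * κ) * R ^ 2)) ≤ S := by
  rcases eq_or_ne S ∞ with rfl | hS
  · exact le_top
  lift S to ℝ≥0 using hS
  have ha : 0 ≤ a := hb.trans hba
  rw [← ENNReal.ofReal_coe_nnreal, ← ENNReal.ofReal_mul (by positivity),
    ← ENNReal.ofReal_mul (by positivity), ← ENNReal.ofReal_mul (by positivity),
    ← ENNReal.ofReal_mul (by positivity), ← ENNReal.ofReal_add (by positivity) (by positivity),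
    ← ENNReal.ofReal_mul (by positivity), ENNReal.ofReal_le_ofReal_iff (by positivity)] at h
  rw [← ENNReal.ofReal_coe_nnreal]
  refine ENNReal.ofReal_le_ofReal ?_
  set s : ℝ := (S : ℝ)
  set p := Real.exp (8 * κ * R ^ 2) with hp
  set q := Real.exp (10 * κ * R ^ 2) with hq
  set r := Real.exp (32 * κ * R ^ 2) with hr
  have e1 : Real.exp (18 * κ * R ^ 2) = p * q := by rw [← Real.exp_add]; congr 1; ring
  have e2 : Real.exp (50 * κ * R ^ 2) = p * q * r := by
    rw [← Real.exp_add, ← Real.exp_add]; congr 1; ring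
  have e3 : Real.exp (-(32 * κ) * R ^ 2) = r⁻¹ := by rw [← Real.exp_neg]; congr 1; ring
  have hp0 : 0 < p := Real.exp_pos _
  have hr0 : 0 < r := Real.exp_pos _
  have hq1 : 1 ≤ q := Real.one_le_exp (by positivity)
  rw [e1, e2] at h
  have h1 : a * (q * E₂ ^ 2) ≤ 8 * C * (E₁ ^ 2 + q * r * s) := by
    refine le_of_mul_le_mul_left ?_ hp0
    linarith
  have h2 : 8 * C * E₁ ^ 2 ≤ a * E₂ ^ 2 / 2 * q := by
    have : a * E₂ ^ 2 / 2 * 1 ≤ a * E₂ ^ 2 / 2 * q := by gcongr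
    linarith
  have h3 : a * E₂ ^ 2 / 2 ≤ 8 * C * (r * s) := by
    refine le_of_mul_le_mul_left ?_ (by linarith : 0 < q)
    linarith
  have h4 : b * E₂ ^ 2 ≤ a * E₂ ^ 2 := by gcongr
  rw [e3, ← div_eq_mul_inv, div_div, div_le_iff₀ (by positivity)]
  linarith

end LowerBound

/-- The choice of `ε₀` precedes that of `κ`, which alone depends on the bound `K`. -/
lemma exists_goodParams (d : ℕ) {lam Lam : ℝ} (hlam : 0 < lam) (hLam : 0 < Lam) (K : ℝ≥0) :
    ∃ κ c : ℝ, GoodParams d lam Lam (lam ^ 2 / (3 * (d + 1 : ℝ) ^ 3 * Lam)) K κ c timeBump := by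
  obtain ⟨c, hc1, hc2⟩ := exists_bound_deriv_timeBump
  have hc : 0 ≤ c := (abs_nonneg _).trans (hc1 0)
  set T : ℝ := 2 * c + 36 * (d + 1 : ℝ) ^ 7 * Lam ^ 2 * (K : ℝ) ^ 2 / lam ^ 2
    + 16 * (d + 1 : ℝ) * Lam ^ 2 * c ^ 2 / lam ^ 2 with hT
  have hT0 : 0 ≤ T := by positivity
  have hT1 : 0 ≤ T / lam ^ 2 := by positivity
  refine ⟨1 + T / lam ^ 2, c,
    { lam_pos := hlam
      Lam_pos := hLam
      eps_nonneg := by positivity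
      K_nonneg := K.2
      contDiff := contDiff_timeBump
      deriv_le := hc1
      deriv_deriv_le := hc2
      eps_small := by rw [mul_div_cancel₀ _ (by positivity)]
      kappa_pos := by positivity
      kappa_large := ?_ }⟩
  rw [← hT, ← div_le_iff₀ (by positivity)]
  nlinarith

end Carleman

open Carleman in
theorem theorem6p3 (d : ℕ) (lam Lam : ℝ) (hlam : 0 < lam) (hLam : 0 < Lam) :
    ∃ ε₀ : ℝ, 0 < ε₀ ∧ ∀ K : ℝ≥0,
    ∃ C₀ : ℝ, 0 < C₀ ∧ ∀ M₁ E₁ E₂ R₀ : ℝ, 0 < E₂ ^ 2 →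
    ∃ R₁ : ℝ, 0 < R₁ ∧ ∃ C₁ : ℝ, 0 < C₁ ∧
    ∀ (a : ℝ) (B : EuclideanSpace ℝ (Fin d) → Matrix (Fin d) (Fin d) ℝ)
      (V : ℝ × EuclideanSpace ℝ (Fin (d + 1)) → ℝ)
      (u : ℝ × EuclideanSpace ℝ (Fin (d + 1)) → ℂ)
      (Du : ℝ × EuclideanSpace ℝ (Fin (d + 1)) → EuclideanSpace ℂ (Fin (d + 1))),
      0 < a →
      (∀ y, (B y).IsSymm) →
      (∀ j k, ContDiff ℝ 3 (fun y => B y j k)) →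
      c3Norm B ≤ (K : ℝ≥0∞) →
      IsEllipticField lam Lam (blockCoeff a B) →
      (∀ y, ‖y‖ * gradNorm B y ≤ ε₀) →
      MemLp V ∞ (volume.restrict (Icc (0 : ℝ) 1 ×ˢ univ)) →
      eLpNorm V ∞ (volume.restrict (Icc (0 : ℝ) 1 ×ˢ univ)) ≤ ENNReal.ofReal M₁ →
      MemLinfL2 u →
      MemL2H1 u Du →
      IsWeakSolution (blockCoeff a B) V u Du →
      energyOn u Du (Icc (1 / 8) (7 / 8)) univ ≤ ENNReal.ofReal (E₁ ^ 2) →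
      ENNReal.ofReal (E₂ ^ 2) ≤
        ∫⁻ z in Icc (1 / 4 : ℝ) (3 / 4) ×ˢ
          Metric.closedBall (0 : EuclideanSpace ℝ (Fin (d + 1))) R₀, ‖u z‖ₑ ^ 2 →
      ∀ R : ℝ, R₁ < R →
        ENNReal.ofReal (C₁ * Real.exp (-C₀ * R ^ 2)) ≤
          energyOn u Du (Icc (1 / 8) (7 / 8))
            (Metric.closedBall 0 R \ Metric.closedBall 0 (R - 1)) := by

  refine ⟨lam ^ 2 / (3 * (d + 1 : ℝ) ^ 3 * Lam), by positivity, fun K => ?_⟩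
  obtain ⟨κ, c, hP⟩ := exists_goodParams d hlam hLam K
  obtain ⟨C, hC, hCar⟩ := exists_lintegral_carleman d hP
  have hκ := hP.kappa_pos
  refine ⟨32 * κ, by positivity, fun M₁ E₁ E₂ R₀ hE₂ => ?_⟩
  set b : ℝ := κ ^ 3 * lam ^ 2 with hb
  have hb0 : 0 < b := by positivity
  refine ⟨R₀ ^ 2 + 2 + 16 * M₁ ^ 2 / b + 16 * C * E₁ ^ 2 / (b * E₂ ^ 2), by positivity,
    b * E₂ ^ 2 / (16 * C), by positivity, ?_⟩
  intro a B V u Du _ hsymm hsmooth hK hell hsm hV hVM _ hu hsol hE₁ hmass R hR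
  have p1 : 0 ≤ 16 * M₁ ^ 2 / b := by positivity
  have p2 : 0 ≤ 16 * C * E₁ ^ 2 / (b * E₂ ^ 2) := by positivity
  have hR2 : 2 < R := by linarith [sq_nonneg R₀]
  have hR0 : R₀ ^ 2 ≤ R := by linarith
  have hRR : R ≤ R ^ 2 := by nlinarith
  have hM : 16 * M₁ ^ 2 ≤ b * R ^ 2 := by
    have : 16 * M₁ ^ 2 / b ≤ R ^ 2 := by linarith [sq_nonneg R₀]
    rwa [div_le_iff₀' hb0] at this
  have hE : 16 * C * E₁ ^ 2 ≤ b * R ^ 2 * E₂ ^ 2 := by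
    have : 16 * C * E₁ ^ 2 / (b * E₂ ^ 2) ≤ R ^ 2 := by linarith [sq_nonneg R₀]
    rw [div_le_iff₀' (by positivity)] at this
    linarith
  have hA := admissible_coef (a := a) hlam hP.eps_nonneg hsymm hsmooth hK hell hsm
  obtain ⟨U₁, U₂, G₁, G₂, W₁, W₂, h⟩ := exists_isRealForm
    (fun i j => (hA.contDiff i j).continuous) hV hVM hu hsol
  have key := h.carleman hA hLam K.2 hκ.le (by linarith : 1 < R) hM
    (hCar _ hA R (by linarith))
  have low := h.le_bulk hκ.le (R := R) (R₀ := R₀) (by nlinarith) (by linarith)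
    (by nlinarith [sq_nonneg (R₀ - 1)])
  have up := h.edge_le hκ.le (R := R) (by linarith)
  refine shell_lower_bound hκ.le hb0.le hC (a := b * R ^ 2) (by nlinarith) hE ?_
  calc _ ≤ ENNReal.ofReal (b * R ^ 2) * ∫⁻ z, bulkWeight d κ R z * (‖U₁ z‖ₑ ^ 2 + ‖U₂ z‖ₑ ^ 2) := by
        gcongr
        exact le_trans (by gcongr) low
    _ ≤ _ := key
    _ ≤ _ := by
        gcongr
        refine up.trans ?_
        gcongr
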